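/- Let $H^m=\mathbb R^{2m+1}$ be the Heisenberg group, with points $q=(x,y,t)$, $x,y\in\mathbb R^m$, $t\in\mathbb R$, and left-invariant fields $X_j=\partial_{x_j}+2y_j\partial_t$, $Y_j=\partial_{y_j}-2x_j\partial_t$ $(1\le j\le m)$. Write $\nabla_{H^m}u=\sum_j (X_ju)X_j+(Y_ju)Y_j$, $\nabla_{H^m}u\cdot\nabla_{H^m}v=\sum_j (X_ju\,X_jv+Y_ju\,Y_jv)$ and $|\nabla_{H^m}u|=(\nabla_{H^m}u\cdot\nabla_{H^m}u)^{1/2}$. Let $\varphi,f,h,g$ be real functions and $\tau\ge 0$, $\theta<2$ real numbers such that: - ($\Phi$) $\varphi\in C^0([0,\infty))\cap C^1((0,\infty))$, $\varphi(0)=0$, $\varphi'>0$ on $(0,\infty)$; - ($F$) $f\in C^0([0,\infty))$, $f>0$ on $(0,\infty)$, and $f$ is increasing (not necessarily strictly) on $[0,\infty)$; - ($H$) $h\in C^0((0,\infty))$, $h\ge0$, $h\in L^1(0^+)$, and $h$ is non-increasing on $(0,\infty)$; - ($\Phi0$) $t\varphi'(t)\in L^1(0^+)$; - ($\Phi2$)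 for some $D>0$: $s\varphi'(st)\le D s^{\tau}\varphi'(t)$ for all $s\in[0,1]$, $t>0$ (the left side being $0$ for $s=0$); - ($\Phi3$) for some $B>0$: $\varphi'(ts)\ge B\varphi'(t)s^{-\theta}$ for all $t>0$, $s\ge1$; - ($G$) $g$ is a non-negative measurable function on $[0,\infty)$ and, for some $\widetilde D>0$ and the same $\tau$ as in ($\Phi2$), $g(st)\le\widetilde D s^{\tau+1}t^2\varphi'(t)$ for all $s\in[0,1]$, $t>0$. Let $K(t)=\int_0^t s\varphi'(s)\,ds$, which is a bijection of $[0,\infty)$ onto itself, let $K^{-1}$ be its inverse, and let $\hat F(t)=\int_0^t f(s)\,e^{(2-\theta)\int_0^s h(x)\,dx}\,ds$, with $\theta$ as in ($\Phi3$). Assume the Keller–Osserman condition $$\frac{e^{\int_0^t h(x)\,dx}}{K^{-1}(\hat F(t))}\in L^1(+\infty).$$ Let $u\in C^1(H^m)$, $u\ge0$, be a weak solution of $\Delta^\varphi_{H^m}u\ge f(u)-h(u)g(|\nabla_{H^m}u|)$ on $H^m$, that is, for every $\zeta\in C_c^\infty(H^m)$, $\zeta\ge0$, $$-\int_{\mathbb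 R^{2m+1}}\frac{\varphi(|\nabla_{H^m}u|)}{|\nabla_{H^m}u|}\,\nabla_{H^m}u\cdot\nabla_{H^m}\zeta\ \ge\ \int_{\mathbb R^{2m+1}}\bigl(f(u)-h(u)g(|\nabla_{H^m}u|)\bigr)\zeta,$$ where the integrand on the left is $0$ where $\nabla_{H^m}u=0$, the product $h(u)g(|\nabla_{H^m}u|)$ is $0$ where $u=0$ (there $\nabla_{H^m}u=0$, and $g(0)=0$ by ($G$)), and the inequality is no condition on $\zeta$ if the right-hand integral is $-\infty$. Then $u\equiv0$. -/

import Mathlib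

/-!
A solution is compared with barriers that blow up on spheres of the Korányi gauge
`r = (|z|⁴ + t²)^(1/4)`. The Keller–Osserman condition is Osgood's condition for the equation
`A' = e^(-∫_0^A h) K⁻¹(F̂(A) - F̂(ε))`, so a solution leaves the rest point `ε` and becomes infinite
in finite time. Slowed down by a small factor it becomes a profile `α` that equals `ε` on
`(-∞, 1]`, is still small at a prescribed `r`, and blows up at some finite `R`. As `|∇r| ≤ 1`, `r`
is `∞`-harmonic and `div ∇r = (2m + 1) |∇r|² / r`, the barrier `α(r)` is a supersolution with the
smaller source `f / 2`. Its flux may fail to be differentiable where its gradient vanishes; this is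
repaired by truncating the flux.

If `u` exceeded the barrier `v` somewhere, `u - v` would have a positive interior maximum. There the
gradients agree, so the source of `u` is strictly larger than that of `v`, and testing with
`((u - v - c)⁺)²` for a level `c` just below the maximum contradicts the monotonicity of the flux.
Hence `u ≤ v`, and `v` is arbitrarily small at any given point.
-/

namespace Heisenberg

/-- The underlying manifold `ℝ^(2m+1)` of the Heisenberg group `H^m`, with points
`q = (x, y, t)`; it carries the Lebesgue measure `MeasureTheory.volume`. -/
abbrev Point (m : ℕ) : Type := (Fin m → ℝ) × (Fin m → ℝ) × ℝ

/-- The left-invariant field `X_j = ∂/∂x_j + 2 y_j ∂/∂t`, acting on `u` at `q`. -/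
noncomputable def X {m : ℕ} (j : Fin m) (u : Point m → ℝ) (q : Point m) : ℝ :=
  fderiv ℝ u q (Pi.single j 1, 0, 2 * q.2.1 j)

/-- The left-invariant field `Y_j = ∂/∂y_j - 2 x_j ∂/∂t`, acting on `u` at `q`. -/
noncomputable def Y {m : ℕ} (j : Fin m) (u : Point m → ℝ) (q : Point m) : ℝ :=
  fderiv ℝ u q (0, Pi.single j 1, -2 * q.1 j)

/-- The product `∇_H u · ∇_H v = ∑_j (X_j u)(X_j v) + (Y_j u)(Y_j v)` of Heisenberg gradients. -/
noncomputable def gradDot {m : ℕ} (u v : Point m → ℝ) (q : Point m) : ℝ :=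
  ∑ j : Fin m, (X j u q * X j v q + Y j u q * Y j v q)

/-- The length `|∇_H u|` of the Heisenberg gradient. -/
noncomputable def gradNorm {m : ℕ} (u : Point m → ℝ) (q : Point m) : ℝ :=
  Real.sqrt (gradDot u u q)

/-- `u` satisfies `Δ^φ u ≥ f(u) - h(u) g(|∇_H u|)` on `H^m` in the weak sense:
`∫ (f(u) - h(u) g(|∇_H u|)) ζ ≤ -∫ |∇_H u|⁻¹ φ(|∇_H u|) ∇_H u · ∇_H ζ`
for all smooth compactly supported `ζ ≥ 0`.

For `u ∈ C¹` the functions `f(u) ζ` and `|∇_H u|⁻¹ φ(|∇_H u|) ∇_H u · ∇_H ζ` (zero where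
`∇_H u = 0`) are continuous with compact support, and `h(u) g(|∇_H u|) ζ ≥ 0`.  So the left
integral can only fail to converge by being `-∞` (when `h` is unbounded near `0`), in which case
the inequality is no condition. -/
def IsWeakSolution {m : ℕ} (φ f h g : ℝ → ℝ) (u : Point m → ℝ) : Prop :=
  ∀ ζ : Point m → ℝ, ContDiff ℝ (⊤ : ℕ∞) ζ → HasCompactSupport ζ → (∀ q, 0 ≤ ζ q) →
    MeasureTheory.Integrable
      (fun q => (f (u q) - h (u q) * g (gradNorm u q)) * ζ q) MeasureTheory.volume →
    ∫ q, (f (u q) - h (u q) * g (gradNorm u q)) * ζ q ≤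
      -∫ q, (gradNorm u q)⁻¹ * φ (gradNorm u q) * gradDot u ζ q

/-- Condition (Φ): `φ ∈ C⁰([0,∞)) ∩ C¹((0,∞))`, `φ(0) = 0`, `φ' > 0` on `(0,∞)`. -/
structure CondPhi (φ : ℝ → ℝ) : Prop where
  continuousOn : ContinuousOn φ (Set.Ici 0)
  contDiffOn : ContDiffOn ℝ 1 φ (Set.Ioi 0)
  map_zero : φ 0 = 0
  deriv_pos : ∀ t : ℝ, 0 < t → 0 < deriv φ t

/-- Condition (F): `f ∈ C⁰([0,∞))`, `f > 0` on `(0,∞)`, `f` increasing on `[0,∞)`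
(not necessarily strictly). -/
structure CondF (f : ℝ → ℝ) : Prop where
  continuousOn : ContinuousOn f (Set.Ici 0)
  pos : ∀ t : ℝ, 0 < t → 0 < f t
  monotoneOn : MonotoneOn f (Set.Ici 0)

/-- Condition (H): `h ∈ C⁰((0,∞))`, `h ≥ 0`, `h ∈ L¹(0⁺)`, `h` non-increasing. -/
structure CondH (h : ℝ → ℝ) : Prop where
  continuousOn : ContinuousOn h (Set.Ioi 0)
  nonneg : ∀ t : ℝ, 0 < t → 0 ≤ h t
  integrable : MeasureTheory.IntegrableAtFilter h (nhdsWithin 0 (Set.Ioi 0))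
    MeasureTheory.volume
  antitoneOn : AntitoneOn h (Set.Ioi 0)

/-- Condition (Φ0): `t φ'(t) ∈ L¹(0⁺)`. -/
def CondPhi0 (φ : ℝ → ℝ) : Prop :=
  MeasureTheory.IntegrableAtFilter (fun t => t * deriv φ t) (nhdsWithin 0 (Set.Ioi 0))
    MeasureTheory.volume

/-- Condition (Φ2) with exponent `τ ≥ 0`: for some `D > 0`,
`s φ'(s t) ≤ D s^τ φ'(t)` for `s ∈ [0,1]`, `t > 0` (at `s = 0` the left side is `0`). -/
def CondPhi2 (φ : ℝ → ℝ) (τ : ℝ) : Prop :=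
  0 ≤ τ ∧ ∃ D : ℝ, 0 < D ∧ ∀ s : ℝ, 0 ≤ s → s ≤ 1 → ∀ t : ℝ, 0 < t →
    s * deriv φ (s * t) ≤ D * s ^ τ * deriv φ t

/-- Condition (Φ3) with exponent `θ < 2`: for some `B > 0`,
`φ'(t s) ≥ B φ'(t) s^(-θ)` for `t > 0`, `s ≥ 1`. -/
def CondPhi3 (φ : ℝ → ℝ) (θ : ℝ) : Prop :=
  θ < 2 ∧ ∃ B : ℝ, 0 < B ∧ ∀ t : ℝ, 0 < t → ∀ s : ℝ, 1 ≤ s →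
    B * deriv φ t * s ^ (-θ) ≤ deriv φ (t * s)

/-- Condition (G) with the exponent `τ` of (Φ2), for a non-negative measurable function `g` on
`[0,∞)`: for some `C > 0`, `g(s t) ≤ C s^(τ+1) t² φ'(t)` for `s ∈ [0,1]`, `t > 0`. -/
structure CondG (φ g : ℝ → ℝ) (τ : ℝ) : Prop where
  measurable : Measurable (fun t : Set.Ici (0 : ℝ) => g t)
  nonneg : ∀ t : ℝ, 0 ≤ t → 0 ≤ g t
  bound : ∃ C : ℝ, 0 < C ∧ ∀ s : ℝ, 0 ≤ s → s ≤ 1 → ∀ t : ℝ, 0 < t →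
    g (s * t) ≤ C * s ^ (τ + 1) * t ^ 2 * deriv φ t

/-- `K(t) = ∫_0^t s φ'(s) ds`. -/
noncomputable def K (φ : ℝ → ℝ) (t : ℝ) : ℝ := ∫ s in (0 : ℝ)..t, s * deriv φ s

/-- The inverse `K⁻¹ : [0,∞) → [0,∞)` of `K` (under (Φ), (Φ0), (Φ3) `K` is a bijection of
`[0,∞)`). -/
noncomputable def KInv (φ : ℝ → ℝ) : ℝ → ℝ := Function.invFunOn (K φ) (Set.Ici 0)

/-- `F̂(t) = ∫_0^t f(s) exp((2-θ) ∫_0^s h) ds`. -/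
noncomputable def FHat (f h : ℝ → ℝ) (θ t : ℝ) : ℝ :=
  ∫ s in (0 : ℝ)..t, f s * Real.exp ((2 - θ) * ∫ x in (0 : ℝ)..s, h x)

/-- The adapted Keller–Osserman condition: `exp(∫_0^t h) / K⁻¹(F̂(t)) ∈ L¹(+∞)`. -/
def KellerOsserman (φ f h : ℝ → ℝ) (θ : ℝ) : Prop :=
  MeasureTheory.IntegrableAtFilter
    (fun t : ℝ => Real.exp (∫ x in (0 : ℝ)..t, h x) / KInv φ (FHat f h θ t))
    Filter.atTop MeasureTheory.volume

end Heisenberg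

namespace Heisenberg

open MeasureTheory Set Filter Topology

/-! ### Inverses and primitives of functions on a half-line -/

theorem strictMonoOn_invFunOn {α β : Type*} [LinearOrder α] [Nonempty α] [Preorder β]
    {f : α → β} {s : Set α} (hf : StrictMonoOn f s) :
    StrictMonoOn (Function.invFunOn f s) (f '' s) := by
  rintro _ ⟨x, hx, rfl⟩ _ ⟨y, hy, rfl⟩ hxy
  rw [hf.injOn.leftInvOn_invFunOn hx, hf.injOn.leftInvOn_invFunOn hy]
  exact (hf.lt_iff_lt hx hy).1 hxy

section InverseOnHalfLine

variable {α β : Type*} [ConditionallyCompleteLinearOrder α] [TopologicalSpace α] [OrderTopology α]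
  [DenselyOrdered α] [NoMaxOrder α] [LinearOrder β] [TopologicalSpace β] [OrderTopology β]
  {f : α → β} {a x : α}

theorem image_Ici_mem_nhds (hmono : StrictMonoOn f (Ici a)) (hcont : ContinuousOn f (Ici a))
    (hx : a < x) : f '' Ici a ∈ 𝓝 (f x) := by
  obtain ⟨b, hb⟩ := exists_gt x
  refine mem_of_superset (Icc_mem_nhds (hmono self_mem_Ici hx.le hx)
    (hmono hx.le (hx.trans hb).le hb)) ?_
  exact (intermediate_value_Icc (hx.trans hb).le (hcont.mono Icc_subset_Ici_self)).trans
    (image_mono Icc_subset_Ici_self)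

theorem image_Ici_mem_nhdsGE (hmono : StrictMonoOn f (Ici a)) (hcont : ContinuousOn f (Ici a)) :
    f '' Ici a ∈ 𝓝[≥] f a := by
  obtain ⟨b, hb⟩ := exists_gt a
  refine mem_of_superset (Icc_mem_nhdsGE (hmono self_mem_Ici hb.le hb)) ?_
  exact (intermediate_value_Icc hb.le (hcont.mono Icc_subset_Ici_self)).trans
    (image_mono Icc_subset_Ici_self)

theorem continuousAt_invFunOn_Ici [Nonempty α] (hmono : StrictMonoOn f (Ici a))
    (hcont : ContinuousOn f (Ici a)) (hx : a < x) :
    ContinuousAt (Function.invFunOn f (Ici a)) (f x) := by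
  refine (strictMonoOn_invFunOn hmono).continuousAt_of_image_mem_nhds
    (image_Ici_mem_nhds hmono hcont hx) ?_
  rw [hmono.injOn.leftInvOn_invFunOn.image_image, hmono.injOn.leftInvOn_invFunOn hx.le]
  exact Ici_mem_nhds hx

theorem continuousWithinAt_invFunOn_Ici [Nonempty α] (hmono : StrictMonoOn f (Ici a))
    (hcont : ContinuousOn f (Ici a)) :
    ContinuousWithinAt (Function.invFunOn f (Ici a)) (Ici (f a)) (f a) := by
  refine (strictMonoOn_invFunOn hmono).continuousWithinAt_right_of_image_mem_nhdsWithin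
    (image_Ici_mem_nhdsGE hmono hcont) ?_
  rw [hmono.injOn.leftInvOn_invFunOn.image_image, hmono.injOn.leftInvOn_invFunOn self_mem_Ici]
  exact self_mem_nhdsWithin

end InverseOnHalfLine

theorem hasDerivAt_invFunOn_Ici {f : ℝ → ℝ} {a : ℝ} (hmono : StrictMonoOn f (Ici a))
    (hcont : ContinuousOn f (Ici a)) {x f' : ℝ} (hx : a < x) (hf : HasDerivAt f f' x)
    (hf' : f' ≠ 0) : HasDerivAt (Function.invFunOn f (Ici a)) f'⁻¹ (f x) := by
  have hleft := hmono.injOn.leftInvOn_invFunOn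
  refine HasDerivAt.of_local_left_inverse (continuousAt_invFunOn_Ici hmono hcont hx)
    (by rwa [hleft hx.le]) hf' ?_
  filter_upwards [image_Ici_mem_nhds hmono hcont hx] with y hy
  exact Function.invFunOn_eq hy

theorem strictMonoOn_Ici_of_hasDerivAt_pos {f f' : ℝ → ℝ} {a : ℝ} (hf : ContinuousOn f (Ici a))
    (hd : ∀ x, a < x → HasDerivAt f (f' x) x) (hpos : ∀ x, a < x → 0 < f' x) :
    StrictMonoOn f (Ici a) := by
  refine strictMonoOn_of_hasDerivWithinAt_pos (f' := f') (convex_Ici a) hf ?_ ?_ <;>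
    rw [interior_Ici]
  · exact fun x hx => (hd x hx).hasDerivWithinAt
  · exact hpos

theorem sub_le_sub_of_hasDerivAt_le {F G F' G' : ℝ → ℝ} {a b : ℝ} (hab : a ≤ b)
    (hF : ContinuousOn F (Icc a b)) (hG : ContinuousOn G (Icc a b))
    (hF' : ∀ x ∈ Ioo a b, HasDerivAt F (F' x) x) (hG' : ∀ x ∈ Ioo a b, HasDerivAt G (G' x) x)
    (hle : ∀ x ∈ Ioo a b, F' x ≤ G' x) : F b - F a ≤ G b - G a := by
  have hmono : MonotoneOn (G - F) (Icc a b) := by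
    refine monotoneOn_of_hasDerivWithinAt_nonneg (f' := G' - F') (convex_Icc a b) (hG.sub hF)
      ?_ ?_ <;> rw [interior_Icc]
    · exact fun x hx => ((hG' x hx).sub (hF' x hx)).hasDerivWithinAt
    · exact fun x hx => sub_nonneg.2 (hle x hx)
  have hGF : G a - F a ≤ G b - F b := hmono (left_mem_Icc.2 hab) (right_mem_Icc.2 hab) hab
  linarith

section Primitive

variable {E : Type*} [NormedAddCommGroup E] {k : ℝ → E} {a t : ℝ}

theorem intervalIntegrable_of_integrableAtFilter_nhdsGT (hc : ContinuousOn k (Ioi a))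
    (hi : IntegrableAtFilter k (𝓝[>] a) volume) (ht : a ≤ t) :
    IntervalIntegrable k volume a t := by
  obtain ⟨s, hs, hks⟩ := hi
  obtain ⟨b, hb, hbs⟩ := mem_nhdsGT_iff_exists_Ioc_subset.1 hs
  have hab : IntervalIntegrable k volume a b :=
    (intervalIntegrable_iff_integrableOn_Ioc_of_le (le_of_lt hb)).2 (hks.mono_set hbs)
  rcases ht.eq_or_lt with rfl | ht
  · exact IntervalIntegrable.refl
  exact hab.trans (ContinuousOn.intervalIntegrable
    (hc.mono fun x hx => (lt_min hb ht).trans_le hx.1))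

variable [NormedSpace ℝ E]

theorem continuousOn_primitive_Ici (hi : ∀ t, a ≤ t → IntervalIntegrable k volume a t) :
    ContinuousOn (fun t => ∫ x in a..t, k x) (Ici a) := by
  intro t (ht : a ≤ t)
  have hat : a ≤ t + 1 := by linarith
  have hIcc : ContinuousOn (fun t => ∫ x in a..t, k x) (Icc a (t + 1)) := by
    rw [← uIcc_of_le hat]
    exact intervalIntegral.continuousOn_primitive_interval
      (by rw [uIcc_of_le hat, integrableOn_Icc_iff_integrableOn_Ioc]
          exact (intervalIntegrable_iff_integrableOn_Ioc_of_le hat).1 (hi _ hat))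
  refine (hIcc t ⟨ht, by linarith⟩).mono_of_mem_nhdsWithin ?_
  rw [← Ici_inter_Iic]
  exact inter_mem self_mem_nhdsWithin (mem_nhdsWithin_of_mem_nhds (Iic_mem_nhds (by linarith)))

theorem hasDerivAt_primitive_Ioi [CompleteSpace E] (hc : ContinuousOn k (Ioi a))
    (hi : ∀ t, a ≤ t → IntervalIntegrable k volume a t) (ht : a < t) :
    HasDerivAt (fun t => ∫ x in a..t, k x) (k t) t :=
  intervalIntegral.integral_hasDerivAt_right (hi t ht.le)
    (hc.stronglyMeasurableAtFilter isOpen_Ioi t ht) (hc.continuousAt (Ioi_mem_nhds ht))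

end Primitive

/-! ### The functions `φ`, `K` and `K⁻¹` -/

section OperatorFunctions

variable {φ : ℝ → ℝ} {τ θ s t : ℝ}

theorem CondPhi.continuousOn_deriv (hφ : CondPhi φ) : ContinuousOn (deriv φ) (Ioi 0) :=
  hφ.contDiffOn.continuousOn_deriv_of_isOpen isOpen_Ioi le_rfl

theorem CondPhi.hasDerivAt (hφ : CondPhi φ) (ht : 0 < t) : HasDerivAt φ (deriv φ t) t :=
  ((hφ.contDiffOn.differentiableOn one_ne_zero).differentiableAt (Ioi_mem_nhds ht)).hasDerivAt

theorem CondPhi.strictMonoOn (hφ : CondPhi φ) : StrictMonoOn φ (Ici 0) :=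
  strictMonoOn_Ici_of_hasDerivAt_pos hφ.continuousOn (fun _ => hφ.hasDerivAt) hφ.deriv_pos

theorem CondPhi.map_nonneg (hφ : CondPhi φ) (ht : 0 ≤ t) : 0 ≤ φ t := by
  rw [← hφ.map_zero]
  exact hφ.strictMonoOn.monotoneOn self_mem_Ici ht ht

/-- Condition (Φ2) with exponent `τ = 0` and constant `D`. Every instance of (Φ2) implies one of
these, since `s ^ τ ≤ 1`. -/
def HasDilationBound (φ : ℝ → ℝ) (D : ℝ) : Prop :=
  ∀ s : ℝ, 0 ≤ s → s ≤ 1 → ∀ t : ℝ, 0 < t → s * deriv φ (s * t) ≤ D * deriv φ t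

theorem CondPhi2.exists_hasDilationBound (hφ2 : CondPhi2 φ τ) (hφ : CondPhi φ) :
    ∃ D, 0 < D ∧ HasDilationBound φ D := by
  obtain ⟨hτ, D, hD0, hD⟩ := hφ2
  refine ⟨D, hD0, fun s hs hs1 t ht => (hD s hs hs1 t ht).trans ?_⟩
  exact mul_le_mul_of_nonneg_right
    (mul_le_of_le_one_right hD0.le (Real.rpow_le_one hs hs1 hτ)) (hφ.deriv_pos t ht).le

theorem CondPhi.continuousOn_mul_deriv (hφ : CondPhi φ) :
    ContinuousOn (fun t => t * deriv φ t) (Ioi 0) :=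
  continuousOn_id.mul hφ.continuousOn_deriv

theorem CondPhi0.intervalIntegrable (hφ0 : CondPhi0 φ) (hφ : CondPhi φ) (t : ℝ) (ht : 0 ≤ t) :
    IntervalIntegrable (fun t => t * deriv φ t) volume 0 t :=
  intervalIntegrable_of_integrableAtFilter_nhdsGT hφ.continuousOn_mul_deriv hφ0 ht

@[simp]
theorem K_zero (φ : ℝ → ℝ) : K φ 0 = 0 := intervalIntegral.integral_same

theorem continuousOn_K (hφ : CondPhi φ) (hφ0 : CondPhi0 φ) : ContinuousOn (K φ) (Ici 0) :=
  continuousOn_primitive_Ici (hφ0.intervalIntegrable hφ)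

theorem hasDerivAt_K (hφ : CondPhi φ) (hφ0 : CondPhi0 φ) (ht : 0 < t) :
    HasDerivAt (K φ) (t * deriv φ t) t :=
  hasDerivAt_primitive_Ioi hφ.continuousOn_mul_deriv (hφ0.intervalIntegrable hφ) ht

theorem strictMonoOn_K (hφ : CondPhi φ) (hφ0 : CondPhi0 φ) : StrictMonoOn (K φ) (Ici 0) :=
  strictMonoOn_Ici_of_hasDerivAt_pos (continuousOn_K hφ hφ0) (fun _ => hasDerivAt_K hφ hφ0)
    fun t ht => mul_pos ht (hφ.deriv_pos t ht)

theorem K_nonneg (hφ : CondPhi φ) (hφ0 : CondPhi0 φ) (ht : 0 ≤ t) : 0 ≤ K φ t := by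
  rw [← K_zero φ]
  exact (strictMonoOn_K hφ hφ0).monotoneOn self_mem_Ici ht ht

theorem mul_rpow_mul_K_le (hφ : CondPhi φ) (hφ0 : CondPhi0 φ) {B : ℝ}
    (hB : ∀ t : ℝ, 0 < t → ∀ s : ℝ, 1 ≤ s → B * deriv φ t * s ^ (-θ) ≤ deriv φ (t * s))
    {l : ℝ} (hl : 1 ≤ l) (ht : 0 ≤ t) : B * l ^ (2 - θ) * K φ t ≤ K φ (l * t) := by
  have hl0 : 0 < l := by linarith
  have hpow : l ^ (2 - θ) = l * l * l ^ (-θ) := by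
    rw [show (2 - θ) = 1 + 1 + -θ by ring, Real.rpow_add hl0, Real.rpow_add hl0, Real.rpow_one]
  have hderiv : ∀ x ∈ Ioo 0 t,
      B * l ^ (2 - θ) * (x * deriv φ x) ≤ l * x * deriv φ (l * x) * l := fun x hx => by
    have hlx : 0 ≤ l * l * x := by have := hx.1; positivity
    rw [hpow, mul_comm l x]
    linarith [mul_le_mul_of_nonneg_left (hB x hx.1 l hl) hlx]
  have hsub := sub_le_sub_of_hasDerivAt_le ht (G := fun t => K φ (l * t))
    ((continuousOn_const.mul (continuousOn_K hφ hφ0)).mono Icc_subset_Ici_self)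
    (((continuousOn_K hφ hφ0).comp (by fun_prop) fun x hx => mul_nonneg hl0.le hx).mono
      Icc_subset_Ici_self)
    (fun x hx => (hasDerivAt_K hφ hφ0 hx.1).const_mul (B * l ^ (2 - θ)))
    (fun x hx => HasDerivAt.comp x (hasDerivAt_K hφ hφ0 (mul_pos hl0 hx.1))
      (by simpa using (hasDerivAt_id x).const_mul l)) hderiv
  simpa using hsub

theorem surjOn_K (hφ : CondPhi φ) (hφ0 : CondPhi0 φ) (hφ3 : CondPhi3 φ θ) :
    SurjOn (K φ) (Ici 0) (Ici 0) := by
  obtain ⟨hθ, B, hB0, hB⟩ := hφ3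
  intro y hy
  have hK1 : 0 < K φ 1 := by
    simpa using strictMonoOn_K hφ hφ0 self_mem_Ici (zero_le_one' ℝ) one_pos
  obtain ⟨l, hyl, hl⟩ := (((tendsto_rpow_atTop (sub_pos.2 hθ)).eventually_ge_atTop
    (y / (B * K φ 1))).and (eventually_ge_atTop 1)).exists
  have hyK : y ≤ K φ l := by
    have hKl := mul_rpow_mul_K_le hφ hφ0 hB hl zero_le_one
    rw [div_le_iff₀ (by positivity)] at hyl
    rw [mul_one] at hKl
    linarith
  obtain ⟨t, ht, hty⟩ := intermediate_value_Icc (zero_le_one.trans hl)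
    ((continuousOn_K hφ hφ0).mono Icc_subset_Ici_self) ⟨(K_zero φ).trans_le hy, hyK⟩
  exact ⟨t, ht.1, hty⟩

theorem strictMonoOn_KInv (hφ : CondPhi φ) (hφ0 : CondPhi0 φ) (hφ3 : CondPhi3 φ θ) :
    StrictMonoOn (KInv φ) (Ici 0) :=
  (strictMonoOn_invFunOn (strictMonoOn_K hφ hφ0)).mono (surjOn_K hφ hφ0 hφ3)

theorem KInv_K (hφ : CondPhi φ) (hφ0 : CondPhi0 φ) (ht : 0 ≤ t) : KInv φ (K φ t) = t :=
  (strictMonoOn_K hφ hφ0).injOn.leftInvOn_invFunOn ht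

theorem K_KInv (hφ : CondPhi φ) (hφ0 : CondPhi0 φ) (hφ3 : CondPhi3 φ θ) (ht : 0 ≤ t) :
    K φ (KInv φ t) = t :=
  (surjOn_K hφ hφ0 hφ3).rightInvOn_invFunOn ht

theorem KInv_nonneg (hφ : CondPhi φ) (hφ0 : CondPhi0 φ) (hφ3 : CondPhi3 φ θ) (ht : 0 ≤ t) :
    0 ≤ KInv φ t :=
  (surjOn_K hφ hφ0 hφ3).mapsTo_invFunOn ht

theorem KInv_zero (hφ : CondPhi φ) (hφ0 : CondPhi0 φ) : KInv φ 0 = 0 := by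
  conv_lhs => rw [← K_zero φ]
  exact KInv_K hφ hφ0 le_rfl

theorem KInv_pos (hφ : CondPhi φ) (hφ0 : CondPhi0 φ) (hφ3 : CondPhi3 φ θ) (ht : 0 < t) :
    0 < KInv φ t := by
  refine (KInv_nonneg hφ hφ0 hφ3 ht.le).lt_of_ne' fun h => ht.ne ?_
  rw [← K_KInv hφ hφ0 hφ3 ht.le, h, K_zero]

theorem hasDerivAt_KInv (hφ : CondPhi φ) (hφ0 : CondPhi0 φ) (hφ3 : CondPhi3 φ θ) (ht : 0 < t) :
    HasDerivAt (KInv φ) (KInv φ t * deriv φ (KInv φ t))⁻¹ t := by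
  have hpos := KInv_pos hφ hφ0 hφ3 ht
  have hd := hasDerivAt_invFunOn_Ici (strictMonoOn_K hφ hφ0) (continuousOn_K hφ hφ0) hpos
    (hasDerivAt_K hφ hφ0 hpos) (mul_pos hpos (hφ.deriv_pos _ hpos)).ne'
  rwa [K_KInv hφ hφ0 hφ3 ht.le] at hd

theorem continuousOn_KInv (hφ : CondPhi φ) (hφ0 : CondPhi0 φ) (hφ3 : CondPhi3 φ θ) :
    ContinuousOn (KInv φ) (Ici 0) := by
  intro t ht
  rcases (mem_Ici.1 ht).eq_or_lt with rfl | ht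
  · simpa [KInv] using
      continuousWithinAt_invFunOn_Ici (strictMonoOn_K hφ hφ0) (continuousOn_K hφ hφ0)
  · exact (hasDerivAt_KInv hφ hφ0 hφ3 ht).continuousAt.continuousWithinAt

theorem exists_KInv_two_mul_le (hφ : CondPhi φ) (hφ0 : CondPhi0 φ) (hφ3 : CondPhi3 φ θ) :
    ∃ L : ℝ, ∀ t : ℝ, 0 ≤ t → KInv φ (2 * t) ≤ L * KInv φ t := by
  have ⟨hθ, B, hB0, hB⟩ := hφ3
  obtain ⟨L, hBL, hL⟩ := (((tendsto_rpow_atTop (sub_pos.2 hθ)).eventually_ge_atTop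
    (2 / B)).and (eventually_ge_atTop 1)).exists
  refine ⟨L, fun t ht => ?_⟩
  have hk := KInv_nonneg hφ hφ0 hφ3 ht
  have hLk : 0 ≤ L * KInv φ t := mul_nonneg (zero_le_one.trans hL) hk
  have h2t : 2 * t ≤ K φ (L * KInv φ t) := by
    refine le_trans ?_ (mul_rpow_mul_K_le hφ hφ0 hB hL hk)
    rw [K_KInv hφ hφ0 hφ3 ht]
    rw [div_le_iff₀' hB0] at hBL
    exact mul_le_mul_of_nonneg_right hBL ht
  calc KInv φ (2 * t) ≤ KInv φ (K φ (L * KInv φ t)) :=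
        (strictMonoOn_KInv hφ hφ0 hφ3).monotoneOn (mul_nonneg zero_le_two ht)
          (K_nonneg hφ hφ0 hLk) h2t
    _ = L * KInv φ t := KInv_K hφ hφ0 hLk

theorem min_one_two_rpow_le_rpow_neg {x : ℝ} (hx : 1 / 2 ≤ x) (hx1 : x ≤ 1) :
    min 1 (2 ^ θ) ≤ x ^ (-θ) := by
  rcases le_total 0 θ with h | h
  · exact (min_le_left _ _).trans
      (Real.one_le_rpow_of_pos_of_le_one_of_nonpos (by linarith) hx1 (by linarith))
  · calc min 1 ((2 : ℝ) ^ θ) ≤ 2 ^ θ := min_le_right _ _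
      _ = (1 / 2 : ℝ) ^ (-θ) := by
        rw [one_div, Real.inv_rpow two_pos.le, Real.rpow_neg two_pos.le, inv_inv]
      _ ≤ x ^ (-θ) := Real.rpow_le_rpow (by norm_num) hx (by linarith)

theorem CondPhi3.exists_mul_deriv_mul_rpow_le (hφ3 : CondPhi3 φ θ) (hφ : CondPhi φ) :
    ∃ c : ℝ, 0 < c ∧ ∀ l t s : ℝ, 0 < l → l ≤ 1 / 2 → 0 < t → t / 2 ≤ s → s ≤ t →
      c * deriv φ (l * t) * l ^ θ ≤ deriv φ s := by
  obtain ⟨-, B, hB0, hB⟩ := hφ3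
  refine ⟨B * min 1 (2 ^ θ), mul_pos hB0 (lt_min one_pos (by positivity)),
    fun l t s hl hl2 ht hts hst => ?_⟩
  have hlt : 0 < l * t := mul_pos hl ht
  have hs : s / (l * t) = s / t / l := by rw [div_div, mul_comm]
  have hB' := hB (l * t) hlt (s / (l * t)) (by rw [le_div_iff₀ hlt]; nlinarith)
  rw [mul_div_cancel₀ _ hlt.ne'] at hB'
  refine le_trans ?_ hB'
  have hpow : min 1 (2 ^ θ) * l ^ θ ≤ (s / (l * t)) ^ (-θ) := by
    have hst0 : 0 ≤ s / t := div_nonneg (by linarith) ht.le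
    rw [hs, Real.div_rpow hst0 hl.le, Real.rpow_neg hl.le θ, div_inv_eq_mul]
    refine mul_le_mul_of_nonneg_right (min_one_two_rpow_le_rpow_neg ?_ ?_) (by positivity)
    · rw [le_div_iff₀ ht]; linarith
    · rwa [div_le_one ht]
  calc B * min 1 (2 ^ θ) * deriv φ (l * t) * l ^ θ
      = B * deriv φ (l * t) * (min 1 (2 ^ θ) * l ^ θ) := by ring
    _ ≤ B * deriv φ (l * t) * (s / (l * t)) ^ (-θ) :=
        mul_le_mul_of_nonneg_left hpow (mul_pos hB0 (hφ.deriv_pos _ hlt)).le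

theorem CondPhi3.exists_sq_mul_deriv_le (hφ3 : CondPhi3 φ θ) (hφ : CondPhi φ)
    (hφ0 : CondPhi0 φ) :
    ∃ C : ℝ, 0 < C ∧ ∀ l t : ℝ, 0 < l → l ≤ 1 / 2 → 0 < t →
      (l * t) ^ 2 * deriv φ (l * t) ≤ C * l ^ (2 - θ) * K φ t := by
  obtain ⟨c, hc, hderiv⟩ := hφ3.exists_mul_deriv_mul_rpow_le hφ
  refine ⟨4 / c, by positivity, fun l t hl hl2 ht => ?_⟩
  have hd : 0 < deriv φ (l * t) := hφ.deriv_pos _ (mul_pos hl ht)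
  have hsub := sub_le_sub_of_hasDerivAt_le (by linarith : t / 2 ≤ t) (by fun_prop)
    ((continuousOn_K hφ hφ0).mono fun x hx => (half_pos ht).le.trans hx.1)
    (fun x _ => (hasDerivAt_id x).const_mul (t / 2 * (c * deriv φ (l * t) * l ^ θ)))
    (fun x hx => hasDerivAt_K hφ hφ0 ((half_pos ht).trans hx.1))
    (fun x hx => by
      rw [mul_one]
      exact mul_le_mul hx.1.le (hderiv l t x hl hl2 ht hx.1.le hx.2.le) (by positivity)
        ((half_pos ht).le.trans hx.1.le))
  have hK : (t / 2) * (c * deriv φ (l * t) * l ^ θ) * (t / 2) ≤ K φ t := by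
    have := K_nonneg hφ hφ0 (half_pos ht).le
    simp only [id] at hsub
    linarith
  calc (l * t) ^ 2 * deriv φ (l * t) = l ^ (2 - θ) * l ^ θ * (t ^ 2 * deriv φ (l * t)) := by
        rw [← Real.rpow_add hl, sub_add_cancel, Real.rpow_two]; ring
    _ = 4 / c * l ^ (2 - θ) * ((t / 2) * (c * deriv φ (l * t) * l ^ θ) * (t / 2)) := by
        field_simp; ring
    _ ≤ 4 / c * l ^ (2 - θ) * K φ t := mul_le_mul_of_nonneg_left hK (by positivity)

end OperatorFunctions

/-! ### The slope of the Keller–Osserman profile -/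

/-- The primitive `∫_0^t h` vanishing at `0`. -/
noncomputable def primitive (h : ℝ → ℝ) (t : ℝ) : ℝ := ∫ x in (0 : ℝ)..t, h x

/-- The integrand `f(s) exp((2-θ) ∫_0^s h)` of `F̂`. -/
noncomputable def FHatDeriv (f h : ℝ → ℝ) (θ s : ℝ) : ℝ :=
  f s * Real.exp ((2 - θ) * primitive h s)

section Primitives

variable {f h : ℝ → ℝ} {a θ ε t : ℝ}

theorem CondH.intervalIntegrable (hh : CondH h) (t : ℝ) (ht : 0 ≤ t) :
    IntervalIntegrable h volume 0 t :=
  intervalIntegrable_of_integrableAtFilter_nhdsGT hh.continuousOn hh.integrable ht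

theorem CondH.continuousOn_primitive (hh : CondH h) : ContinuousOn (primitive h) (Ici 0) :=
  continuousOn_primitive_Ici hh.intervalIntegrable

theorem CondH.hasDerivAt_primitive (hh : CondH h) (ht : 0 < t) :
    HasDerivAt (primitive h) (h t) t :=
  hasDerivAt_primitive_Ioi hh.continuousOn hh.intervalIntegrable ht

theorem CondH.primitive_nonneg (hh : CondH h) (ht : 0 ≤ t) : 0 ≤ primitive h t := by
  rw [primitive, intervalIntegral.integral_of_le ht]
  exact setIntegral_nonneg measurableSet_Ioc fun x hx => hh.nonneg x hx.1

theorem CondH.one_le_exp_mul_primitive (hh : CondH h) (ha : 0 ≤ a) (ht : 0 ≤ t) :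
    1 ≤ Real.exp (a * primitive h t) :=
  Real.one_le_exp (mul_nonneg ha (hh.primitive_nonneg ht))

theorem CondH.one_le_exp_primitive (hh : CondH h) (ht : 0 ≤ t) : 1 ≤ Real.exp (primitive h t) :=
  Real.one_le_exp (hh.primitive_nonneg ht)

theorem CondH.continuousOn_exp_mul_primitive (hh : CondH h) (a : ℝ) :
    ContinuousOn (fun t => Real.exp (a * primitive h t)) (Ici 0) :=
  (continuousOn_const.mul hh.continuousOn_primitive).rexp

theorem CondF.nonneg (hf : CondF f) (ht : 0 ≤ t) : 0 ≤ f t := by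
  rcases ht.eq_or_lt with rfl | ht
  · have hlim : Tendsto f (𝓝[>] 0) (𝓝 (f 0)) :=
      (hf.continuousOn 0 self_mem_Ici).mono_left (nhdsWithin_mono _ Ioi_subset_Ici_self)
    exact ge_of_tendsto hlim (eventually_nhdsWithin_of_forall fun x hx => (hf.pos x hx).le)
  · exact (hf.pos t ht).le

theorem FHatDeriv_pos (hf : CondF f) (ht : 0 < t) : 0 < FHatDeriv f h θ t :=
  mul_pos (hf.pos t ht) (Real.exp_pos _)

theorem continuousOn_FHatDeriv (hf : CondF f) (hh : CondH h) (θ : ℝ) :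
    ContinuousOn (FHatDeriv f h θ) (Ici 0) :=
  hf.continuousOn.mul (hh.continuousOn_exp_mul_primitive _)

theorem intervalIntegrable_FHatDeriv (hf : CondF f) (hh : CondH h) (θ t : ℝ) (ht : 0 ≤ t) :
    IntervalIntegrable (FHatDeriv f h θ) volume 0 t :=
  ContinuousOn.intervalIntegrable ((continuousOn_FHatDeriv hf hh θ).mono (by
    rw [uIcc_of_le ht]; exact Icc_subset_Ici_self))

theorem continuousOn_FHat (hf : CondF f) (hh : CondH h) (θ : ℝ) :
    ContinuousOn (FHat f h θ) (Ici 0) :=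
  continuousOn_primitive_Ici (intervalIntegrable_FHatDeriv hf hh θ)

theorem hasDerivAt_FHat (hf : CondF f) (hh : CondH h) (θ : ℝ) (ht : 0 < t) :
    HasDerivAt (FHat f h θ) (FHatDeriv f h θ t) t :=
  hasDerivAt_primitive_Ioi ((continuousOn_FHatDeriv hf hh θ).mono Ioi_subset_Ici_self)
    (intervalIntegrable_FHatDeriv hf hh θ) ht

theorem strictMonoOn_FHat (hf : CondF f) (hh : CondH h) (θ : ℝ) :
    StrictMonoOn (FHat f h θ) (Ici 0) :=
  strictMonoOn_Ici_of_hasDerivAt_pos (continuousOn_FHat hf hh θ)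
    (fun _ => hasDerivAt_FHat hf hh θ) fun _ => FHatDeriv_pos hf

theorem tendsto_FHat_atTop (hf : CondF f) (hh : CondH h) (hθ : θ < 2) :
    Tendsto (FHat f h θ) atTop atTop := by
  have hf1 : 0 < f 1 := hf.pos 1 one_pos
  refine tendsto_atTop_mono' atTop ?_ (tendsto_atTop_add_const_right _ (FHat f h θ 1 - f 1)
    (tendsto_id.const_mul_atTop hf1))
  filter_upwards [eventually_ge_atTop 1] with s hs
  have hle : ∀ x ∈ Ioo 1 s, f 1 * 1 ≤ FHatDeriv f h θ x := fun x hx => by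
    have hx0 : 0 ≤ x := zero_le_one.trans hx.1.le
    exact mul_le_mul (hf.monotoneOn (zero_le_one' ℝ) hx0 hx.1.le)
      (hh.one_le_exp_mul_primitive (by linarith) hx0) zero_le_one (hf.nonneg hx0)
  have hsub := sub_le_sub_of_hasDerivAt_le hs (by fun_prop)
    ((continuousOn_FHat hf hh θ).mono fun x hx => zero_le_one.trans hx.1)
    (fun x _ => (hasDerivAt_id x).const_mul (f 1))
    (fun x hx => hasDerivAt_FHat hf hh θ (one_pos.trans hx.1)) hle
  simp only [id, mul_one] at hsub ⊢
  linarith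

theorem mul_FHat_sub_le (hf : CondF f) (hh : CondH h) (hθ : θ < 2) (hε : 0 < ε) (ht : ε ≤ t) :
    h t * (FHat f h θ t - FHat f h θ ε) ≤ FHatDeriv f h θ t / (2 - θ) := by
  have hθ' : 0 < 2 - θ := sub_pos.2 hθ
  have ht0 : 0 < t := hε.trans_le ht
  have hsub : Icc ε t ⊆ Ici 0 := fun x hx => hε.le.trans hx.1
  have hle : ∀ x ∈ Ioo ε t, h t * FHatDeriv f h θ x ≤
      f t / (2 - θ) * (Real.exp ((2 - θ) * primitive h x) * ((2 - θ) * h x)) := fun x hx => by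
    have hx0 : 0 < x := hε.trans hx.1
    calc h t * FHatDeriv f h θ x = (h t * f x) * Real.exp ((2 - θ) * primitive h x) := by
          rw [FHatDeriv, mul_assoc]
      _ ≤ (h x * f t) * Real.exp ((2 - θ) * primitive h x) :=
          mul_le_mul_of_nonneg_right (mul_le_mul (hh.antitoneOn hx0 ht0 hx.2.le)
            (hf.monotoneOn hx0.le ht0.le hx.2.le) (hf.pos x hx0).le (hh.nonneg x hx0))
            (Real.exp_pos _).le
      _ = _ := by field_simp
  have hcmp := sub_le_sub_of_hasDerivAt_le ht
    (continuousOn_const.mul ((continuousOn_FHat hf hh θ).mono hsub))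
    (continuousOn_const.mul ((hh.continuousOn_exp_mul_primitive _).mono hsub))
    (fun x hx => (hasDerivAt_FHat hf hh θ (hε.trans hx.1)).const_mul (h t))
    (fun x hx => (((hh.hasDerivAt_primitive (hε.trans hx.1)).const_mul _).exp).const_mul _) hle
  have hε0 : 0 ≤ f t / (2 - θ) * Real.exp ((2 - θ) * primitive h ε) :=
    mul_nonneg (div_nonneg (hf.pos t ht0).le hθ'.le) (Real.exp_pos _).le
  simp only [Pi.mul_apply] at hcmp
  rw [FHatDeriv, mul_div_right_comm]
  linarith

end Primitives

/-- The slope `K⁻¹(F̂(s) - F̂(ε))`, at height `s`, of a one-dimensional profile leaving the height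
`ε` with speed `0`, before the correction for the gradient term `h(u) g(|∇u|)`. -/
noncomputable def rawSlope (φ f h : ℝ → ℝ) (θ ε s : ℝ) : ℝ :=
  KInv φ (FHat f h θ s - FHat f h θ ε)

/-- The derivative of `rawSlope`. -/
noncomputable def rawSlopeDeriv (φ f h : ℝ → ℝ) (θ ε s : ℝ) : ℝ :=
  (rawSlope φ f h θ ε s * deriv φ (rawSlope φ f h θ ε s))⁻¹ * FHatDeriv f h θ s

/-- The slope `exp(-∫_0^s h) K⁻¹(F̂(s) - F̂(ε))`, at height `s`, of the Keller–Osserman profile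
leaving the height `ε` with speed `0`. -/
noncomputable def slope (φ f h : ℝ → ℝ) (θ ε s : ℝ) : ℝ :=
  rawSlope φ f h θ ε s * Real.exp (-primitive h s)

/-- The derivative of `slope`. -/
noncomputable def slopeDeriv (φ f h : ℝ → ℝ) (θ ε s : ℝ) : ℝ :=
  rawSlopeDeriv φ f h θ ε s * Real.exp (-primitive h s) +
    rawSlope φ f h θ ε s * (Real.exp (-primitive h s) * -h s)

section Slope

variable {φ f h : ℝ → ℝ} {τ θ ε s : ℝ}

theorem rawSlope_self (hφ : CondPhi φ) (hφ0 : CondPhi0 φ) : rawSlope φ f h θ ε ε = 0 := by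
  rw [rawSlope, sub_self, KInv_zero hφ hφ0]

theorem slope_self (hφ : CondPhi φ) (hφ0 : CondPhi0 φ) : slope φ f h θ ε ε = 0 := by
  rw [slope, rawSlope_self hφ hφ0, zero_mul]

theorem FHat_sub_pos (hf : CondF f) (hh : CondH h) (hε : 0 ≤ ε) (hs : ε < s) :
    0 < FHat f h θ s - FHat f h θ ε :=
  sub_pos.2 (strictMonoOn_FHat hf hh θ hε (hε.trans hs.le) hs)

theorem rawSlope_pos (hφ : CondPhi φ) (hφ0 : CondPhi0 φ) (hφ3 : CondPhi3 φ θ) (hf : CondF f)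
    (hh : CondH h) (hε : 0 ≤ ε) (hs : ε < s) : 0 < rawSlope φ f h θ ε s :=
  KInv_pos hφ hφ0 hφ3 (FHat_sub_pos hf hh hε hs)

theorem slope_pos (hφ : CondPhi φ) (hφ0 : CondPhi0 φ) (hφ3 : CondPhi3 φ θ) (hf : CondF f)
    (hh : CondH h) (hε : 0 ≤ ε) (hs : ε < s) : 0 < slope φ f h θ ε s :=
  mul_pos (rawSlope_pos hφ hφ0 hφ3 hf hh hε hs) (Real.exp_pos _)

theorem K_rawSlope (hφ : CondPhi φ) (hφ0 : CondPhi0 φ) (hφ3 : CondPhi3 φ θ) (hf : CondF f)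
    (hh : CondH h) (hε : 0 ≤ ε) (hs : ε < s) :
    K φ (rawSlope φ f h θ ε s) = FHat f h θ s - FHat f h θ ε :=
  K_KInv hφ hφ0 hφ3 (FHat_sub_pos hf hh hε hs).le

theorem continuousOn_rawSlope (hφ : CondPhi φ) (hφ0 : CondPhi0 φ) (hφ3 : CondPhi3 φ θ)
    (hf : CondF f) (hh : CondH h) (hε : 0 ≤ ε) : ContinuousOn (rawSlope φ f h θ ε) (Ici ε) :=
  (continuousOn_KInv hφ hφ0 hφ3).comp
    (((continuousOn_FHat hf hh θ).mono (Ici_subset_Ici.2 hε)).sub continuousOn_const)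
    fun _ hs => sub_nonneg.2 ((strictMonoOn_FHat hf hh θ).monotoneOn hε (hε.trans hs) hs)

theorem hasDerivAt_rawSlope (hφ : CondPhi φ) (hφ0 : CondPhi0 φ) (hφ3 : CondPhi3 φ θ)
    (hf : CondF f) (hh : CondH h) (hε : 0 ≤ ε) (hs : ε < s) :
    HasDerivAt (rawSlope φ f h θ ε) (rawSlopeDeriv φ f h θ ε s) s :=
  HasDerivAt.comp s (h₂ := KInv φ) (hasDerivAt_KInv hφ hφ0 hφ3 (FHat_sub_pos hf hh hε hs))
    ((hasDerivAt_FHat hf hh θ (hε.trans_lt hs)).sub_const _)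

theorem continuousOn_rawSlopeDeriv (hφ : CondPhi φ) (hφ0 : CondPhi0 φ) (hφ3 : CondPhi3 φ θ)
    (hf : CondF f) (hh : CondH h) (hε : 0 ≤ ε) :
    ContinuousOn (rawSlopeDeriv φ f h θ ε) (Ioi ε) := by
  have hk := (continuousOn_rawSlope hφ hφ0 hφ3 hf hh hε).mono Ioi_subset_Ici_self
  have hpos : ∀ s ∈ Ioi ε, 0 < rawSlope φ f h θ ε s := fun s hs =>
    rawSlope_pos hφ hφ0 hφ3 hf hh hε hs
  exact ((hk.mul (hφ.continuousOn_deriv.comp hk hpos)).inv₀ fun s hs =>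
      (mul_pos (hpos s hs) (hφ.deriv_pos _ (hpos s hs))).ne').mul
    ((continuousOn_FHatDeriv hf hh θ).mono fun s hs => hε.trans (le_of_lt hs))

theorem rawSlope_mul_deriv_mul (hφ : CondPhi φ) (hφ0 : CondPhi0 φ) (hφ3 : CondPhi3 φ θ)
    (hf : CondF f) (hh : CondH h) (hε : 0 ≤ ε) (hs : ε < s) :
    deriv φ (rawSlope φ f h θ ε s) * (rawSlope φ f h θ ε s * rawSlopeDeriv φ f h θ ε s) =
      FHatDeriv f h θ s := by
  have hk := rawSlope_pos hφ hφ0 hφ3 hf hh hε hs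
  have hd := hφ.deriv_pos _ hk
  rw [rawSlopeDeriv]
  field_simp

theorem continuousOn_slope (hφ : CondPhi φ) (hφ0 : CondPhi0 φ) (hφ3 : CondPhi3 φ θ)
    (hf : CondF f) (hh : CondH h) (hε : 0 ≤ ε) : ContinuousOn (slope φ f h θ ε) (Ici ε) :=
  (continuousOn_rawSlope hφ hφ0 hφ3 hf hh hε).mul
    (hh.continuousOn_primitive.neg.rexp.mono (Ici_subset_Ici.2 hε))

theorem hasDerivAt_slope (hφ : CondPhi φ) (hφ0 : CondPhi0 φ) (hφ3 : CondPhi3 φ θ)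
    (hf : CondF f) (hh : CondH h) (hε : 0 ≤ ε) (hs : ε < s) :
    HasDerivAt (slope φ f h θ ε) (slopeDeriv φ f h θ ε s) s :=
  (hasDerivAt_rawSlope hφ hφ0 hφ3 hf hh hε hs).mul
    (hh.hasDerivAt_primitive (hε.trans_lt hs)).neg.exp

theorem continuousOn_slopeDeriv (hφ : CondPhi φ) (hφ0 : CondPhi0 φ) (hφ3 : CondPhi3 φ θ)
    (hf : CondF f) (hh : CondH h) (hε : 0 ≤ ε) :
    ContinuousOn (slopeDeriv φ f h θ ε) (Ioi ε) := by
  have hexp : ContinuousOn (fun s => Real.exp (-primitive h s)) (Ioi ε) :=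
    hh.continuousOn_primitive.neg.rexp.mono fun s hs => hε.trans (le_of_lt hs)
  exact ((continuousOn_rawSlopeDeriv hφ hφ0 hφ3 hf hh hε).mul hexp).add
    (((continuousOn_rawSlope hφ hφ0 hφ3 hf hh hε).mono Ioi_subset_Ici_self).mul
      (hexp.mul (hh.continuousOn.mono (Ioi_subset_Ioi hε)).neg))

theorem continuousOn_inv_slope (hφ : CondPhi φ) (hφ0 : CondPhi0 φ) (hφ3 : CondPhi3 φ θ)
    (hf : CondF f) (hh : CondH h) (hε : 0 ≤ ε) :
    ContinuousOn (fun s => (slope φ f h θ ε s)⁻¹) (Ioi ε) :=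
  ((continuousOn_slope hφ hφ0 hφ3 hf hh hε).mono Ioi_subset_Ici_self).inv₀
    fun _ hs => (slope_pos hφ hφ0 hφ3 hf hh hε hs).ne'

theorem integrableAtFilter_inv_slope_nhdsGT (hφ : CondPhi φ) (hφ0 : CondPhi0 φ)
    (hφ3 : CondPhi3 φ θ) (hf : CondF f) (hh : CondH h) (hε : 0 < ε) :
    IntegrableAtFilter (fun s => (slope φ f h θ ε s)⁻¹) (𝓝[>] ε) volume := by
  have hpos : ∀ s, ε < s → 0 < rawSlope φ f h θ ε s := fun s hs =>
    rawSlope_pos hφ hφ0 hφ3 hf hh hε.le hs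
  have hFpos : ∀ s, ε ≤ s → 0 < FHatDeriv f h θ s := fun s hs =>
    FHatDeriv_pos hf (hε.trans_le hs)
  have hIcc : Icc ε (ε + 1) ⊆ Ici 0 := fun s hs => hε.le.trans hs.1
  have hint : IntegrableOn
      (fun s => deriv φ (rawSlope φ f h θ ε s) * rawSlopeDeriv φ f h θ ε s) (Ioc ε (ε + 1)) := by
    refine intervalIntegral.integrableOn_deriv_of_nonneg (g := fun s => φ (rawSlope φ f h θ ε s))
      (hφ.continuousOn.comp ((continuousOn_rawSlope hφ hφ0 hφ3 hf hh hε.le).mono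
        Icc_subset_Ici_self) fun s hs => ?_)
      (fun s hs => (hφ.hasDerivAt (hpos s hs.1)).comp s
        (hasDerivAt_rawSlope hφ hφ0 hφ3 hf hh hε.le hs.1)) fun s hs => ?_
    · rcases hs.1.eq_or_lt with rfl | hs
      exacts [(rawSlope_self hφ hφ0).ge, (hpos s hs).le]
    · have hd := hφ.deriv_pos _ (hpos s hs.1)
      exact mul_nonneg hd.le (mul_nonneg (inv_nonneg.2 (mul_pos (hpos s hs.1) hd).le)
        (hFpos s hs.1.le).le)
  have hweight : ContinuousOn (fun s => Real.exp (primitive h s) / FHatDeriv f h θ s)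
      (Icc ε (ε + 1)) :=
    (hh.continuousOn_primitive.rexp.mono hIcc).div
      ((continuousOn_FHatDeriv hf hh θ).mono hIcc) fun s hs => (hFpos s hs.1).ne'
  rw [← integrableOn_Icc_iff_integrableOn_Ioc] at hint
  refine ⟨Ioc ε (ε + 1), Ioc_mem_nhdsGT (lt_add_one ε), ((hint.continuousOn_mul hweight
    isCompact_Icc).mono_set Ioc_subset_Icc_self).congr_fun (fun s hs => ?_) measurableSet_Ioc⟩
  have hk := hpos s hs.1
  have hF := hFpos s hs.1.le
  have hd := hφ.deriv_pos _ hk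
  simp only [slope, rawSlopeDeriv, Real.exp_neg]
  field_simp

theorem exists_eventually_KInv_FHat_le (hφ : CondPhi φ) (hφ0 : CondPhi0 φ) (hφ3 : CondPhi3 φ θ)
    (hf : CondF f) (hh : CondH h) (hε : 0 ≤ ε) :
    ∃ L : ℝ, ∀ᶠ s in atTop, KInv φ (FHat f h θ s) ≤ L * rawSlope φ f h θ ε s := by
  obtain ⟨L, hL⟩ := exists_KInv_two_mul_le hφ hφ0 hφ3
  refine ⟨L, ?_⟩
  filter_upwards [(tendsto_FHat_atTop hf hh hφ3.1).eventually_ge_atTop (2 * FHat f h θ ε),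
    (tendsto_FHat_atTop hf hh hφ3.1).eventually_ge_atTop 0, eventually_gt_atTop ε] with s h2 h0 hs
  have hsub := (FHat_sub_pos (θ := θ) hf hh hε hs).le
  exact ((strictMonoOn_KInv hφ hφ0 hφ3).monotoneOn h0 (mul_nonneg zero_le_two hsub)
    (by linarith)).trans (hL _ hsub)

theorem integrableAtFilter_inv_slope_atTop (hφ : CondPhi φ) (hφ0 : CondPhi0 φ)
    (hφ3 : CondPhi3 φ θ) (hf : CondF f) (hh : CondH h) (hε : 0 ≤ ε)
    (hKO : KellerOsserman φ f h θ) :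
    IntegrableAtFilter (fun s => (slope φ f h θ ε s)⁻¹) atTop volume := by
  obtain ⟨L, hL⟩ := exists_eventually_KInv_FHat_le hφ hφ0 hφ3 hf hh hε
  refine Asymptotics.IsBigO.integrableAtFilter (Asymptotics.IsBigO.of_bound L ?_)
    ⟨Ioi ε, Ioi_mem_atTop ε,
      (continuousOn_inv_slope hφ hφ0 hφ3 hf hh hε).aestronglyMeasurable measurableSet_Ioi⟩ hKO
  filter_upwards [hL, eventually_gt_atTop ε,
    (tendsto_FHat_atTop hf hh hφ3.1).eventually_gt_atTop 0] with s hLs hs hF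
  have hk := rawSlope_pos hφ hφ0 hφ3 hf hh hε hs
  have hKI := KInv_pos hφ hφ0 hφ3 hF
  have hexp : 0 < Real.exp (primitive h s) := Real.exp_pos _
  change ‖(rawSlope φ f h θ ε s * Real.exp (-primitive h s))⁻¹‖ ≤
    L * ‖Real.exp (primitive h s) / KInv φ (FHat f h θ s)‖
  rw [Real.norm_of_nonneg (by positivity), Real.norm_of_nonneg (by positivity), mul_inv,
    ← Real.exp_neg, neg_neg, mul_div_left_comm, mul_comm]
  refine mul_le_mul_of_nonneg_left ?_ hexp.le
  rwa [le_div_iff₀ hKI, inv_mul_le_iff₀ hk, mul_comm]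

theorem integrableOn_inv_slope (hφ : CondPhi φ) (hφ0 : CondPhi0 φ) (hφ3 : CondPhi3 φ θ)
    (hf : CondF f) (hh : CondH h) (hε : 0 < ε) (hKO : KellerOsserman φ f h θ) :
    IntegrableOn (fun s => (slope φ f h θ ε s)⁻¹) (Ioi ε) volume :=
  integrableOn_Ioi_iff_integrableAtFilter_atTop_nhdsWithin.2
    ⟨integrableAtFilter_inv_slope_atTop hφ hφ0 hφ3 hf hh hε.le hKO,
      integrableAtFilter_inv_slope_nhdsGT hφ hφ0 hφ3 hf hh hε,
      (continuousOn_inv_slope hφ hφ0 hφ3 hf hh hε.le).locallyIntegrableOn measurableSet_Ioi⟩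

theorem slope_mul_slopeDeriv_add :
    slope φ f h θ ε s * slopeDeriv φ f h θ ε s + h s * slope φ f h θ ε s ^ 2 =
      rawSlope φ f h θ ε s * rawSlopeDeriv φ f h θ ε s * Real.exp (-primitive h s) ^ 2 := by
  simp only [slope, slopeDeriv]
  ring

theorem slope_mul_slopeDeriv_add_nonneg (hφ : CondPhi φ) (hφ0 : CondPhi0 φ)
    (hφ3 : CondPhi3 φ θ) (hf : CondF f) (hh : CondH h) (hε : 0 ≤ ε) (hs : ε < s) :
    0 ≤ slope φ f h θ ε s * slopeDeriv φ f h θ ε s + h s * slope φ f h θ ε s ^ 2 := by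
  have hk := rawSlope_pos hφ hφ0 hφ3 hf hh hε hs
  have hd := hφ.deriv_pos _ hk
  have hF := FHatDeriv_pos (h := h) (θ := θ) hf (hε.trans_lt hs)
  rw [slope_mul_slopeDeriv_add, rawSlopeDeriv]
  positivity

theorem exp_primitive_mul_slope :
    Real.exp (primitive h s) * slope φ f h θ ε s = rawSlope φ f h θ ε s := by
  rw [slope, mul_left_comm, ← Real.exp_add, add_neg_cancel, Real.exp_zero, mul_one]

theorem exists_deriv_slope_mul_le (hφ : CondPhi φ) (hφ0 : CondPhi0 φ) (hφ3 : CondPhi3 φ θ)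
    (hf : CondF f) (hh : CondH h) (hε : 0 ≤ ε) :
    ∃ C : ℝ, ∀ s, ε < s → deriv φ (slope φ f h θ ε s) *
      (slope φ f h θ ε s * slopeDeriv φ f h θ ε s + h s * slope φ f h θ ε s ^ 2) ≤ C * f s := by
  have ⟨_, B, hB0, hB⟩ := hφ3
  refine ⟨B⁻¹, fun s hs => ?_⟩
  have hs0 : 0 < s := hε.trans_lt hs
  set q := slope φ f h θ ε s
  set e := Real.exp (-primitive h s)
  have hBq : B * deriv φ q * Real.exp (primitive h s) ^ (-θ) ≤
      deriv φ (rawSlope φ f h θ ε s) := by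
    rw [← exp_primitive_mul_slope, mul_comm (Real.exp _) (slope _ _ _ _ _ _)]
    exact hB q (slope_pos hφ hφ0 hφ3 hf hh hε hs) _
      (hh.one_le_exp_primitive hs0.le)
  have hexp : FHatDeriv f h θ s * e ^ 2 = f s * Real.exp (primitive h s) ^ (-θ) := by
    rw [FHatDeriv, mul_assoc, ← Real.exp_nat_mul, ← Real.exp_add, ← Real.exp_mul]
    ring_nf
  rw [le_inv_mul_iff₀ hB0]
  refine le_of_mul_le_mul_right ?_
    (Real.rpow_pos_of_pos (Real.exp_pos (primitive h s)) (-θ))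
  rw [← hexp, ← rawSlope_mul_deriv_mul hφ hφ0 hφ3 hf hh hε hs]
  have hmul := mul_le_mul_of_nonneg_right hBq
    (slope_mul_slopeDeriv_add_nonneg hφ hφ0 hφ3 hf hh hε hs)
  rw [slope_mul_slopeDeriv_add] at hmul ⊢
  linarith

theorem exists_mul_K_slope_le (hφ : CondPhi φ) (hφ0 : CondPhi0 φ) (hφ3 : CondPhi3 φ θ)
    (hf : CondF f) (hh : CondH h) (hε : 0 < ε) :
    ∃ C : ℝ, ∀ s, ε < s → h s * K φ (slope φ f h θ ε s) ≤ C * f s := by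
  have ⟨hθ, B, hB0, hB⟩ := hφ3
  have hθ' : 0 < 2 - θ := sub_pos.2 hθ
  refine ⟨(B * (2 - θ))⁻¹, fun s hs => ?_⟩
  have hs0 : 0 < s := hε.trans hs
  have hscale := mul_rpow_mul_K_le hφ hφ0 hB
    (hh.one_le_exp_primitive hs0.le)
    (slope_pos hφ hφ0 hφ3 hf hh hε.le hs).le
  rw [exp_primitive_mul_slope, K_rawSlope hφ hφ0 hφ3 hf hh hε.le hs, ← Real.exp_mul,
    mul_comm (primitive h s)] at hscale
  have hF := (mul_le_mul_of_nonneg_left hscale (hh.nonneg s hs0)).trans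
    (mul_FHat_sub_le hf hh hθ hε hs.le)
  rw [le_inv_mul_iff₀ (by positivity)]
  refine le_of_mul_le_mul_right ?_ (Real.exp_pos ((2 - θ) * primitive h s))
  rw [FHatDeriv, le_div_iff₀ hθ'] at hF
  linarith

theorem exists_slope_le (hφ : CondPhi φ) (hφ0 : CondPhi0 φ) (hφ2 : CondPhi2 φ τ)
    (hφ3 : CondPhi3 φ θ) (hf : CondF f) (hh : CondH h) (hε : 0 < ε) :
    ∃ C : ℝ, ∀ l : ℝ, 0 < l → l ≤ 1 / 2 → ∀ s, ε < s →
      deriv φ (l * slope φ f h θ ε s) * (l ^ 2 *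
        (slope φ f h θ ε s * slopeDeriv φ f h θ ε s + h s * slope φ f h θ ε s ^ 2)) ≤
          C * l * f s ∧
      h s * ((l * slope φ f h θ ε s) ^ 2 * deriv φ (l * slope φ f h θ ε s)) ≤
        C * l ^ (2 - θ) * f s := by
  obtain ⟨D, hD0, hD⟩ := hφ2.exists_hasDilationBound hφ
  obtain ⟨C₁, hC₁⟩ := exists_deriv_slope_mul_le hφ hφ0 hφ3 hf hh hε.le
  obtain ⟨C₂, hC₂0, hC₂⟩ := hφ3.exists_sq_mul_deriv_le hφ hφ0
  obtain ⟨C₃, hC₃⟩ := exists_mul_K_slope_le hφ hφ0 hφ3 hf hh hε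
  refine ⟨max (D * C₁) (C₂ * C₃), fun l hl hl2 s hs => ?_⟩
  have hfs := hf.pos s (hε.trans hs)
  have hhs := hh.nonneg s (hε.trans hs)
  have hq := slope_pos hφ hφ0 hφ3 hf hh hε.le hs
  have hN := slope_mul_slopeDeriv_add_nonneg hφ hφ0 hφ3 hf hh hε.le hs
  have hC₁s := hC₁ s hs
  have hC₃s := hC₃ s hs
  set q := slope φ f h θ ε s
  set N := q * slopeDeriv φ f h θ ε s + h s * q ^ 2
  constructor
  · calc deriv φ (l * q) * (l ^ 2 * N) = (l * deriv φ (l * q)) * (l * N) := by ring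
      _ ≤ (D * deriv φ q) * (l * N) :=
          mul_le_mul_of_nonneg_right (hD l hl.le (by linarith) q hq) (by positivity)
      _ = D * l * (deriv φ q * N) := by ring
      _ ≤ D * l * (C₁ * f s) := by gcongr
      _ = D * C₁ * l * f s := by ring
      _ ≤ max (D * C₁) (C₂ * C₃) * l * f s := by gcongr; exact le_max_left _ _
  · calc h s * ((l * q) ^ 2 * deriv φ (l * q)) ≤ h s * (C₂ * l ^ (2 - θ) * K φ q) :=
          mul_le_mul_of_nonneg_left (hC₂ l q hl hl2 hq) hhs
      _ = C₂ * l ^ (2 - θ) * (h s * K φ q) := by ring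
      _ ≤ C₂ * l ^ (2 - θ) * (C₃ * f s) := by gcongr
      _ = C₂ * C₃ * l ^ (2 - θ) * f s := by ring
      _ ≤ max (D * C₁) (C₂ * C₃) * l ^ (2 - θ) * f s := by gcongr; exact le_max_right _ _

end Slope

/-! ### Solutions of autonomous equations with finite blow-up time -/

/-- A vector field `q` on `[ε, ∞)` that vanishes only at `ε` and satisfies Osgood's condition
`∫_ε^∞ ds / q(s) < ∞`: some solution of `A' = q(A)` leaves the rest point `ε` in finite time and
then blows up in finite time. -/
structure IsOsgoodField (q : ℝ → ℝ) (ε : ℝ) : Prop where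
  continuousOn : ContinuousOn q (Ici ε)
  map_self : q ε = 0
  pos : ∀ s, ε < s → 0 < q s
  integrableOn_inv : IntegrableOn (fun s => (q s)⁻¹) (Ioi ε) volume

/-- The time a solution of `A' = q(A)` needs to move from `ε` to `t`. -/
noncomputable def travelTime (q : ℝ → ℝ) (ε t : ℝ) : ℝ := ∫ s in ε..t, (q s)⁻¹

/-- The time a solution of `A' = q(A)` needs to move from `ε` to `∞`. -/
noncomputable def blowupTime (q : ℝ → ℝ) (ε : ℝ) : ℝ := ∫ s in Ioi ε, (q s)⁻¹

/-- The solution of `A' = q(A)` that rests at `ε` until time `0` and then leaves it; only its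
values at times `x < blowupTime q ε` are meaningful. -/
noncomputable def flowOut (q : ℝ → ℝ) (ε x : ℝ) : ℝ :=
  if x ≤ 0 then ε else Function.invFunOn (travelTime q ε) (Ici ε) x

@[simp]
theorem travelTime_self (q : ℝ → ℝ) (ε : ℝ) : travelTime q ε ε = 0 :=
  intervalIntegral.integral_same

theorem flowOut_of_nonpos {q : ℝ → ℝ} {ε x : ℝ} (hx : x ≤ 0) : flowOut q ε x = ε := if_pos hx

namespace IsOsgoodField

variable {q : ℝ → ℝ} {ε t x : ℝ}

theorem nonneg (hq : IsOsgoodField q ε) (ht : ε ≤ t) : 0 ≤ q t := by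
  rcases ht.eq_or_lt with rfl | ht
  exacts [hq.map_self.ge, (hq.pos t ht).le]

theorem intervalIntegrable_inv (hq : IsOsgoodField q ε) (t : ℝ) (ht : ε ≤ t) :
    IntervalIntegrable (fun s => (q s)⁻¹) volume ε t :=
  (intervalIntegrable_iff_integrableOn_Ioc_of_le ht).2
    (hq.integrableOn_inv.mono_set Ioc_subset_Ioi_self)

theorem continuousOn_travelTime (hq : IsOsgoodField q ε) :
    ContinuousOn (travelTime q ε) (Ici ε) :=
  continuousOn_primitive_Ici hq.intervalIntegrable_inv

theorem hasDerivAt_travelTime (hq : IsOsgoodField q ε) (ht : ε < t) :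
    HasDerivAt (travelTime q ε) (q t)⁻¹ t :=
  hasDerivAt_primitive_Ioi ((hq.continuousOn.mono Ioi_subset_Ici_self).inv₀
    fun s hs => (hq.pos s hs).ne') hq.intervalIntegrable_inv ht

theorem strictMonoOn_travelTime (hq : IsOsgoodField q ε) :
    StrictMonoOn (travelTime q ε) (Ici ε) :=
  strictMonoOn_Ici_of_hasDerivAt_pos hq.continuousOn_travelTime
    (fun _ => hq.hasDerivAt_travelTime) fun t ht => inv_pos.2 (hq.pos t ht)

theorem tendsto_travelTime (hq : IsOsgoodField q ε) :
    Tendsto (travelTime q ε) atTop (𝓝 (blowupTime q ε)) :=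
  intervalIntegral_tendsto_integral_Ioi ε hq.integrableOn_inv tendsto_id

theorem travelTime_lt_blowupTime (hq : IsOsgoodField q ε) (ht : ε ≤ t) :
    travelTime q ε t < blowupTime q ε := by
  have ht1 : ε ≤ t + 1 := by linarith
  refine (hq.strictMonoOn_travelTime ht ht1 (lt_add_one t)).trans_le
    (ge_of_tendsto hq.tendsto_travelTime ?_)
  filter_upwards [eventually_ge_atTop (t + 1)] with s hs
  exact hq.strictMonoOn_travelTime.monotoneOn ht1 (ht1.trans hs) hs

theorem blowupTime_pos (hq : IsOsgoodField q ε) : 0 < blowupTime q ε := by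
  simpa using hq.travelTime_lt_blowupTime le_rfl

theorem travelTime_nonneg (hq : IsOsgoodField q ε) (ht : ε ≤ t) : 0 ≤ travelTime q ε t := by
  simpa using hq.strictMonoOn_travelTime.monotoneOn self_mem_Ici ht ht

theorem exists_travelTime_eq (hq : IsOsgoodField q ε) (hx : 0 < x) (hxL : x < blowupTime q ε) :
    ∃ z, ε < z ∧ travelTime q ε z = x := by
  obtain ⟨b, hxb, hb⟩ := ((hq.tendsto_travelTime.eventually_const_lt hxL).and
    (eventually_ge_atTop ε)).exists
  obtain ⟨z, hz, rfl⟩ := intermediate_value_Icc hb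
    (hq.continuousOn_travelTime.mono Icc_subset_Ici_self)
    ⟨(travelTime_self q ε).trans_le hx.le, hxb.le⟩
  refine ⟨z, hz.1.lt_of_ne' ?_, rfl⟩
  rintro rfl
  exact hx.ne' (travelTime_self q z)

theorem flowOut_eq_invFunOn (hq : IsOsgoodField q ε) (hx : 0 ≤ x) :
    flowOut q ε x = Function.invFunOn (travelTime q ε) (Ici ε) x := by
  rcases hx.eq_or_lt with rfl | hx
  · rw [flowOut_of_nonpos le_rfl, ← travelTime_self q ε,
      hq.strictMonoOn_travelTime.injOn.leftInvOn_invFunOn self_mem_Ici]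
  · exact if_neg hx.not_ge

theorem flowOut_travelTime (hq : IsOsgoodField q ε) (ht : ε ≤ t) :
    flowOut q ε (travelTime q ε t) = t := by
  rw [hq.flowOut_eq_invFunOn (hq.travelTime_nonneg ht)]
  exact hq.strictMonoOn_travelTime.injOn.leftInvOn_invFunOn ht

theorem lt_flowOut (hq : IsOsgoodField q ε) (hx : 0 < x) (hxL : x < blowupTime q ε) :
    ε < flowOut q ε x := by
  obtain ⟨z, hz, rfl⟩ := hq.exists_travelTime_eq hx hxL
  rwa [hq.flowOut_travelTime hz.le]

theorem le_flowOut (hq : IsOsgoodField q ε) (hxL : x < blowupTime q ε) :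
    ε ≤ flowOut q ε x := by
  rcases le_or_gt x 0 with hx | hx
  exacts [(flowOut_of_nonpos hx).ge, (hq.lt_flowOut hx hxL).le]

theorem hasDerivAt_flowOut_of_pos (hq : IsOsgoodField q ε) (hx : 0 < x)
    (hxL : x < blowupTime q ε) : HasDerivAt (flowOut q ε) (q (flowOut q ε x)) x := by
  obtain ⟨z, hz, rfl⟩ := hq.exists_travelTime_eq hx hxL
  have hd := hasDerivAt_invFunOn_Ici hq.strictMonoOn_travelTime hq.continuousOn_travelTime hz
    (hq.hasDerivAt_travelTime hz) (inv_pos.2 (hq.pos z hz)).ne'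
  rw [inv_inv] at hd
  rw [hq.flowOut_travelTime hz.le]
  refine hd.congr_of_eventuallyEq ?_
  filter_upwards [Ioi_mem_nhds hx] with y hy
  exact hq.flowOut_eq_invFunOn (le_of_lt hy)

theorem continuousWithinAt_flowOut_zero (hq : IsOsgoodField q ε) :
    ContinuousWithinAt (flowOut q ε) (Ici 0) 0 := by
  have hinv := continuousWithinAt_invFunOn_Ici hq.strictMonoOn_travelTime
    hq.continuousOn_travelTime
  rw [travelTime_self] at hinv
  exact hinv.congr (fun _ => hq.flowOut_eq_invFunOn) (hq.flowOut_eq_invFunOn le_rfl)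

theorem hasDerivWithinAt_flowOut_zero (hq : IsOsgoodField q ε) :
    HasDerivWithinAt (flowOut q ε) 0 (Ici 0) 0 := by
  have hnhds := Ioo_mem_nhdsGT hq.blowupTime_pos
  have hlim : Tendsto (flowOut q ε) (𝓝[>] 0) (𝓝[Ici ε] ε) := by
    refine tendsto_nhdsWithin_iff.2 ⟨?_, mem_of_superset hnhds fun y hy => hq.le_flowOut hy.2⟩
    simpa only [flowOut_of_nonpos le_rfl] using
      hq.continuousWithinAt_flowOut_zero.mono_left (nhdsWithin_mono 0 Ioi_subset_Ici_self)
  have hlim_q : Tendsto (fun x => q (flowOut q ε x)) (𝓝[>] 0) (𝓝 0) := by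
    simpa only [hq.map_self, Function.comp_def] using
      (hq.continuousOn ε self_mem_Ici).tendsto.comp hlim
  refine hasDerivWithinAt_Ici_of_tendsto_deriv (s := Ioo 0 (blowupTime q ε))
    (fun y hy => (hq.hasDerivAt_flowOut_of_pos hy.1 hy.2).differentiableAt.differentiableWithinAt)
    (hq.continuousWithinAt_flowOut_zero.mono fun y hy => hy.1.le) hnhds (hlim_q.congr' ?_)
  filter_upwards [hnhds] with y hy
  exact (hq.hasDerivAt_flowOut_of_pos hy.1 hy.2).deriv.symm

theorem hasDerivAt_flowOut (hq : IsOsgoodField q ε) (hxL : x < blowupTime q ε) :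
    HasDerivAt (flowOut q ε) (q (flowOut q ε x)) x := by
  rcases lt_trichotomy x 0 with hx | rfl | hx
  · rw [flowOut_of_nonpos hx.le, hq.map_self]
    refine (hasDerivAt_const x ε).congr_of_eventuallyEq ?_
    filter_upwards [Iio_mem_nhds hx] with y hy
    exact flowOut_of_nonpos (le_of_lt hy)
  · have hleft : HasDerivWithinAt (flowOut q ε) 0 (Iic 0) 0 :=
      (hasDerivWithinAt_const 0 (Iic 0) ε).congr (fun _ => flowOut_of_nonpos)
        (flowOut_of_nonpos le_rfl)
    rw [flowOut_of_nonpos le_rfl, hq.map_self, ← hasDerivWithinAt_univ, ← Iic_union_Ici (a := 0)]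
    exact hleft.union hq.hasDerivWithinAt_flowOut_zero
  · exact hq.hasDerivAt_flowOut_of_pos hx hxL

theorem monotoneOn_flowOut (hq : IsOsgoodField q ε) :
    MonotoneOn (flowOut q ε) (Iio (blowupTime q ε)) := by
  refine monotoneOn_of_hasDerivWithinAt_nonneg (f' := fun x => q (flowOut q ε x)) (convex_Iio _)
    (fun x hx => (hq.hasDerivAt_flowOut hx).continuousAt.continuousWithinAt) ?_ ?_ <;>
    rw [interior_Iio]
  · exact fun x hx => (hq.hasDerivAt_flowOut hx).hasDerivWithinAt
  · exact fun x hx => hq.nonneg (hq.le_flowOut hx)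

theorem tendsto_flowOut (hq : IsOsgoodField q ε) :
    Tendsto (flowOut q ε) (𝓝[<] blowupTime q ε) atTop := by
  refine tendsto_atTop.2 fun M => ?_
  have hz : ε ≤ max M ε := le_max_right _ _
  filter_upwards [Ioo_mem_nhdsLT (hq.travelTime_lt_blowupTime hz)] with x hx
  calc M ≤ max M ε := le_max_left _ _
    _ = flowOut q ε (travelTime q ε (max M ε)) := (hq.flowOut_travelTime hz).symm
    _ ≤ flowOut q ε x :=
      hq.monotoneOn_flowOut (hq.travelTime_lt_blowupTime hz) hx.2 hx.1.le

end IsOsgoodField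

theorem isOsgoodField_slope {φ f h : ℝ → ℝ} {θ ε : ℝ} (hφ : CondPhi φ) (hφ0 : CondPhi0 φ)
    (hφ3 : CondPhi3 φ θ) (hf : CondF f) (hh : CondH h) (hKO : KellerOsserman φ f h θ)
    (hε : 0 < ε) : IsOsgoodField (slope φ f h θ ε) ε where
  continuousOn := continuousOn_slope hφ hφ0 hφ3 hf hh hε.le
  map_self := slope_self hφ hφ0
  pos _ hs := slope_pos hφ hφ0 hφ3 hf hh hε.le hs
  integrableOn_inv := integrableOn_inv_slope hφ hφ0 hφ3 hf hh hε hKO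

/-! ### Radial profiles -/

/-- A radial profile `α` of a barrier, with derivative `p` and second derivative `p'`: it equals
`ε` on `(-∞, 1]`, blows up at `R`, and satisfies, up to the small factor `κ`, the differential
inequalities that make `α ∘ gauge` a supersolution. -/
structure IsProfile (φ f h : ℝ → ℝ) (ε κ R : ℝ) (α p p' : ℝ → ℝ) : Prop where
  eps_pos : 0 < ε
  one_lt : 1 < R
  eq_of_le_one : ∀ r, r ≤ 1 → α r = ε
  deriv_eq_zero : ∀ r, r ≤ 1 → p r = 0
  lt_of_one_lt : ∀ r, 1 < r → r < R → ε < α r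
  deriv_pos : ∀ r, 1 < r → r < R → 0 < p r
  tendsto_atTop : Tendsto α (𝓝[<] R) atTop
  hasDerivAt : ∀ r, r < R → HasDerivAt α (p r) r
  continuousOn_deriv : ContinuousOn p (Iio R)
  hasDerivAt_deriv : ∀ r, 1 < r → r < R → HasDerivAt p (p' r) r
  continuousOn_deriv2 : ContinuousOn p' (Ioo 1 R)
  deriv_mul_le : ∀ r, 1 < r → r < R →
    deriv φ (p r) * (p' r + h (α r) * p r ^ 2) ≤ κ * f (α r)
  mul_sq_mul_deriv_le : ∀ r, 1 < r → r < R →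
    h (α r) * (p r ^ 2 * deriv φ (p r)) ≤ κ * f (α r)

namespace IsProfile

variable {φ f h : ℝ → ℝ} {ε κ R r : ℝ} {α p p' : ℝ → ℝ}

theorem le (hP : IsProfile φ f h ε κ R α p p') (hr : r < R) : ε ≤ α r := by
  rcases le_or_gt r 1 with h1 | h1
  exacts [(hP.eq_of_le_one r h1).ge, (hP.lt_of_one_lt r h1 hr).le]

theorem pos (hP : IsProfile φ f h ε κ R α p p') (hr : r < R) : 0 < α r :=
  hP.eps_pos.trans_le (hP.le hr)

theorem deriv_nonneg (hP : IsProfile φ f h ε κ R α p p') (hr : r < R) : 0 ≤ p r := by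
  rcases le_or_gt r 1 with h1 | h1
  exacts [(hP.deriv_eq_zero r h1).ge, (hP.deriv_pos r h1 hr).le]

theorem monotoneOn (hP : IsProfile φ f h ε κ R α p p') : MonotoneOn α (Iio R) := by
  refine monotoneOn_of_hasDerivWithinAt_nonneg (f' := p) (convex_Iio R)
    (fun r hr => (hP.hasDerivAt r hr).continuousAt.continuousWithinAt) ?_ ?_ <;>
    rw [interior_Iio]
  · exact fun r hr => (hP.hasDerivAt r hr).hasDerivWithinAt
  · exact fun r hr => hP.deriv_nonneg hr

theorem map_deriv_le (hP : IsProfile φ f h ε κ R α p p') (hφ : CondPhi φ) (hf : CondF f)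
    (hh : CondH h) (hκ : 0 ≤ κ) (h1r : 1 < r) (hr : r < R) : φ (p r) ≤ κ * f (α r) * r := by
  have hle : ∀ x ∈ Ioo 1 r, deriv φ (p x) * p' x ≤ κ * f (α r) * 1 := fun x hx => by
    have hxR : x < R := hx.2.trans hr
    have hhp : 0 ≤ deriv φ (p x) * (h (α x) * p x ^ 2) :=
      mul_nonneg (hφ.deriv_pos _ (hP.deriv_pos x hx.1 hxR)).le
        (mul_nonneg (hh.nonneg _ (hP.pos hxR)) (sq_nonneg _))
    have hfx : κ * f (α x) ≤ κ * f (α r) := mul_le_mul_of_nonneg_left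
      (hf.monotoneOn (hP.pos hxR).le (hP.pos hr).le (hP.monotoneOn hxR hr hx.2.le)) hκ
    linarith [hP.deriv_mul_le x hx.1 hxR]
  have hsub := sub_le_sub_of_hasDerivAt_le (F := fun x => φ (p x)) h1r.le
    (hφ.continuousOn.comp (hP.continuousOn_deriv.mono fun x hx => hx.2.trans_lt hr)
      fun x hx => hP.deriv_nonneg (hx.2.trans_lt hr))
    (by fun_prop)
    (fun x hx => (hφ.hasDerivAt (hP.deriv_pos x hx.1 (hx.2.trans hr))).comp x
      (hP.hasDerivAt_deriv x hx.1 (hx.2.trans hr)))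
    (fun x _ => (hasDerivAt_id x).const_mul (κ * f (α r))) hle
  simp only [hP.deriv_eq_zero 1 le_rfl, hφ.map_zero, sub_zero, id, mul_one] at hsub
  have hκf : 0 ≤ κ * f (α r) := mul_nonneg hκ (hf.pos _ (hP.pos hr)).le
  linarith

end IsProfile

/-- The solution of `A' = q(A)` leaving `ε`, slowed down by the factor `l` and started at `1`. -/
noncomputable def slowFlow (q : ℝ → ℝ) (ε l r : ℝ) : ℝ := flowOut q ε (l * (r - 1))

theorem slowFlow_of_le_one {q : ℝ → ℝ} {ε l r : ℝ} (hl : 0 ≤ l) (hr : r ≤ 1) :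
    slowFlow q ε l r = ε :=
  flowOut_of_nonpos (mul_nonpos_of_nonneg_of_nonpos hl (sub_nonpos.2 hr))

theorem mul_sub_one_lt_iff {l r L : ℝ} (hl : 0 < l) : l * (r - 1) < L ↔ r < 1 + L / l := by
  rw [← sub_lt_iff_lt_add', lt_div_iff₀' hl]

namespace IsOsgoodField

variable {q q' : ℝ → ℝ} {ε l r : ℝ}

theorem hasDerivAt_slowFlow (hq : IsOsgoodField q ε) (hl : 0 < l)
    (hr : r < 1 + blowupTime q ε / l) :
    HasDerivAt (slowFlow q ε l) (l * q (slowFlow q ε l r)) r :=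
  (HasDerivAt.comp r (hq.hasDerivAt_flowOut ((mul_sub_one_lt_iff hl).2 hr))
    (((hasDerivAt_id r).sub_const 1).const_mul l)).congr_deriv (by rw [mul_one, mul_comm]; rfl)

theorem lt_slowFlow (hq : IsOsgoodField q ε) (hl : 0 < l) (h1r : 1 < r)
    (hr : r < 1 + blowupTime q ε / l) : ε < slowFlow q ε l r :=
  hq.lt_flowOut (mul_pos hl (sub_pos.2 h1r)) ((mul_sub_one_lt_iff hl).2 hr)

theorem continuousOn_slowFlow (hq : IsOsgoodField q ε) (hl : 0 < l) :
    ContinuousOn (slowFlow q ε l) (Iio (1 + blowupTime q ε / l)) :=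
  fun _ hr => (hq.hasDerivAt_slowFlow hl hr).continuousAt.continuousWithinAt

theorem tendsto_slowFlow (hq : IsOsgoodField q ε) (hl : 0 < l) :
    Tendsto (slowFlow q ε l) (𝓝[<] (1 + blowupTime q ε / l)) atTop := by
  refine hq.tendsto_flowOut.comp (tendsto_nhdsWithin_iff.2 ⟨?_, ?_⟩)
  · have hcont : Continuous fun r : ℝ => l * (r - 1) := by fun_prop
    have hlim := hcont.tendsto (1 + blowupTime q ε / l)
    rw [add_sub_cancel_left, mul_div_cancel₀ _ hl.ne'] at hlim
    exact hlim.mono_left nhdsWithin_le_nhds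
  · exact eventually_nhdsWithin_of_forall fun r hr => (mul_sub_one_lt_iff hl).2 hr

theorem hasDerivAt_mul_slowFlow (hq : IsOsgoodField q ε) (hl : 0 < l)
    (hqd : ∀ s, ε < s → HasDerivAt q (q' s) s) (h1r : 1 < r) (hr : r < 1 + blowupTime q ε / l) :
    HasDerivAt (fun r => l * q (slowFlow q ε l r))
      (l ^ 2 * (q (slowFlow q ε l r) * q' (slowFlow q ε l r))) r :=
  (((hqd _ (hq.lt_slowFlow hl h1r hr)).comp r (hq.hasDerivAt_slowFlow hl hr)).const_mul
    l).congr_deriv (by ring)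

theorem eventually_slowFlow_lt (hq : IsOsgoodField q ε) {ρ η : ℝ} (hη : ε < η) :
    ∀ᶠ l in 𝓝[>] 0, ρ < 1 + blowupTime q ε / l ∧ slowFlow q ε l ρ < η := by
  have hlim : Tendsto (fun l : ℝ => l * (ρ - 1)) (𝓝[>] 0) (𝓝 0) := by
    have hcont : Continuous fun l : ℝ => l * (ρ - 1) := by fun_prop
    simpa using (hcont.tendsto 0).mono_left nhdsWithin_le_nhds
  have hflow : Tendsto (fun l => slowFlow q ε l ρ) (𝓝[>] 0) (𝓝 ε) := by
    have hcont := (hq.hasDerivAt_flowOut hq.blowupTime_pos).continuousAt.tendsto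
    rw [flowOut_of_nonpos le_rfl] at hcont
    exact hcont.comp hlim
  filter_upwards [self_mem_nhdsWithin, hlim.eventually_lt_const hq.blowupTime_pos,
    hflow.eventually_lt_const hη] with l hl hL hlη
  exact ⟨(mul_sub_one_lt_iff hl).1 hL, hlη⟩

end IsOsgoodField

theorem eventually_mul_rpow_le {κ a : ℝ} (hκ : 0 < κ) (ha : 0 < a) (C : ℝ) :
    ∀ᶠ l : ℝ in 𝓝[>] 0, C * l ^ a ≤ κ := by
  have hlim : Tendsto (fun l : ℝ => C * l ^ a) (𝓝[>] 0) (𝓝 (C * 0 ^ a)) :=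
    ((tendsto_id.mono_left nhdsWithin_le_nhds).rpow_const (Or.inr ha.le)).const_mul C
  rw [Real.zero_rpow ha.ne', mul_zero] at hlim
  exact hlim.eventually_le_const hκ

section SlopeProfile

variable {φ f h : ℝ → ℝ} {τ θ ε κ l : ℝ}

theorem isProfile_slowFlow_slope (hφ : CondPhi φ) (hφ0 : CondPhi0 φ) (hφ3 : CondPhi3 φ θ)
    (hf : CondF f) (hh : CondH h) (hKO : KellerOsserman φ f h θ) (hε : 0 < ε) (hl : 0 < l)
    (hslope : ∀ s, ε < s →
      deriv φ (l * slope φ f h θ ε s) * (l ^ 2 *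
        (slope φ f h θ ε s * slopeDeriv φ f h θ ε s + h s * slope φ f h θ ε s ^ 2)) ≤
          κ * f s ∧
      h s * ((l * slope φ f h θ ε s) ^ 2 * deriv φ (l * slope φ f h θ ε s)) ≤ κ * f s) :
    IsProfile φ f h ε κ (1 + blowupTime (slope φ f h θ ε) ε / l)
      (slowFlow (slope φ f h θ ε) ε l)
      (fun r => l * slope φ f h θ ε (slowFlow (slope φ f h θ ε) ε l r))
      (fun r => l ^ 2 * (slope φ f h θ ε (slowFlow (slope φ f h θ ε) ε l r) *
        slopeDeriv φ f h θ ε (slowFlow (slope φ f h θ ε) ε l r))) :=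
  have hq : IsOsgoodField (slope φ f h θ ε) ε :=
    isOsgoodField_slope hφ hφ0 hφ3 hf hh hKO hε
  have hge : ∀ r, r < 1 + blowupTime (slope φ f h θ ε) ε / l →
      ε ≤ slowFlow (slope φ f h θ ε) ε l r :=
    fun _ hr => hq.le_flowOut ((mul_sub_one_lt_iff hl).2 hr)
  { eps_pos := hε
    one_lt := lt_add_of_pos_right 1 (div_pos hq.blowupTime_pos hl)
    eq_of_le_one := fun _ hr => slowFlow_of_le_one hl.le hr
    deriv_eq_zero := fun r hr => by simp only [slowFlow_of_le_one hl.le hr, hq.map_self, mul_zero]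
    lt_of_one_lt := fun _ => hq.lt_slowFlow hl
    deriv_pos := fun r h1r hr => mul_pos hl (hq.pos _ (hq.lt_slowFlow hl h1r hr))
    tendsto_atTop := hq.tendsto_slowFlow hl
    hasDerivAt := fun _ => hq.hasDerivAt_slowFlow hl
    continuousOn_deriv := continuousOn_const.mul
      (hq.continuousOn.comp (hq.continuousOn_slowFlow hl) hge)
    hasDerivAt_deriv := fun _ => hq.hasDerivAt_mul_slowFlow hl
      fun _ => hasDerivAt_slope hφ hφ0 hφ3 hf hh hε.le
    continuousOn_deriv2 :=
      have hcont := (hq.continuousOn_slowFlow hl).mono Ioo_subset_Iio_self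
      continuousOn_const.mul ((hq.continuousOn.comp hcont fun r hr => hge r hr.2).mul
        ((continuousOn_slopeDeriv hφ hφ0 hφ3 hf hh hε.le).comp hcont
          fun r hr => hq.lt_slowFlow hl hr.1 hr.2))
    deriv_mul_le := fun r h1r hr => by
      refine le_trans (le_of_eq ?_) (hslope _ (hq.lt_slowFlow hl h1r hr)).1
      ring
    mul_sq_mul_deriv_le := fun r h1r hr => (hslope _ (hq.lt_slowFlow hl h1r hr)).2 }

theorem exists_isProfile (hφ : CondPhi φ) (hφ0 : CondPhi0 φ) (hφ2 : CondPhi2 φ τ)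
    (hφ3 : CondPhi3 φ θ) (hf : CondF f) (hh : CondH h) (hKO : KellerOsserman φ f h θ)
    (hε : 0 < ε) (hκ : 0 < κ) (ρ : ℝ) {η : ℝ} (hη : ε < η) :
    ∃ (R : ℝ) (α p p' : ℝ → ℝ), IsProfile φ f h ε κ R α p p' ∧ ρ < R ∧ α ρ < η := by
  obtain ⟨C, hC⟩ := exists_slope_le hφ hφ0 hφ2 hφ3 hf hh hε
  have hq : IsOsgoodField (slope φ f h θ ε) ε := isOsgoodField_slope hφ hφ0 hφ3 hf hh hKO hε
  have hlin : ∀ᶠ l : ℝ in 𝓝[>] 0, C * l ^ (1 : ℝ) ≤ κ := eventually_mul_rpow_le hκ one_pos C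
  obtain ⟨l, ⟨hl, hl2⟩, hlin, hpow, hρ, hlη⟩ :=
    (Filter.Eventually.and (Ioc_mem_nhdsGT (by norm_num : (0 : ℝ) < 1 / 2)) (hlin.and
      ((eventually_mul_rpow_le hκ (sub_pos.2 hφ3.1) C).and
        (hq.eventually_slowFlow_lt (ρ := ρ) hη)))).exists
  rw [Real.rpow_one] at hlin
  refine ⟨_, _, _, _, isProfile_slowFlow_slope hφ hφ0 hφ3 hf hh hKO hε hl fun s hs => ?_, hρ, hlη⟩
  have hfs := (hf.pos s (hε.trans hs)).le
  exact ⟨(hC l hl hl2 s hs).1.trans (mul_le_mul_of_nonneg_right hlin hfs),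
    (hC l hl hl2 s hs).2.trans (mul_le_mul_of_nonneg_right hpow hfs)⟩

end SlopeProfile

/-! ### Horizontal calculus -/

theorem continuous_mul_of_tsupport_subset {E : Type*} [TopologicalSpace E] {F ζ : E → ℝ}
    {U : Set E} (hU : IsOpen U) (hF : ContinuousOn F U) (hζ : Continuous ζ)
    (hsub : tsupport ζ ⊆ U) : Continuous fun q => F q * ζ q :=
  (hF.mul hζ.continuousOn).continuous_of_tsupport_subset hU
    ((closure_mono (Function.support_mul_subset_right F ζ)).trans hsub)

theorem integrable_mul_of_tsupport_subset {E : Type*} [TopologicalSpace E] [MeasurableSpace E]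
    [OpensMeasurableSpace E] {μ : Measure E} [IsFiniteMeasureOnCompacts μ] {F ζ : E → ℝ}
    {U : Set E} (hU : IsOpen U) (hF : ContinuousOn F U) (hζ : Continuous ζ)
    (hc : HasCompactSupport ζ) (hsub : tsupport ζ ⊆ U) : Integrable (fun q => F q * ζ q) μ :=
  (continuous_mul_of_tsupport_subset hU hF hζ hsub).integrable_of_hasCompactSupport hc.mul_left

theorem contDiff_smul_of_tsupport_subset {E F : Type*} [NormedAddCommGroup E] [NormedSpace ℝ E]
    [NormedAddCommGroup F] [NormedSpace ℝ F] {n : WithTop ℕ∞} {ζ : E → ℝ} {W : E → F} {U : Set E}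
    (hU : IsOpen U) (hζ : ContDiff ℝ n ζ) (hW : ContDiffOn ℝ n W U) (hsub : tsupport ζ ⊆ U) :
    ContDiff ℝ n fun q => ζ q • W q := by
  refine contDiff_iff_contDiffAt.2 fun q => ?_
  by_cases hq : q ∈ tsupport ζ
  · exact hζ.contDiffAt.smul (hW.contDiffAt (hU.mem_nhds (hsub hq)))
  · refine contDiffAt_const.congr_of_eventuallyEq (f := fun _ => 0) ?_
    filter_upwards [notMem_tsupport_iff_eventuallyEq.1 hq] with x hx
    simp [hx]

theorem integral_fderiv_eq_zero {E : Type*} [NormedAddCommGroup E] [NormedSpace ℝ E]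
    [FiniteDimensional ℝ E] [MeasurableSpace E] [BorelSpace E] {μ : Measure E}
    [μ.IsAddHaarMeasure] {k : E → ℝ} (hk : ContDiff ℝ 1 k) (hc : HasCompactSupport k) (v : E) :
    ∫ q, fderiv ℝ k q v ∂μ = 0 := by
  have hk' : Integrable (fun q => fderiv ℝ k q v) μ :=
    ((hk.continuous_fderiv one_ne_zero).clm_apply
      continuous_const).integrable_of_hasCompactSupport (hc.fderiv_apply ℝ v)
  simpa using integral_mul_fderiv_eq_neg_fderiv_mul_of_integrable (μ := μ) (v := v)
    (f := fun _ : E => (1 : ℝ)) (g := k) (by simp) (by simpa using hk')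
    (by simpa using hk.continuous.integrable_of_hasCompactSupport hc)
    (fun _ _ => differentiableAt_const _) fun q _ => hk.differentiable one_ne_zero q

instance isAddHaarMeasure_volume_point (m : ℕ) :
    (volume : Measure (Point m)).IsAddHaarMeasure :=
  haveI : (volume : Measure ((Fin m → ℝ) × ℝ)).IsAddHaarMeasure :=
    Measure.prod.instIsAddHaarMeasure volume volume
  Measure.prod.instIsAddHaarMeasure volume volume

section HorizontalCalculus

variable {m : ℕ}

/-- The horizontal frame: `X_j` is the field `frame (Sum.inl j)` and `Y_j` is
`frame (Sum.inr j)`. -/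
def frame (i : Fin m ⊕ Fin m) (q : Point m) : Point m :=
  Sum.elim (fun j => (Pi.single j 1, 0, 2 * q.2.1 j)) (fun j => (0, Pi.single j 1, -2 * q.1 j)) i

/-- The horizontal gradient, as the vector of its components in the frame `X_j, Y_j`. -/
noncomputable def hgrad (u : Point m → ℝ) (q : Point m) : EuclideanSpace ℝ (Fin m ⊕ Fin m) :=
  WithLp.toLp 2 fun i => fderiv ℝ u q (frame i q)

/-- The horizontal divergence of the field with components `W` in the frame `X_j, Y_j`. -/
noncomputable def hdiv (W : Point m → EuclideanSpace ℝ (Fin m ⊕ Fin m)) (q : Point m) : ℝ :=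
  ∑ i, fderiv ℝ (fun q => W q i) q (frame i q)

theorem hgrad_apply (u : Point m → ℝ) (q : Point m) (i : Fin m ⊕ Fin m) :
    hgrad u q i = fderiv ℝ u q (frame i q) := rfl

theorem gradDot_eq_inner (u v : Point m → ℝ) (q : Point m) :
    gradDot u v q = inner ℝ (hgrad u q) (hgrad v q) := by
  simp [gradDot, PiLp.inner_apply, hgrad_apply, frame, X, Y, Finset.sum_add_distrib, mul_comm]

theorem gradNorm_eq_norm (u : Point m → ℝ) (q : Point m) : gradNorm u q = ‖hgrad u q‖ := by
  rw [gradNorm, gradDot_eq_inner, real_inner_self_eq_norm_sq, Real.sqrt_sq (norm_nonneg _)]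

theorem inner_hgrad_eq_sum (a : EuclideanSpace ℝ (Fin m ⊕ Fin m)) (ζ : Point m → ℝ)
    (q : Point m) : inner ℝ a (hgrad ζ q) = ∑ i, a i * fderiv ℝ ζ q (frame i q) := by
  simp [PiLp.inner_apply, hgrad_apply, mul_comm]

theorem hgrad_congr {u v : Point m → ℝ} {q : Point m} (h : u =ᶠ[𝓝 q] v) :
    hgrad u q = hgrad v q := by
  ext i
  rw [hgrad_apply, hgrad_apply, h.fderiv_eq]

theorem hgrad_comp {f : ℝ → ℝ} {f' : ℝ} {u : Point m → ℝ} {q : Point m}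
    (hf : HasDerivAt f f' (u q)) (hu : DifferentiableAt ℝ u q) :
    hgrad (fun q => f (u q)) q = f' • hgrad u q := by
  ext i
  have h : HasFDerivAt (fun q => f (u q)) (f' • fderiv ℝ u q) q :=
    hf.comp_hasFDerivAt q hu.hasFDerivAt
  simp [hgrad_apply, h.fderiv]

theorem hgrad_sub {u v : Point m → ℝ} {q : Point m} (hu : DifferentiableAt ℝ u q)
    (hv : DifferentiableAt ℝ v q) :
    hgrad (fun q => u q - v q) q = hgrad u q - hgrad v q := by
  ext i
  simp [hgrad_apply, fderiv_fun_sub hu hv]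

theorem hgrad_mul {u v : Point m → ℝ} {q : Point m} (hu : DifferentiableAt ℝ u q)
    (hv : DifferentiableAt ℝ v q) :
    hgrad (fun q => u q * v q) q = u q • hgrad v q + v q • hgrad u q := by
  ext i
  simp [hgrad_apply, fderiv_fun_mul hu hv]

theorem hgrad_eq_zero_of_notMem_tsupport {u : Point m → ℝ} {q : Point m} (hq : q ∉ tsupport u) :
    hgrad u q = 0 := by
  ext i
  simp [hgrad_apply, fderiv_of_notMem_tsupport ℝ hq]

theorem hdiv_congr {V W : Point m → EuclideanSpace ℝ (Fin m ⊕ Fin m)} {q : Point m}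
    (h : V =ᶠ[𝓝 q] W) : hdiv V q = hdiv W q := by
  refine Finset.sum_congr rfl fun i _ => ?_
  have hi : (fun q => V q i) =ᶠ[𝓝 q] fun q => W q i := h.fun_comp fun a => a i
  rw [hi.fderiv_eq]

theorem hdiv_smul {k : Point m → ℝ} {W : Point m → EuclideanSpace ℝ (Fin m ⊕ Fin m)}
    {q : Point m} (hk : DifferentiableAt ℝ k q) (hW : DifferentiableAt ℝ W q) :
    hdiv (fun q => k q • W q) q = inner ℝ (W q) (hgrad k q) + k q * hdiv W q := by
  rw [inner_hgrad_eq_sum, hdiv, hdiv, Finset.mul_sum, ← Finset.sum_add_distrib]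
  refine Finset.sum_congr rfl fun i _ => ?_
  simp only [PiLp.smul_apply, smul_eq_mul]
  rw [fderiv_fun_mul hk (differentiableAt_euclidean.1 hW i)]
  simp [add_comm]

theorem contDiff_frame (i : Fin m ⊕ Fin m) : ContDiff ℝ 1 (frame (m := m) i) := by
  unfold frame
  rcases i with j | j <;> simp only [Sum.elim_inl, Sum.elim_inr] <;> fun_prop

theorem continuousOn_hgrad {u : Point m → ℝ} {U : Set (Point m)} (hU : IsOpen U)
    (hu : ContDiffOn ℝ 1 u U) : ContinuousOn (hgrad u) U := by
  refine (PiLp.continuous_toLp 2 _).comp_continuousOn (continuousOn_pi.2 fun i => ?_)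
  exact (hu.continuousOn_fderiv_of_isOpen hU le_rfl).clm_apply
    (contDiff_frame i).continuous.continuousOn

theorem contDiffAt_hgrad {u : Point m → ℝ} {q : Point m} (hu : ContDiffAt ℝ 2 u q) :
    ContDiffAt ℝ 1 (hgrad u) q :=
  contDiffAt_euclidean.2 fun i =>
    (hu.fderiv_right (m := 1) (by norm_num)).clm_apply (contDiff_frame i).contDiffAt

theorem continuous_hgrad {u : Point m → ℝ} (hu : ContDiff ℝ 1 u) : Continuous (hgrad u) :=
  continuousOn_univ.1 (continuousOn_hgrad isOpen_univ hu.contDiffOn)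

theorem continuousOn_hdiv {W : Point m → EuclideanSpace ℝ (Fin m ⊕ Fin m)} {U : Set (Point m)}
    (hU : IsOpen U) (hW : ContDiffOn ℝ 1 W U) : ContinuousOn (hdiv W) U :=
  continuousOn_finsetSum _ fun i _ =>
    ((contDiffOn_euclidean.1 hW i).continuousOn_fderiv_of_isOpen hU le_rfl).clm_apply
      (contDiff_frame i).continuous.continuousOn

theorem tsupport_hgrad_subset (u : Point m → ℝ) : tsupport (hgrad u) ⊆ tsupport u :=
  closure_minimal (fun _ hq => by_contra fun h => hq (hgrad_eq_zero_of_notMem_tsupport h))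
    (isClosed_tsupport u)

theorem hasCompactSupport_hgrad {u : Point m → ℝ} (hc : HasCompactSupport u) :
    HasCompactSupport (hgrad u) :=
  hc.of_isClosed_subset (isClosed_tsupport _) (tsupport_hgrad_subset u)

theorem integrable_norm_hgrad {u : Point m → ℝ} (hu : ContDiff ℝ 1 u)
    (hc : HasCompactSupport u) : Integrable fun q => ‖hgrad u q‖ :=
  (continuous_hgrad hu).norm.integrable_of_hasCompactSupport (hasCompactSupport_hgrad hc).norm

theorem integrable_inner_hgrad {U : Set (Point m)} {ζ : Point m → ℝ}
    {W : Point m → EuclideanSpace ℝ (Fin m ⊕ Fin m)} (hU : IsOpen U) (hW : ContinuousOn W U)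
    (hζ : ContDiff ℝ 1 ζ) (hc : HasCompactSupport ζ) (hsub : tsupport ζ ⊆ U) :
    Integrable fun q => inner ℝ (W q) (hgrad ζ q) := by
  have hsupp : tsupport (fun q => inner ℝ (W q) (hgrad ζ q)) ⊆ tsupport (hgrad ζ) :=
    closure_mono fun q hq h => hq (by simp only [h, inner_zero_right])
  have hinner := hW.inner (𝕜 := ℝ) (continuous_hgrad hζ).continuousOn
  exact (hinner.continuous_of_tsupport_subset hU
    (hsupp.trans ((tsupport_hgrad_subset ζ).trans hsub))).integrable_of_hasCompactSupport
    ((hasCompactSupport_hgrad hc).of_isClosed_subset (isClosed_tsupport _) hsupp)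

theorem exists_frame_eq_add_smul (i : Fin m ⊕ Fin m) : ∃ c : Point m →L[ℝ] ℝ,
    c (0, 0, 1) = 0 ∧ ∀ q, frame i q = frame i 0 + c q • (0, 0, 1) := by
  rcases i with j | j
  · exact ⟨(2 : ℝ) • (ContinuousLinearMap.proj j ∘L ContinuousLinearMap.fst ℝ (Fin m → ℝ) ℝ ∘L
      ContinuousLinearMap.snd ℝ (Fin m → ℝ) _), by simp, fun q => by simp [frame]⟩
  · exact ⟨(-2 : ℝ) • (ContinuousLinearMap.proj j ∘L ContinuousLinearMap.fst ℝ (Fin m → ℝ) _),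
      by simp, fun q => by simp [frame]⟩

theorem integral_fderiv_frame_eq_zero {k : Point m → ℝ} (hk : ContDiff ℝ 1 k)
    (hc : HasCompactSupport k) (i : Fin m ⊕ Fin m) : ∫ q, fderiv ℝ k q (frame i q) = 0 := by
  obtain ⟨c, hc0, hframe⟩ := exists_frame_eq_add_smul i
  have hck : ContDiff ℝ 1 fun q => c q * k q := c.contDiff.mul hk
  have hint : ∀ {k : Point m → ℝ}, ContDiff ℝ 1 k → HasCompactSupport k → ∀ v,
      Integrable fun q => fderiv ℝ k q v := fun hk hc v =>
    ((hk.continuous_fderiv one_ne_zero).clm_apply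
      continuous_const).integrable_of_hasCompactSupport (hc.fderiv_apply ℝ v)
  calc ∫ q, fderiv ℝ k q (frame i q)
      = ∫ q, (fderiv ℝ k q (frame i 0) + fderiv ℝ (fun q => c q * k q) q (0, 0, 1)) := by
        congr 1 with q
        rw [fderiv_fun_mul c.differentiableAt (hk.differentiable one_ne_zero q), hframe q,
          map_add, map_smul]
        simp [hc0]
    _ = 0 := by
        rw [integral_add (hint hk hc _) (hint hck hc.mul_left _), integral_fderiv_eq_zero hk hc,
          integral_fderiv_eq_zero hck hc.mul_left, add_zero]

theorem integral_hdiv_eq_zero {W : Point m → EuclideanSpace ℝ (Fin m ⊕ Fin m)}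
    (hW : ContDiff ℝ 1 W) (hc : HasCompactSupport W) : ∫ q, hdiv W q = 0 := by
  have hWi : ∀ i, ContDiff ℝ 1 fun q => W q i := contDiff_euclidean.1 hW
  have hci : ∀ i, HasCompactSupport fun q => W q i := fun i =>
    hc.mono fun q hq h => hq (by simp [h])
  simp only [hdiv]
  rw [integral_finsetSum]
  · exact Finset.sum_eq_zero fun i _ => integral_fderiv_frame_eq_zero (hWi i) (hci i) i
  · refine fun i _ => Continuous.integrable_of_hasCompactSupport
      (((hWi i).continuous_fderiv one_ne_zero).clm_apply (contDiff_frame i).continuous) ?_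
    exact ((hci i).fderiv ℝ).mono fun q hq h => hq (by simp [h])

theorem integral_inner_hgrad_eq_neg {U : Set (Point m)} {ζ : Point m → ℝ}
    {W : Point m → EuclideanSpace ℝ (Fin m ⊕ Fin m)} (hU : IsOpen U) (hW : ContDiffOn ℝ 1 W U)
    (hζ : ContDiff ℝ 1 ζ) (hc : HasCompactSupport ζ) (hsub : tsupport ζ ⊆ U) :
    ∫ q, inner ℝ (W q) (hgrad ζ q) = -∫ q, hdiv W q * ζ q := by
  rw [eq_neg_iff_add_eq_zero, ← integral_add
    (integrable_inner_hgrad hU hW.continuousOn hζ hc hsub)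
    (integrable_mul_of_tsupport_subset hU (continuousOn_hdiv hU hW) hζ.continuous hc hsub),
    ← integral_hdiv_eq_zero (contDiff_smul_of_tsupport_subset hU hζ hW hsub) hc.smul_right]
  congr 1 with q
  by_cases hq : q ∈ tsupport ζ
  · rw [hdiv_smul (hζ.differentiable one_ne_zero q)
      ((hW.contDiffAt (hU.mem_nhds (hsub hq))).differentiableAt one_ne_zero), mul_comm (ζ q)]
  · have hzero : (fun q => ζ q • W q) =ᶠ[𝓝 q] fun _ => 0 := by
      filter_upwards [notMem_tsupport_iff_eventuallyEq.1 hq] with x hx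
      simp [hx]
    rw [hdiv_congr hzero, image_eq_zero_of_notMem_tsupport hq,
      hgrad_eq_zero_of_notMem_tsupport hq]
    simp [hdiv]

end HorizontalCalculus

/-! ### The Korányi gauge -/

section Gauge

variable {m : ℕ}

/-- The square `|z|²` of the horizontal coordinate `z = (x, y)`. -/
def zSq (q : Point m) : ℝ := ∑ j, (q.1 j ^ 2 + q.2.1 j ^ 2)

/-- The fourth power `|z|⁴ + t²` of the Korányi gauge, a polynomial. -/
def gaugeFour (q : Point m) : ℝ := zSq q ^ 2 + q.2.2 ^ 2

/-- The Korányi gauge `(|z|⁴ + t²)^(1/4)`. -/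
noncomputable def gauge (q : Point m) : ℝ := √√(gaugeFour q)

/-- The density `|z| / r` of the Korányi gauge `r`, which is the length of the horizontal gradient
of `r` away from the origin. -/
noncomputable def density (q : Point m) : ℝ := √(zSq q) / gauge q

theorem zSq_nonneg (q : Point m) : 0 ≤ zSq q :=
  Finset.sum_nonneg fun _ _ => by positivity

theorem gaugeFour_nonneg (q : Point m) : 0 ≤ gaugeFour q := by
  unfold gaugeFour; positivity

theorem gauge_pow_four (q : Point m) : gauge q ^ 4 = gaugeFour q := by
  rw [gauge, show 4 = 2 * 2 from rfl, pow_mul, Real.sq_sqrt (Real.sqrt_nonneg _),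
    Real.sq_sqrt (gaugeFour_nonneg q)]

theorem gauge_nonneg (q : Point m) : 0 ≤ gauge q := Real.sqrt_nonneg _

theorem density_nonneg (q : Point m) : 0 ≤ density q :=
  div_nonneg (Real.sqrt_nonneg _) (gauge_nonneg q)

theorem zSq_le_gauge_sq (q : Point m) : zSq q ≤ gauge q ^ 2 := by
  rw [gauge, Real.sq_sqrt (Real.sqrt_nonneg _)]
  exact Real.le_sqrt_of_sq_le (le_add_of_nonneg_right (sq_nonneg _))

theorem abs_vertical_le_gauge_sq (q : Point m) : |q.2.2| ≤ gauge q ^ 2 := by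
  rw [gauge, Real.sq_sqrt (Real.sqrt_nonneg _)]
  exact Real.abs_le_sqrt (le_add_of_nonneg_left (sq_nonneg _))

theorem density_le_one (q : Point m) : density q ≤ 1 :=
  div_le_one_of_le₀ (Real.sqrt_le_iff.2 ⟨gauge_nonneg q, zSq_le_gauge_sq q⟩) (gauge_nonneg q)

theorem density_sq {q : Point m} (hq : 0 < gauge q) : density q ^ 2 * gauge q ^ 2 = zSq q := by
  rw [density, div_pow, Real.sq_sqrt (zSq_nonneg q), div_mul_cancel₀ _ (by positivity)]

theorem contDiff_zSq {n : WithTop ℕ∞} : ContDiff ℝ n (zSq (m := m)) := by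
  unfold zSq
  refine ContDiff.sum fun j _ => ?_
  fun_prop

theorem contDiff_gaugeFour {n : WithTop ℕ∞} : ContDiff ℝ n (gaugeFour (m := m)) := by
  have := contDiff_zSq (m := m) (n := n)
  unfold gaugeFour
  fun_prop

theorem continuous_gauge : Continuous (gauge (m := m)) :=
  Real.continuous_sqrt.comp (Real.continuous_sqrt.comp (contDiff_gaugeFour (n := 0)).continuous)

theorem contDiffAt_gauge {n : WithTop ℕ∞} {q : Point m} (hq : 0 < gauge q) :
    ContDiffAt ℝ n gauge q :=
  (contDiff_gaugeFour.contDiffAt.sqrt (Real.sqrt_pos.1 (Real.sqrt_pos.1 hq)).ne').sqrt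
    (Real.sqrt_pos.1 hq).ne'

theorem hasFDerivAt_fst_apply (j : Fin m) (q : Point m) :
    HasFDerivAt (fun q : Point m => q.1 j)
      (ContinuousLinearMap.proj j ∘L ContinuousLinearMap.fst ℝ (Fin m → ℝ) _) q :=
  (ContinuousLinearMap.proj j ∘L
    ContinuousLinearMap.fst ℝ (Fin m → ℝ) ((Fin m → ℝ) × ℝ)).hasFDerivAt

theorem hasFDerivAt_snd_fst_apply (j : Fin m) (q : Point m) :
    HasFDerivAt (fun q : Point m => q.2.1 j)
      (ContinuousLinearMap.proj j ∘L ContinuousLinearMap.fst ℝ (Fin m → ℝ) ℝ ∘L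
        ContinuousLinearMap.snd ℝ (Fin m → ℝ) _) q :=
  (ContinuousLinearMap.proj j ∘L ContinuousLinearMap.fst ℝ (Fin m → ℝ) ℝ ∘L
    ContinuousLinearMap.snd ℝ (Fin m → ℝ) ((Fin m → ℝ) × ℝ)).hasFDerivAt

theorem hasFDerivAt_snd_snd (q : Point m) :
    HasFDerivAt (fun q : Point m => q.2.2)
      (ContinuousLinearMap.snd ℝ (Fin m → ℝ) ℝ ∘L ContinuousLinearMap.snd ℝ (Fin m → ℝ) _) q :=
  (ContinuousLinearMap.snd ℝ (Fin m → ℝ) ℝ ∘L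
    ContinuousLinearMap.snd ℝ (Fin m → ℝ) ((Fin m → ℝ) × ℝ)).hasFDerivAt

theorem hgrad_zSq (q : Point m) :
    hgrad zSq q = WithLp.toLp 2 (Sum.elim (fun j => 2 * q.1 j) fun j => 2 * q.2.1 j) := by
  have h : HasFDerivAt (zSq (m := m)) _ q := HasFDerivAt.fun_sum (u := Finset.univ)
    fun j _ => ((hasFDerivAt_fst_apply j q).pow 2).add ((hasFDerivAt_snd_fst_apply j q).pow 2)
  ext i
  rw [hgrad_apply, h.fderiv]
  rcases i with j | j <;> simp [frame, Pi.single_apply]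

theorem fderiv_zSq_frame (q : Point m) (i : Fin m ⊕ Fin m) :
    fderiv ℝ zSq q (frame i q) = Sum.elim (fun j => 2 * q.1 j) (fun j => 2 * q.2.1 j) i :=
  congrArg (fun a => a i) (hgrad_zSq q)

theorem hgrad_gaugeFour (q : Point m) :
    hgrad gaugeFour q = WithLp.toLp 2 (Sum.elim (fun j => 4 * (zSq q * q.1 j + q.2.2 * q.2.1 j))
      fun j => 4 * (zSq q * q.2.1 j - q.2.2 * q.1 j)) := by
  have h : HasFDerivAt (gaugeFour (m := m)) _ q :=
    ((contDiff_zSq.differentiable one_ne_zero q).hasFDerivAt.pow 2).add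
      ((hasFDerivAt_snd_snd q).pow 2)
  ext i
  rw [hgrad_apply, h.fderiv]
  rcases i with j | j <;> simp [fderiv_zSq_frame] <;> simp [frame] <;> ring

theorem inner_hgrad_zSq_hgrad_gaugeFour (q : Point m) :
    inner ℝ (hgrad zSq q) (hgrad gaugeFour q) = 8 * zSq q ^ 2 := by
  calc inner ℝ (hgrad zSq q) (hgrad gaugeFour q)
      = ∑ j, 8 * zSq q * (q.1 j ^ 2 + q.2.1 j ^ 2) := by
        simp only [hgrad_zSq, hgrad_gaugeFour, PiLp.inner_apply, Fintype.sum_sum_type,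
          Sum.elim_inl, Sum.elim_inr, ← Finset.sum_add_distrib, RCLike.inner_apply, conj_trivial]
        exact Finset.sum_congr rfl fun j _ => by ring
    _ = 8 * zSq q ^ 2 := by rw [← Finset.mul_sum, ← zSq]; ring

theorem norm_sq_hgrad_gaugeFour (q : Point m) :
    ‖hgrad gaugeFour q‖ ^ 2 = 16 * gaugeFour q * zSq q := by
  calc ‖hgrad gaugeFour q‖ ^ 2
      = ∑ j, 16 * gaugeFour q * (q.1 j ^ 2 + q.2.1 j ^ 2) := by
        simp only [hgrad_gaugeFour, EuclideanSpace.norm_sq_eq, Fintype.sum_sum_type,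
          Sum.elim_inl, Sum.elim_inr, ← Finset.sum_add_distrib, Real.norm_eq_abs, sq_abs, gaugeFour]
        exact Finset.sum_congr rfl fun j _ => by ring
    _ = 16 * gaugeFour q * zSq q := by rw [← Finset.mul_sum, ← zSq]

theorem hdiv_hgrad_gaugeFour (q : Point m) :
    hdiv (hgrad gaugeFour) q = 8 * (m + 2) * zSq q := by
  have hz := (contDiff_zSq.differentiable one_ne_zero q).hasFDerivAt
  have hx : ∀ j : Fin m, fderiv ℝ (fun q => 4 * (zSq q * q.1 j + q.2.2 * q.2.1 j)) q
      (frame (Sum.inl j) q) = 4 * zSq q + 8 * (q.1 j ^ 2 + q.2.1 j ^ 2) := fun j => by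
    have h : HasFDerivAt (fun q => 4 * (zSq q * q.1 j + q.2.2 * q.2.1 j)) _ q :=
      ((hz.mul (hasFDerivAt_fst_apply j q)).add
        ((hasFDerivAt_snd_snd q).mul (hasFDerivAt_snd_fst_apply j q))).const_mul 4
    rw [h.fderiv]
    simp [fderiv_zSq_frame q (Sum.inl j)]
    simp [frame]
    ring
  have hy : ∀ j : Fin m, fderiv ℝ (fun q => 4 * (zSq q * q.2.1 j - q.2.2 * q.1 j)) q
      (frame (Sum.inr j) q) = 4 * zSq q + 8 * (q.1 j ^ 2 + q.2.1 j ^ 2) := fun j => by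
    have h : HasFDerivAt (fun q => 4 * (zSq q * q.2.1 j - q.2.2 * q.1 j)) _ q :=
      ((hz.mul (hasFDerivAt_snd_fst_apply j q)).sub
        ((hasFDerivAt_snd_snd q).mul (hasFDerivAt_fst_apply j q))).const_mul 4
    rw [h.fderiv]
    simp [fderiv_zSq_frame q (Sum.inr j)]
    simp [frame]
    ring
  simp only [hdiv, hgrad_gaugeFour, Fintype.sum_sum_type, Sum.elim_inl, Sum.elim_inr, hx, hy,
    Finset.sum_add_distrib (f := fun _ => 4 * zSq q), ← Finset.mul_sum, Finset.sum_const,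
    Finset.card_univ, Fintype.card_fin, nsmul_eq_mul]
  rw [show ∑ j, (q.1 j ^ 2 + q.2.1 j ^ 2) = zSq q from rfl]
  ring

theorem hgrad_gaugeFour_eq_smul {q : Point m} (hq : 0 < gauge q) :
    hgrad gaugeFour q = (4 * gauge q ^ 3) • hgrad gauge q := by
  have h := hgrad_comp (hasDerivAt_pow 4 (gauge q))
    ((contDiffAt_gauge hq).differentiableAt one_ne_zero)
  simpa only [gauge_pow_four, Nat.cast_ofNat, Nat.add_one_sub_one] using h

theorem norm_hgrad_gauge {q : Point m} (hq : 0 < gauge q) : ‖hgrad gauge q‖ = density q := by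
  have h := norm_sq_hgrad_gaugeFour q
  rw [hgrad_gaugeFour_eq_smul hq, norm_smul, Real.norm_of_nonneg (by positivity),
    ← density_sq hq, ← gauge_pow_four] at h
  refine (sq_eq_sq₀ (norm_nonneg _) (density_nonneg q)).1 (mul_left_cancel₀ (pow_pos hq 6).ne' ?_)
  linear_combination h / 16

theorem contDiffAt_density {n : WithTop ℕ∞} {q : Point m} (hz : 0 < zSq q) (hr : 0 < gauge q) :
    ContDiffAt ℝ n density q :=
  (contDiff_zSq.contDiffAt.sqrt hz.ne').div (contDiffAt_gauge hr) hr.ne'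

/-- The gauge is `∞`-harmonic. -/
theorem inner_hgrad_gauge_hgrad_density {q : Point m} (hz : 0 < zSq q) (hr : 0 < gauge q) :
    inner ℝ (hgrad gauge q) (hgrad density q) = 0 := by
  have hσ : DifferentiableAt ℝ density q :=
    (contDiffAt_density hz hr).differentiableAt one_ne_zero
  have hg : DifferentiableAt ℝ gauge q := (contDiffAt_gauge hr).differentiableAt one_ne_zero
  have hσpos : 0 < density q := div_pos (Real.sqrt_pos.2 hz) hr
  -- Differentiate `|z|² = density² r²` along `∇r`.
  have hgrad_z : hgrad zSq q = density q ^ 2 • (2 * gauge q) • hgrad gauge q +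
      gauge q ^ 2 • (2 * density q) • hgrad density q := by
    have hzSq : (fun x => density x ^ 2 * gauge x ^ 2) =ᶠ[𝓝 q] zSq := by
      filter_upwards [continuous_gauge.continuousAt.eventually_const_lt hr] with x hx
      exact density_sq hx
    rw [← hgrad_congr hzSq, hgrad_mul (hσ.fun_pow 2) (hg.fun_pow 2),
      hgrad_comp (hasDerivAt_pow 2 _) hσ, hgrad_comp (hasDerivAt_pow 2 _) hg]
    simp
  have h := inner_hgrad_zSq_hgrad_gaugeFour q
  rw [hgrad_gaugeFour_eq_smul hr, hgrad_z, ← density_sq hr] at h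
  simp only [inner_add_left, real_inner_smul_left, real_inner_smul_right,
    real_inner_self_eq_norm_sq, norm_hgrad_gauge hr] at h
  rw [real_inner_comm]
  refine (mul_eq_zero.1 (?_ : 8 * gauge q ^ 5 * density q * _ = 0)).resolve_left (by positivity)
  linear_combination h

theorem hdiv_hgrad_gauge {q : Point m} (hq : 0 < gauge q) :
    hdiv (hgrad gauge) q = (2 * m + 1) * density q ^ 2 / gauge q := by
  have hg : ContDiffAt ℝ 2 gauge q := contDiffAt_gauge hq
  have hgd := hg.differentiableAt two_ne_zero
  have hfield : hgrad gaugeFour =ᶠ[𝓝 q] fun x => (4 * gauge x ^ 3) • hgrad gauge x := by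
    filter_upwards [continuous_gauge.continuousAt.eventually_const_lt hq] with x hx
    exact hgrad_gaugeFour_eq_smul hx
  have h := hdiv_congr hfield
  rw [hdiv_hgrad_gaugeFour, hdiv_smul ((hgd.fun_pow 3).const_mul 4)
    ((contDiffAt_hgrad hg).differentiableAt one_ne_zero),
    hgrad_comp ((hasDerivAt_pow 3 (gauge q)).const_mul 4) hgd, real_inner_smul_right,
    real_inner_self_eq_norm_sq, norm_hgrad_gauge hq, ← density_sq hq] at h
  rw [eq_div_iff hq.ne']
  refine mul_left_cancel₀ (pow_pos hq 2).ne' ?_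
  push_cast at h
  linear_combination -h / 4

theorem isCompact_gauge_le (R : ℝ) : IsCompact {q : Point m | gauge q ≤ R} := by
  refine Metric.isCompact_of_isClosed_isBounded (isClosed_le continuous_gauge continuous_const)
    ((Metric.isBounded_closedBall (x := (0 : Point m)) (r := max R (R ^ 2))).subset fun q hq => ?_)
  have hR : 0 ≤ R := (gauge_nonneg q).trans hq
  have hgR : gauge q ^ 2 ≤ R ^ 2 := pow_le_pow_left₀ (gauge_nonneg q) hq 2
  have hcoord : ∀ j, q.1 j ^ 2 + q.2.1 j ^ 2 ≤ R ^ 2 := fun j =>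
    (Finset.single_le_sum (f := fun j => q.1 j ^ 2 + q.2.1 j ^ 2) (fun _ _ => by positivity)
      (Finset.mem_univ j)).trans ((zSq_le_gauge_sq q).trans hgR)
  rw [mem_closedBall_zero_iff, norm_prod_le_iff, norm_prod_le_iff,
    pi_norm_le_iff_of_nonneg (le_max_of_le_left hR), pi_norm_le_iff_of_nonneg
    (le_max_of_le_left hR)]
  refine ⟨fun j => le_max_of_le_left ?_, fun j => le_max_of_le_left ?_,
    le_max_of_le_right ((abs_vertical_le_gauge_sq q).trans hgR)⟩
  · exact abs_le_of_sq_le_sq (by linarith [hcoord j, sq_nonneg (q.2.1 j)]) hR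
  · exact abs_le_of_sq_le_sq (by linarith [hcoord j, sq_nonneg (q.1 j)]) hR

end Gauge

/-! ### The flux `φ(|a|) a / |a|` and its truncation -/

theorem hasDerivAt_max_zero_sq (x : ℝ) :
    HasDerivAt (fun x : ℝ => (max x 0) ^ 2) (2 * max x 0) x := by
  refine hasDerivAt_of_hasDerivAt_of_ne' (x := 0) (g := fun x => 2 * max x 0) (fun y hy => ?_)
    (by fun_prop) (by fun_prop) x
  rcases hy.lt_or_gt with hy | hy
  · rw [max_eq_right hy.le, mul_zero]
    refine (hasDerivAt_const y (0 : ℝ)).congr_of_eventuallyEq ?_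
    filter_upwards [Iio_mem_nhds hy] with z hz
    rw [max_eq_right (le_of_lt (mem_Iio.1 hz)), zero_pow two_ne_zero]
  · rw [max_eq_left hy.le]
    refine HasDerivAt.congr_of_eventuallyEq (f := fun x : ℝ => x ^ 2)
      (by simpa using hasDerivAt_pow 2 y) ?_
    filter_upwards [Ioi_mem_nhds hy] with z hz
    rw [max_eq_left (le_of_lt hz)]

theorem contDiff_max_zero_sq : ContDiff ℝ 1 (fun x : ℝ => (max x 0) ^ 2) := by
  refine contDiff_one_iff_deriv.2 ⟨fun x => (hasDerivAt_max_zero_sq x).differentiableAt, ?_⟩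
  rw [show deriv (fun x : ℝ => (max x 0) ^ 2) = fun x => 2 * max x 0 from
    funext fun x => (hasDerivAt_max_zero_sq x).deriv]
  fun_prop

/-- A `C¹` non-decreasing approximation of the identity of `[0, ∞)` that vanishes on `[0, δ]`. -/
noncomputable def truncation (δ y : ℝ) : ℝ := √((max (y - δ) 0) ^ 2 + δ ^ 2) - δ

section Truncation

variable {δ y : ℝ}

theorem truncation_radicand_pos (hδ : 0 < δ) (y : ℝ) : 0 < (max (y - δ) 0) ^ 2 + δ ^ 2 := by
  positivity

theorem contDiff_truncation (hδ : 0 < δ) : ContDiff ℝ 1 (truncation δ) :=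
  (((contDiff_max_zero_sq.comp (contDiff_id.sub contDiff_const)).add contDiff_const).sqrt
    fun y => (truncation_radicand_pos hδ y).ne').sub contDiff_const

theorem truncation_eq_zero (hδ : 0 ≤ δ) (hy : y ≤ δ) : truncation δ y = 0 := by
  simp [truncation, max_eq_right (sub_nonpos.2 hy), Real.sqrt_sq hδ]

theorem truncation_le (hδ : 0 ≤ δ) (hy : 0 ≤ y) : truncation δ y ≤ y := by
  refine sub_le_iff_le_add.2 (Real.sqrt_le_iff.2 ⟨add_nonneg hy hδ, ?_⟩)
  rcases max_cases (y - δ) 0 with h | h <;> rw [h.1] <;> nlinarith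

theorem sub_two_mul_le_truncation : y - 2 * δ ≤ truncation δ y := by
  have h : y - δ ≤ √((max (y - δ) 0) ^ 2 + δ ^ 2) :=
    (le_max_left _ 0).trans (Real.le_sqrt_of_sq_le (le_add_of_nonneg_right (sq_nonneg δ)))
  rw [truncation]
  linarith

theorem deriv_truncation_mem_Icc (hδ : 0 < δ) (y : ℝ) : deriv (truncation δ) y ∈ Icc 0 1 := by
  have hrad := truncation_radicand_pos hδ y
  have hd : HasDerivAt (truncation δ)
      (2 * max (y - δ) 0 / (2 * √((max (y - δ) 0) ^ 2 + δ ^ 2))) y := by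
    have h := (hasDerivAt_max_zero_sq (y - δ)).comp y ((hasDerivAt_id y).sub_const δ)
    rw [mul_one] at h
    exact ((h.add_const (δ ^ 2)).sqrt hrad.ne').sub_const δ
  rw [hd.deriv]
  refine ⟨by positivity, div_le_one_of_le₀ ?_ (by positivity)⟩
  gcongr
  exact Real.le_sqrt_of_sq_le (le_add_of_nonneg_right (sq_nonneg δ))

end Truncation

section Flux

variable {F : Type*} [NormedAddCommGroup F] [InnerProductSpace ℝ F] {Γ : ℝ → ℝ}

/-- The flux `Γ(|a|) a / |a|`, zero at `a = 0`. It is the vector field under the divergence of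
`Δ^Γ`, with `a` the horizontal gradient. -/
noncomputable def flux (Γ : ℝ → ℝ) (a : F) : F := (‖a‖⁻¹ * Γ ‖a‖) • a

theorem norm_flux (hΓ0 : Γ 0 = 0) (a : F) : ‖flux Γ a‖ = |Γ ‖a‖| := by
  rcases eq_or_ne a 0 with rfl | ha
  · simp [flux, hΓ0]
  · rw [flux, norm_smul, norm_mul, norm_inv, norm_norm, Real.norm_eq_abs, mul_right_comm,
      inv_mul_cancel₀ (norm_ne_zero_iff.2 ha), one_mul]

theorem flux_sub (Γ Δ : ℝ → ℝ) (a : F) :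
    flux (fun s => Γ s - Δ s) a = flux Γ a - flux Δ a := by
  simp only [flux, mul_sub, sub_smul]

theorem flux_smul {k : ℝ} (hk : 0 < k) (Γ : ℝ → ℝ) (a : F) :
    flux Γ (k • a) = (Γ (k * ‖a‖) / ‖a‖) • a := by
  rw [flux, norm_smul, Real.norm_of_nonneg hk.le, smul_smul]
  congr 1
  field_simp

theorem continuous_flux (hΓ : ContinuousOn Γ (Ici 0)) (hΓ0 : Γ 0 = 0) :
    Continuous (flux Γ : F → F) := by
  have hc : Continuous fun a : F => Γ ‖a‖ :=
    hΓ.comp_continuous continuous_norm fun a => norm_nonneg a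
  refine continuous_iff_continuousAt.2 fun a => ?_
  rcases eq_or_ne a 0 with rfl | ha
  · rw [ContinuousAt, show flux Γ (0 : F) = 0 by simp [flux],
      tendsto_zero_iff_norm_tendsto_zero]
    simpa [norm_flux hΓ0, hΓ0] using (hc.tendsto 0).abs
  · exact ((continuous_norm.continuousAt.inv₀ (norm_ne_zero_iff.2 ha)).mul hc.continuousAt).smul
      continuousAt_id

theorem contDiffAt_flux {n : WithTop ℕ∞} (hΓ : ContDiffOn ℝ n Γ (Ioi 0)) {a : F} (ha : a ≠ 0) :
    ContDiffAt ℝ n (flux Γ) a := by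
  have hnorm : ContDiffAt ℝ n (fun a : F => ‖a‖) a := contDiffAt_norm ℝ ha
  exact ((hnorm.inv (norm_ne_zero_iff.2 ha)).mul
    ((hΓ.contDiffAt (Ioi_mem_nhds (norm_pos_iff.2 ha))).comp a hnorm)).smul contDiffAt_id

theorem inner_flux_self (Γ : ℝ → ℝ) (a : F) : inner ℝ (flux Γ a) a = Γ ‖a‖ * ‖a‖ := by
  rw [flux, real_inner_smul_left, real_inner_self_eq_norm_sq]
  rcases eq_or_ne a 0 with rfl | ha
  · simp
  · have := norm_pos_iff.2 ha
    field_simp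

theorem inner_flux_sub_nonneg (hΓ : MonotoneOn Γ (Ici 0)) (hΓ0 : Γ 0 = 0) (a b : F) :
    0 ≤ inner ℝ (flux Γ a - flux Γ b) (a - b) := by
  have hnonneg : ∀ c : F, 0 ≤ Γ ‖c‖ := fun c =>
    hΓ0 ▸ hΓ self_mem_Ici (norm_nonneg c) (norm_nonneg c)
  have hcross : ∀ a b : F, inner ℝ (flux Γ a) b ≤ Γ ‖a‖ * ‖b‖ := fun a b => by
    simpa only [norm_flux hΓ0, abs_of_nonneg (hnonneg a)] using real_inner_le_norm (flux Γ a) b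
  have hmono : 0 ≤ (Γ ‖a‖ - Γ ‖b‖) * (‖a‖ - ‖b‖) := by
    rcases le_total ‖a‖ ‖b‖ with h | h
    · exact mul_nonneg_of_nonpos_of_nonpos
        (sub_nonpos.2 (hΓ (norm_nonneg _) (norm_nonneg _) h)) (sub_nonpos.2 h)
    · exact mul_nonneg (sub_nonneg.2 (hΓ (norm_nonneg _) (norm_nonneg _) h)) (sub_nonneg.2 h)
  rw [inner_sub_left, inner_sub_right, inner_sub_right, inner_flux_self, inner_flux_self]
  linarith [hcross a b, hcross b a]

theorem norm_flux_sub_flux_truncation_le {φ : ℝ → ℝ} {δ : ℝ} (hφ : CondPhi φ) (hδ : 0 < δ)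
    (a : F) :
    ‖flux φ a - flux (fun s => truncation δ (φ s)) a‖ ≤ 2 * δ := by
  have hφa := hφ.map_nonneg (norm_nonneg a)
  rw [← flux_sub, norm_flux (by simp [hφ.map_zero, truncation_eq_zero hδ.le hδ.le]),
    abs_of_nonneg (sub_nonneg.2 (truncation_le hδ.le hφa)), sub_le_comm]
  exact sub_two_mul_le_truncation

end Flux

/-! ### The barrier is a supersolution -/

section Radial

variable {m : ℕ}

/-- The function of the gauge with profile `α`; the barrier is of this form. -/
noncomputable def radial (α : ℝ → ℝ) (q : Point m) : ℝ := α (gauge q)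

theorem isOpen_gauge_lt (R : ℝ) : IsOpen {q : Point m | gauge q < R} :=
  isOpen_lt continuous_gauge continuous_const

theorem hgrad_radial {α : ℝ → ℝ} {a : ℝ} {q : Point m} (hα : HasDerivAt α a (gauge q))
    (hq : 0 < gauge q) : hgrad (radial α) q = a • hgrad gauge q :=
  hgrad_comp hα ((contDiffAt_gauge hq).differentiableAt one_ne_zero)

/-- The shell `1 < gauge q < R` without its points on the vertical axis, where the gradient of a
barrier with profile on `(-∞, R)` does not vanish. -/
def regularSet (m : ℕ) (R : ℝ) : Set (Point m) := {q | (1 < gauge q ∧ gauge q < R) ∧ 0 < zSq q}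

theorem isOpen_regularSet (m : ℕ) (R : ℝ) : IsOpen (regularSet m R) :=
  ((isOpen_lt continuous_const continuous_gauge).inter (isOpen_gauge_lt R)).inter
    (isOpen_lt continuous_const (contDiff_zSq (n := 0)).continuous)

theorem gauge_pos_of_mem_regularSet {R : ℝ} {q : Point m} (hq : q ∈ regularSet m R) :
    0 < gauge q :=
  one_pos.trans hq.1.1

theorem density_pos_of_mem_regularSet {R : ℝ} {q : Point m} (hq : q ∈ regularSet m R) :
    0 < density q :=
  div_pos (Real.sqrt_pos.2 hq.2) (gauge_pos_of_mem_regularSet hq)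

theorem contDiffOn_one_of_hasDerivAt {k k' : ℝ → ℝ} {s : Set ℝ} (hs : IsOpen s)
    (hk : ∀ x ∈ s, HasDerivAt k (k' x) x) (hk' : ContinuousOn k' s) : ContDiffOn ℝ 1 k s := by
  rw [← zero_add (1 : WithTop ℕ∞), contDiffOn_succ_iff_deriv_of_isOpen hs]
  exact ⟨fun x hx => (hk x hx).differentiableAt.differentiableWithinAt, by simp,
    contDiffOn_zero.2 (hk'.congr fun x hx => (hk x hx).deriv)⟩

end Radial

section DilationBound

variable {φ : ℝ → ℝ} {D σ t : ℝ}

theorem HasDilationBound.nonneg (hD : HasDilationBound φ D) (hφ : CondPhi φ) : 0 ≤ D := by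
  have h := hD 0 le_rfl zero_le_one 1 one_pos
  rw [zero_mul] at h
  exact nonneg_of_mul_nonneg_left h (hφ.deriv_pos 1 one_pos)

theorem HasDilationBound.sq_mul_deriv_le (hD : HasDilationBound φ D) (hφ : CondPhi φ)
    (hσ : 0 ≤ σ) (hσ1 : σ ≤ 1) (ht : 0 < t) :
    σ ^ 2 * deriv φ (t * σ) ≤ D * deriv φ t :=
  calc σ ^ 2 * deriv φ (t * σ) = σ * (σ * deriv φ (σ * t)) := by rw [mul_comm t]; ring
    _ ≤ σ * (D * deriv φ t) := mul_le_mul_of_nonneg_left (hD σ hσ hσ1 t ht) hσ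
    _ ≤ D * deriv φ t :=
        mul_le_of_le_one_left (mul_nonneg (hD.nonneg hφ) (hφ.deriv_pos t ht).le) hσ1

theorem HasDilationBound.tendsto_sq_mul_deriv (hD : HasDilationBound φ D) (hφ : CondPhi φ) :
    Tendsto (fun s => s ^ 2 * deriv φ s) (𝓝[≥] 0) (𝓝 0) := by
  have hlim : Tendsto (fun s : ℝ => s * (D * deriv φ 1)) (𝓝[≥] 0) (𝓝 0) := by
    have h : Tendsto (fun s : ℝ => s * (D * deriv φ 1)) (𝓝 0) (𝓝 (0 * (D * deriv φ 1))) :=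
      tendsto_id.mul_const _
    rw [zero_mul] at h
    exact h.mono_left nhdsWithin_le_nhds
  refine tendsto_of_tendsto_of_tendsto_of_le_of_le' tendsto_const_nhds hlim ?_ ?_
  · filter_upwards [self_mem_nhdsWithin] with s hs
    rcases (mem_Ici.1 hs).eq_or_lt with rfl | hs
    · simp
    · exact mul_nonneg (sq_nonneg s) (hφ.deriv_pos s hs).le
  · filter_upwards [self_mem_nhdsWithin, mem_nhdsWithin_of_mem_nhds (Iic_mem_nhds one_pos)]
      with s hs hs1
    have h := hD s hs hs1 1 one_pos
    rw [mul_one] at h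
    rw [sq, mul_assoc]
    exact mul_le_mul_of_nonneg_left h hs

theorem HasDilationBound.continuousOn_sq_mul_deriv (hD : HasDilationBound φ D) (hφ : CondPhi φ) :
    ContinuousOn (fun s => s ^ 2 * deriv φ s) (Ici 0) := by
  intro s hs
  rcases (mem_Ici.1 hs).eq_or_lt with rfl | hs
  · rw [ContinuousWithinAt, zero_pow two_ne_zero, zero_mul]
    exact hD.tendsto_sq_mul_deriv hφ
  · exact ((continuousAt_id.pow 2).mul
      (hφ.continuousOn_deriv.continuousAt (Ioi_mem_nhds hs))).continuousWithinAt

end DilationBound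

/-- The source term `f(v) - C h(v) |∇v|² φ'(|∇v|)`, which replaces `f(v) - h(v) g(|∇v|)`: by (G)
it is the smaller one for a suitable `C`, and it is continuous where `v > 0`. -/
noncomputable def source {m : ℕ} (φ f h : ℝ → ℝ) (C : ℝ) (v : Point m → ℝ) (q : Point m) : ℝ :=
  f (v q) - h (v q) * (C * (‖hgrad v q‖ ^ 2 * deriv φ ‖hgrad v q‖))

theorem continuousOn_source {m : ℕ} {φ f h : ℝ → ℝ} {C D : ℝ} {v : Point m → ℝ}
    {U : Set (Point m)} (hU : IsOpen U) (hv : ContDiffOn ℝ 1 v U) (hpos : ∀ q ∈ U, 0 < v q)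
    (hφ : CondPhi φ) (hD : HasDilationBound φ D) (hf : ContinuousOn f (Ioi 0)) (hh : CondH h) :
    ContinuousOn (source φ f h C v) U :=
  (hf.comp hv.continuousOn hpos).sub ((hh.continuousOn.comp hv.continuousOn hpos).mul
    (continuousOn_const.mul ((hD.continuousOn_sq_mul_deriv hφ).comp
      (continuousOn_hgrad hU hv).norm fun _ _ => norm_nonneg _)))

namespace IsProfile

variable {φ f h : ℝ → ℝ} {ε κ R : ℝ} {α p p' : ℝ → ℝ} {m : ℕ} {q : Point m}

theorem radial_eventuallyEq (hP : IsProfile φ f h ε κ R α p p') (hq : gauge q < 1) :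
    radial α =ᶠ[𝓝 q] fun _ => ε := by
  filter_upwards [(isOpen_gauge_lt 1).mem_nhds hq] with y hy
  exact hP.eq_of_le_one _ (le_of_lt hy)

theorem contDiffOn_radial (hP : IsProfile φ f h ε κ R α p p') :
    ContDiffOn ℝ 1 (radial α : Point m → ℝ) {q | gauge q < R} := by
  intro q hq
  refine ContDiffAt.contDiffWithinAt ?_
  rcases lt_or_ge (gauge q) 1 with h1 | h1
  · exact contDiffAt_const.congr_of_eventuallyEq (hP.radial_eventuallyEq h1)
  · exact ((contDiffOn_one_of_hasDerivAt isOpen_Iio hP.hasDerivAt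
      hP.continuousOn_deriv).contDiffAt (Iio_mem_nhds hq)).comp q
        (contDiffAt_gauge (one_pos.trans_le h1))

theorem continuousOn_hgrad_radial (hP : IsProfile φ f h ε κ R α p p') :
    ContinuousOn (hgrad (radial α : Point m → ℝ)) {q | gauge q < R} :=
  continuousOn_hgrad (isOpen_gauge_lt R) hP.contDiffOn_radial

theorem hgrad_radial_eq_zero (hP : IsProfile φ f h ε κ R α p p') (hq : gauge q ≤ 1) :
    hgrad (radial α) q = 0 := by
  rcases hq.lt_or_eq with h1 | h1
  · rw [hgrad_congr (hP.radial_eventuallyEq h1)]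
    ext i
    simp [hgrad_apply]
  · rw [hgrad_radial (hP.hasDerivAt _ (hq.trans_lt hP.one_lt)) (h1 ▸ one_pos),
      hP.deriv_eq_zero _ hq, zero_smul]

theorem norm_hgrad_radial (hP : IsProfile φ f h ε κ R α p p') (h1 : 1 < gauge q)
    (hq : gauge q < R) : ‖hgrad (radial α) q‖ = p (gauge q) * density q := by
  have hq0 : 0 < gauge q := one_pos.trans h1
  rw [hgrad_radial (hP.hasDerivAt _ hq) hq0, norm_smul, norm_hgrad_gauge hq0,
    Real.norm_of_nonneg (hP.deriv_nonneg hq)]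

theorem mem_regularSet_of_hgrad_ne_zero (hP : IsProfile φ f h ε κ R α p p') (hq : gauge q < R)
    (hne : hgrad (radial α) q ≠ 0) : q ∈ regularSet m R := by
  have h1 : 1 < gauge q := by
    by_contra! h1
    exact hne (hP.hgrad_radial_eq_zero h1)
  refine ⟨⟨h1, hq⟩, lt_of_le_of_ne (zSq_nonneg q) fun h0 => hne ?_⟩
  rw [← norm_eq_zero, hP.norm_hgrad_radial h1 hq, density, ← h0]
  simp

theorem hgrad_radial_ne_zero (hP : IsProfile φ f h ε κ R α p p') (hq : q ∈ regularSet m R) :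
    hgrad (radial α) q ≠ 0 := by
  rw [← norm_ne_zero_iff, hP.norm_hgrad_radial hq.1.1 hq.1.2]
  exact (mul_pos (hP.deriv_pos _ hq.1.1 hq.1.2) (density_pos_of_mem_regularSet hq)).ne'

theorem contDiffAt_deriv_gauge (hP : IsProfile φ f h ε κ R α p p') (hq : q ∈ regularSet m R) :
    ContDiffAt ℝ 1 (fun q => p (gauge q)) q :=
  ((contDiffOn_one_of_hasDerivAt isOpen_Ioo (fun x hx => hP.hasDerivAt_deriv x hx.1 hx.2)
    hP.continuousOn_deriv2).contDiffAt (Ioo_mem_nhds hq.1.1 hq.1.2)).comp q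
    (contDiffAt_gauge (gauge_pos_of_mem_regularSet hq))

theorem contDiffAt_flux_hgrad_radial (hP : IsProfile φ f h ε κ R α p p') {Γ : ℝ → ℝ}
    (hΓ : ContDiffOn ℝ 1 Γ (Ioi 0)) (hq : q ∈ regularSet m R) :
    ContDiffAt ℝ 1 (fun q => flux Γ (hgrad (radial α) q)) q := by
  refine (contDiffAt_flux hΓ (hP.hgrad_radial_ne_zero hq)).comp q ?_
  have hgrad_eq : hgrad (radial α) =ᶠ[𝓝 q] fun x => p (gauge x) • hgrad gauge x := by
    filter_upwards [(isOpen_regularSet m R).mem_nhds hq] with x hx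
    exact hgrad_radial (hP.hasDerivAt _ hx.1.2) (gauge_pos_of_mem_regularSet hx)
  exact ((hP.contDiffAt_deriv_gauge hq).smul (contDiffAt_hgrad
    (contDiffAt_gauge (gauge_pos_of_mem_regularSet hq)))).congr_of_eventuallyEq hgrad_eq

/-- Since the density is constant along `∇r`, only the derivative of `p` enters the radial part. -/
theorem hdiv_flux_hgrad_radial (hP : IsProfile φ f h ε κ R α p p') {Γ : ℝ → ℝ} {γ : ℝ}
    (hq : q ∈ regularSet m R) (hΓ : HasDerivAt Γ γ (p (gauge q) * density q)) :
    hdiv (fun q => flux Γ (hgrad (radial α) q)) q = γ * p' (gauge q) * density q ^ 2 +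
      (2 * m + 1) * (Γ (p (gauge q) * density q) * (density q / gauge q)) := by
  have hr := gauge_pos_of_mem_regularSet hq
  have hσ := density_pos_of_mem_regularSet hq
  have hrd : DifferentiableAt ℝ gauge q := (contDiffAt_gauge hr).differentiableAt one_ne_zero
  have hσd : DifferentiableAt ℝ density q :=
    (contDiffAt_density hq.2 hr).differentiableAt one_ne_zero
  have hpd : DifferentiableAt ℝ (fun q => p (gauge q)) q :=
    (hP.contDiffAt_deriv_gauge hq).differentiableAt one_ne_zero
  have hflux : (fun q => flux Γ (hgrad (radial α) q)) =ᶠ[𝓝 q] fun x =>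
      (Γ (p (gauge x) * density x) * (density x)⁻¹) • hgrad gauge x := by
    filter_upwards [(isOpen_regularSet m R).mem_nhds hq] with x hx
    have hrx := gauge_pos_of_mem_regularSet hx
    rw [hgrad_radial (hP.hasDerivAt _ hx.1.2) hrx,
      flux_smul (hP.deriv_pos _ hx.1.1 hx.1.2), norm_hgrad_gauge hrx, div_eq_mul_inv]
  have hΓd : DifferentiableAt ℝ (fun x => Γ (p (gauge x) * density x)) q :=
    hΓ.differentiableAt.fun_comp' q (hpd.fun_mul hσd)
  rw [hdiv_congr hflux, hdiv_smul (hΓd.fun_mul (hσd.fun_inv hσ.ne'))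
    ((contDiffAt_hgrad (contDiffAt_gauge hr)).differentiableAt one_ne_zero),
    hgrad_mul hΓd (hσd.fun_inv hσ.ne'), hgrad_comp (hasDerivAt_inv hσ.ne') hσd,
    hgrad_comp hΓ (hpd.fun_mul hσd), hgrad_mul hpd hσd,
    hgrad_comp (hP.hasDerivAt_deriv _ hq.1.1 hq.1.2) hrd, hdiv_hgrad_gauge hr]
  simp only [inner_add_right, real_inner_smul_right, inner_hgrad_gauge_hgrad_density hq.2 hr,
    real_inner_self_eq_norm_sq, norm_hgrad_gauge hr]
  field_simp
  ring

section Pointwise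

variable {C D γ r σ : ℝ}

theorem mul_deriv2_mul_sq_le (hP : IsProfile φ f h ε κ R α p p') (hφ : CondPhi φ) (hf : CondF f)
    (hh : CondH h) (hD : HasDilationBound φ D) (hκ : 0 ≤ κ) (h1r : 1 < r) (hr : r < R)
    (hσ : 0 < σ) (hσ1 : σ ≤ 1) (hγ : γ ∈ Icc 0 1) :
    γ * deriv φ (p r * σ) * p' r * σ ^ 2 ≤ D * (κ * f (α r)) := by
  have hp := hP.deriv_pos r h1r hr
  have hφp := hφ.deriv_pos (p r) hp
  have hφσ : 0 ≤ σ ^ 2 * deriv φ (p r * σ) :=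
    mul_nonneg (sq_nonneg σ) (hφ.deriv_pos _ (mul_pos hp hσ)).le
  have hw : γ * (σ ^ 2 * deriv φ (p r * σ)) ≤ D * deriv φ (p r) :=
    (mul_le_of_le_one_left hφσ hγ.2).trans (hD.sq_mul_deriv_le hφ hσ.le hσ1 hp)
  have hp' : p' r ≤ max (p' r + h (α r) * p r ^ 2) 0 :=
    (le_add_of_nonneg_right (mul_nonneg (hh.nonneg _ (hP.pos hr)) (sq_nonneg _))).trans
      (le_max_left _ _)
  calc γ * deriv φ (p r * σ) * p' r * σ ^ 2
      = γ * (σ ^ 2 * deriv φ (p r * σ)) * p' r := by ring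
    _ ≤ γ * (σ ^ 2 * deriv φ (p r * σ)) * max (p' r + h (α r) * p r ^ 2) 0 :=
        mul_le_mul_of_nonneg_left hp' (mul_nonneg hγ.1 hφσ)
    _ ≤ D * deriv φ (p r) * max (p' r + h (α r) * p r ^ 2) 0 :=
        mul_le_mul_of_nonneg_right hw (le_max_right _ _)
    _ = D * max (deriv φ (p r) * (p' r + h (α r) * p r ^ 2)) 0 := by
        rw [mul_assoc, mul_max_of_nonneg _ _ hφp.le, mul_zero]
    _ ≤ D * (κ * f (α r)) := mul_le_mul_of_nonneg_left
        (max_le (hP.deriv_mul_le r h1r hr) (mul_nonneg hκ (hf.pos _ (hP.pos hr)).le))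
        (hD.nonneg hφ)

theorem map_mul_div_le (hP : IsProfile φ f h ε κ R α p p') (hφ : CondPhi φ) (hf : CondF f)
    (hh : CondH h) (hκ : 0 ≤ κ) (h1r : 1 < r) (hr : r < R) (hσ : 0 ≤ σ) (hσ1 : σ ≤ 1) :
    φ (p r * σ) * (σ / r) ≤ κ * f (α r) := by
  have hp := (hP.deriv_pos r h1r hr).le
  have hr0 : 0 < r := one_pos.trans h1r
  have hmono : φ (p r * σ) ≤ φ (p r) := hφ.strictMonoOn.monotoneOn (mul_nonneg hp hσ) hp
    (mul_le_of_le_one_right hp hσ1)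
  calc φ (p r * σ) * (σ / r) ≤ φ (p r) * (1 / r) := by
        gcongr
        exact hφ.map_nonneg hp
    _ ≤ κ * f (α r) := by
        rw [mul_one_div, div_le_iff₀ hr0]
        exact hP.map_deriv_le hφ hf hh hκ h1r hr

theorem mul_sq_mul_deriv_mul_le (hP : IsProfile φ f h ε κ R α p p') (hφ : CondPhi φ)
    (hh : CondH h) (hD : HasDilationBound φ D) (hC : 0 ≤ C) (h1r : 1 < r) (hr : r < R)
    (hσ : 0 ≤ σ) (hσ1 : σ ≤ 1) :
    h (α r) * (C * ((p r * σ) ^ 2 * deriv φ (p r * σ))) ≤ C * D * (κ * f (α r)) :=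
  calc h (α r) * (C * ((p r * σ) ^ 2 * deriv φ (p r * σ)))
      = C * (h (α r) * p r ^ 2) * (σ ^ 2 * deriv φ (p r * σ)) := by ring
    _ ≤ C * (h (α r) * p r ^ 2) * (D * deriv φ (p r)) :=
        mul_le_mul_of_nonneg_left (hD.sq_mul_deriv_le hφ hσ hσ1 (hP.deriv_pos r h1r hr))
          (mul_nonneg hC (mul_nonneg (hh.nonneg _ (hP.pos hr)) (sq_nonneg _)))
    _ = C * D * (h (α r) * (p r ^ 2 * deriv φ (p r))) := by ring
    _ ≤ C * D * (κ * f (α r)) := mul_le_mul_of_nonneg_left (hP.mul_sq_mul_deriv_le r h1r hr)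
        (mul_nonneg hC (hD.nonneg hφ))

end Pointwise

theorem continuousOn_source (hP : IsProfile φ f h ε κ R α p p') (hφ : CondPhi φ)
    (hf : CondF f) (hh : CondH h) {D : ℝ} (hD : HasDilationBound φ D) (C : ℝ) :
    ContinuousOn (source φ (fun s => 1 / 2 * f s) h C (radial α : Point m → ℝ))
      {q | gauge q < R} :=
  Heisenberg.continuousOn_source (isOpen_gauge_lt R) hP.contDiffOn_radial (fun _ => hP.pos) hφ hD
    (continuousOn_const.mul (hf.continuousOn.mono Ioi_subset_Ici_self)) hh

section Supersolution

variable {C D δ : ℝ} {ζ : Point m → ℝ}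

theorem flux_truncation_eventuallyEq_zero (hP : IsProfile φ f h ε κ R α p p') (hφ : CondPhi φ)
    (hδ : 0 < δ) (hq : gauge q < R) (hgrad_q : hgrad (radial α) q = 0) :
    (fun q => flux (fun s => truncation δ (φ s)) (hgrad (radial α) q)) =ᶠ[𝓝 q] fun _ => 0 := by
  have hcont : ContinuousAt (fun q => φ ‖hgrad (radial α) q‖) q :=
    (hφ.continuousOn.comp hP.continuousOn_hgrad_radial.norm fun q _ =>
      norm_nonneg _).continuousAt ((isOpen_gauge_lt R).mem_nhds hq)
  have hlt : φ ‖hgrad (radial α) q‖ < δ := by rwa [hgrad_q, norm_zero, hφ.map_zero]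
  filter_upwards [hcont.eventually_lt_const hlt] with y hy
  rw [flux, truncation_eq_zero hδ.le hy.le, mul_zero, zero_smul]

theorem contDiffOn_flux_truncation (hP : IsProfile φ f h ε κ R α p p') (hφ : CondPhi φ)
    (hδ : 0 < δ) : ContDiffOn ℝ 1
      (fun q : Point m => flux (fun s => truncation δ (φ s)) (hgrad (radial α) q))
      {q | gauge q < R} := by
  intro q hq
  refine ContDiffAt.contDiffWithinAt ?_
  by_cases hgrad_q : hgrad (radial α) q = 0
  · exact contDiffAt_const.congr_of_eventuallyEq
      (hP.flux_truncation_eventuallyEq_zero hφ hδ hq hgrad_q)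
  · exact hP.contDiffAt_flux_hgrad_radial
      ((contDiff_truncation hδ).comp_contDiffOn hφ.contDiffOn)
      (hP.mem_regularSet_of_hgrad_ne_zero hq hgrad_q)

theorem hdiv_flux_truncation_le (hP : IsProfile φ f h ε κ R α p p') (hφ : CondPhi φ)
    (hf : CondF f) (hh : CondH h) (hD : HasDilationBound φ D) (hC : 0 ≤ C) (hκ : 0 ≤ κ)
    (hκ' : (D + (2 * m + 1) + C * D) * κ ≤ 1 / 2) (hδ : 0 < δ) (hq : gauge q < R) :
    hdiv (fun q => flux (fun s => truncation δ (φ s)) (hgrad (radial α) q)) q ≤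
      source φ (fun s => 1 / 2 * f s) h C (radial α) q := by
  have hfα := (hf.pos _ (hP.pos hq)).le
  by_cases hgrad_q : hgrad (radial α) q = 0
  · rw [hdiv_congr (hP.flux_truncation_eventuallyEq_zero hφ hδ hq hgrad_q), source, hgrad_q]
    simpa [hdiv, radial] using hfα
  · have hreg := hP.mem_regularSet_of_hgrad_ne_zero hq hgrad_q
    have h1 := hreg.1.1
    have hσ := density_pos_of_mem_regularSet hreg
    have hσ1 := density_le_one q
    have hs : 0 < p (gauge q) * density q := mul_pos (hP.deriv_pos _ h1 hq) hσ
    have hderiv : HasDerivAt (fun s => truncation δ (φ s)) _ (p (gauge q) * density q) :=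
      ((contDiff_truncation hδ).differentiable one_ne_zero
      (φ (p (gauge q) * density q))).hasDerivAt.comp _ (hφ.hasDerivAt hs)
    have hdiffusion := hP.mul_deriv2_mul_sq_le hφ hf hh hD hκ h1 hq hσ hσ1
      (deriv_truncation_mem_Icc hδ (φ (p (gauge q) * density q)))
    have htransport := mul_le_mul_of_nonneg_left
      ((mul_le_mul_of_nonneg_right (truncation_le hδ.le (hφ.map_nonneg hs.le))
        (div_nonneg hσ.le (gauge_nonneg q))).trans
        (hP.map_mul_div_le hφ hf hh hκ h1 hq hσ.le hσ1)) (by positivity : (0 : ℝ) ≤ 2 * m + 1)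
    have hgradient := hP.mul_sq_mul_deriv_mul_le hφ hh hD hC h1 hq hσ.le hσ1
    rw [hP.hdiv_flux_hgrad_radial hreg hderiv, source, hP.norm_hgrad_radial h1 hq, radial]
    linarith [mul_le_mul_of_nonneg_right hκ' hfα]

theorem neg_integral_truncation_le (hP : IsProfile φ f h ε κ R α p p') (hφ : CondPhi φ)
    (hf : CondF f) (hh : CondH h) (hD : HasDilationBound φ D) (hC : 0 ≤ C) (hκ : 0 ≤ κ)
    (hκ' : (D + (2 * m + 1) + C * D) * κ ≤ 1 / 2) (hζ : ContDiff ℝ 1 ζ)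
    (hc : HasCompactSupport ζ) (hsub : tsupport ζ ⊆ {q | gauge q < R}) (hζ0 : ∀ q, 0 ≤ ζ q)
    (hδ : 0 < δ) :
    -∫ q, inner ℝ (flux (fun s => truncation δ (φ s)) (hgrad (radial α) q)) (hgrad ζ q) ≤
      ∫ q, source φ (fun s => 1 / 2 * f s) h C (radial α) q * ζ q := by
  have hU := isOpen_gauge_lt (m := m) R
  have hW := hP.contDiffOn_flux_truncation (m := m) hφ hδ
  rw [integral_inner_hgrad_eq_neg hU hW hζ hc hsub, neg_neg]
  refine integral_mono
    (integrable_mul_of_tsupport_subset hU (continuousOn_hdiv hU hW) hζ.continuous hc hsub)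
    (integrable_mul_of_tsupport_subset hU (hP.continuousOn_source hφ hf hh hD C)
      hζ.continuous hc hsub) fun q => ?_
  by_cases hq : q ∈ tsupport ζ
  · exact mul_le_mul_of_nonneg_right
      (hP.hdiv_flux_truncation_le hφ hf hh hD hC hκ hκ' hδ (hsub hq)) (hζ0 q)
  · simp [image_eq_zero_of_notMem_tsupport hq]

theorem neg_integral_le_truncation_add (hP : IsProfile φ f h ε κ R α p p') (hφ : CondPhi φ)
    (hζ : ContDiff ℝ 1 ζ) (hc : HasCompactSupport ζ) (hsub : tsupport ζ ⊆ {q | gauge q < R})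
    (hδ : 0 < δ) :
    -∫ q, inner ℝ (flux φ (hgrad (radial α) q)) (hgrad ζ q) ≤
      -(∫ q, inner ℝ (flux (fun s => truncation δ (φ s)) (hgrad (radial α) q)) (hgrad ζ q)) +
        2 * δ * ∫ q, ‖hgrad ζ q‖ := by
  have hU := isOpen_gauge_lt (m := m) R
  have hφint : Integrable fun q => inner ℝ (flux φ (hgrad (radial α) q)) (hgrad ζ q) :=
    integrable_inner_hgrad hU ((continuous_flux hφ.continuousOn
      hφ.map_zero).comp_continuousOn hP.continuousOn_hgrad_radial) hζ hc hsub
  have hΓint := integrable_inner_hgrad hU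
    (hP.contDiffOn_flux_truncation hφ hδ).continuousOn hζ hc hsub
  have hle : ∫ q, (inner ℝ (flux (fun s => truncation δ (φ s)) (hgrad (radial α) q)) (hgrad ζ q) -
      inner ℝ (flux φ (hgrad (radial α) q)) (hgrad ζ q)) ≤ ∫ q, 2 * δ * ‖hgrad ζ q‖ := by
    refine integral_mono (hΓint.sub hφint) ((integrable_norm_hgrad hζ hc).const_mul _) fun q => ?_
    beta_reduce
    rw [← inner_sub_left]
    refine (real_inner_le_norm _ _).trans (mul_le_mul_of_nonneg_right ?_ (norm_nonneg _))
    rw [norm_sub_rev]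
    exact norm_flux_sub_flux_truncation_le hφ hδ _
  rw [integral_sub hΓint hφint, integral_const_mul] at hle
  linarith

/-- The flux of the barrier need not be differentiable where its gradient vanishes, so the
divergence is computed for the truncated fluxes, which vanish near such points. -/
theorem neg_integral_inner_flux_le (hP : IsProfile φ f h ε κ R α p p') (hφ : CondPhi φ)
    (hf : CondF f) (hh : CondH h) (hD : HasDilationBound φ D) (hC : 0 ≤ C) (hκ : 0 ≤ κ)
    (hκ' : (D + (2 * m + 1) + C * D) * κ ≤ 1 / 2) (hζ : ContDiff ℝ 1 ζ)
    (hc : HasCompactSupport ζ) (hsub : tsupport ζ ⊆ {q | gauge q < R}) (hζ0 : ∀ q, 0 ≤ ζ q) :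
    -∫ q, inner ℝ (flux φ (hgrad (radial α) q)) (hgrad ζ q) ≤
      ∫ q, source φ (fun s => 1 / 2 * f s) h C (radial α) q * ζ q := by
  have hlim : Tendsto (fun δ : ℝ => (∫ q, source φ (fun s => 1 / 2 * f s) h C (radial α) q * ζ q) +
      2 * δ * ∫ q, ‖hgrad ζ q‖) (𝓝[>] 0)
      (𝓝 (∫ q, source φ (fun s => 1 / 2 * f s) h C (radial α) q * ζ q)) := by
    refine (Continuous.tendsto' ?_ 0 _ (by simp)).mono_left nhdsWithin_le_nhds
    fun_prop
  refine ge_of_tendsto hlim ?_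
  filter_upwards [self_mem_nhdsWithin] with δ hδ
  exact (hP.neg_integral_le_truncation_add hφ hζ hc hsub hδ).trans
    (add_le_add_left (hP.neg_integral_truncation_le hφ hf hh hD hC hκ hκ' hζ hc hsub hζ0 hδ) _)

end Supersolution

end IsProfile

/-! ### `C¹` test functions -/

section Mollification

open ContinuousLinearMap Convolution

variable {E F : Type*} [NormedAddCommGroup E] [NormedSpace ℝ E] [FiniteDimensional ℝ E]
  [MeasurableSpace E] [BorelSpace E] {μ : Measure E} [μ.IsAddHaarMeasure]
  [NormedAddCommGroup F] [NormedSpace ℝ F]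

theorem tendstoUniformly_normed_convolution [CompleteSpace F] {ι : Type*} {l : Filter ι}
    {b : ι → ContDiffBump (0 : E)} {k : E → F} (hb : Tendsto (fun i => (b i).rOut) l (𝓝 0))
    (hk : UniformContinuous k) :
    TendstoUniformly (fun i => (b i).normed μ ⋆[lsmul ℝ ℝ, μ] k) k l := by
  refine Metric.tendstoUniformly_iff.2 fun η hη => ?_
  obtain ⟨d, hd, hkd⟩ := Metric.uniformContinuous_iff.1 hk (η / 2) (half_pos hη)
  filter_upwards [hb.eventually_lt_const hd] with i hi x
  rw [dist_comm]
  refine ((b i).dist_normed_convolution_le hk.continuous.aestronglyMeasurable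
    fun y hy => ?_).trans_lt (half_lt_self hη)
  exact (hkd ((Metric.mem_ball.1 hy).trans hi)).le

theorem fderiv_normed_convolution (b : ContDiffBump (0 : E)) {ζ : E → ℝ} (hζ : ContDiff ℝ 1 ζ)
    (hc : HasCompactSupport ζ) :
    fderiv ℝ (b.normed μ ⋆[lsmul ℝ ℝ, μ] ζ) = b.normed μ ⋆[lsmul ℝ ℝ, μ] fderiv ℝ ζ := by
  ext1 q
  rw [(hc.hasFDerivAt_convolution_right (lsmul ℝ ℝ)
    (b.continuous_normed.locallyIntegrable (μ := μ)) hζ q).fderiv]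
  refine integral_congr_ae (Eventually.of_forall fun t => ?_)
  ext v
  simp [precompR_apply]

theorem tsupport_normed_convolution_subset (b : ContDiffBump (0 : E)) (ζ : E → F) :
    tsupport (b.normed μ ⋆[lsmul ℝ ℝ, μ] ζ) ⊆ Metric.cthickening b.rOut (tsupport ζ) := by
  refine closure_minimal ((support_convolution_subset _).trans ?_) Metric.isClosed_cthickening
  rintro _ ⟨y, hy, z, hz, rfl⟩
  rw [b.support_normed_eq, mem_ball_zero_iff] at hy
  refine Metric.mem_cthickening_of_dist_le (y + z) z _ _ (subset_tsupport ζ hz) ?_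
  simpa only [dist_eq_norm, add_sub_cancel_right] using hy.le

theorem exists_seq_contDiff_tendstoUniformly {ζ : E → ℝ} {O : Set E} (hO : IsOpen O)
    (hζ : ContDiff ℝ 1 ζ) (hc : HasCompactSupport ζ) (hsub : tsupport ζ ⊆ O)
    (hζ0 : ∀ q, 0 ≤ ζ q) :
    ∃ (K : Set E) (ψ : ℕ → E → ℝ), IsCompact K ∧ K ⊆ O ∧
      (∀ n, ContDiff ℝ (⊤ : ℕ∞) (ψ n) ∧ (∀ q, 0 ≤ ψ n q) ∧ tsupport (ψ n) ⊆ K) ∧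
      TendstoUniformly ψ ζ atTop ∧
      TendstoUniformly (fun n => fderiv ℝ (ψ n)) (fderiv ℝ ζ) atTop := by
  obtain ⟨r, hr, hrO⟩ := hc.isCompact.exists_cthickening_subset_open hO hsub
  have hpos : ∀ n : ℕ, 0 < r * (1 / (n + 1)) := fun n => mul_pos hr Nat.one_div_pos_of_nat
  let b : ℕ → ContDiffBump (0 : E) := fun n =>
    ⟨r * (1 / (n + 1)) / 2, r * (1 / (n + 1)), half_pos (hpos n), half_lt_self (hpos n)⟩
  have hb : Tendsto (fun n => (b n).rOut) atTop (𝓝 0) := by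
    simpa only [mul_zero] using tendsto_one_div_add_atTop_nhds_zero_nat.const_mul r
  have hbr : ∀ n, (b n).rOut ≤ r := fun n =>
    mul_le_of_le_one_right hr.le
      (by simpa using Nat.one_div_le_one_div (α := ℝ) (Nat.zero_le n))
  refine ⟨Metric.cthickening r (tsupport ζ),
    fun n => (b n).normed Measure.addHaar ⋆[lsmul ℝ ℝ, Measure.addHaar] ζ,
    hc.isCompact.cthickening, hrO, fun n => ⟨?_, fun q => ?_, ?_⟩, ?_, ?_⟩
  · exact (b n).hasCompactSupport_normed.contDiff_convolution_left _ (b n).contDiff_normed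
      hζ.continuous.locallyIntegrable
  · exact integral_nonneg fun t => mul_nonneg ((b n).nonneg_normed t) (hζ0 _)
  · exact (tsupport_normed_convolution_subset _ ζ).trans (Metric.cthickening_mono (hbr n) _)
  · exact tendstoUniformly_normed_convolution hb
      (hc.uniformContinuous_of_continuous hζ.continuous)
  · simp only [fderiv_normed_convolution _ hζ hc]
    exact tendstoUniformly_normed_convolution hb
      ((hc.fderiv (𝕜 := ℝ)).uniformContinuous_of_continuous (hζ.continuous_fderiv one_ne_zero))

end Mollification

theorem tendsto_integral_clm_apply {X G : Type*} [TopologicalSpace X] [T2Space X]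
    [SecondCountableTopology X] [MeasurableSpace X] [OpensMeasurableSpace X] {μ : Measure X}
    [IsFiniteMeasureOnCompacts μ] [NormedAddCommGroup G] [NormedSpace ℝ G] {K : Set X}
    (hK : IsCompact K) {A : X → G →L[ℝ] ℝ} (hA : ContinuousOn A K) {T : ℕ → X → G} {S : X → G}
    (hT : ∀ n, Continuous (T n)) (hS : Continuous S) (hT0 : ∀ n, ∀ q ∉ K, T n q = 0)
    (hlim : TendstoUniformly T S atTop) :
    Tendsto (fun n => ∫ q, A q (T n q) ∂μ) atTop (𝓝 (∫ q, A q (S q) ∂μ)) := by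
  have hS0 : ∀ q ∉ K, S q = 0 := fun q hq =>
    tendsto_nhds_unique (hlim.tendsto_at q) (by simp only [hT0 _ q hq, tendsto_const_nhds])
  have hset : ∀ T : X → G, (∀ q ∉ K, T q = 0) → ∫ q, A q (T q) ∂μ = ∫ q in K, A q (T q) ∂μ :=
    fun T hT => (setIntegral_eq_integral_of_forall_compl_eq_zero fun q hq => by
      rw [hT q hq, map_zero]).symm
  rw [hset S hS0, funext fun n => hset (T n) (hT0 n)]
  have hbound : IntegrableOn (fun q => ‖A q‖ * (‖S q‖ + 1)) K μ :=
    (hA.norm.mul (hS.norm.add continuous_const).continuousOn).integrableOn_compact hK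
  refine tendsto_integral_filter_of_dominated_convergence _ ?_ ?_ hbound ?_
  · exact Eventually.of_forall fun n =>
      (hA.clm_apply (hT n).continuousOn).aestronglyMeasurable hK.measurableSet
  · filter_upwards [Metric.tendstoUniformly_iff.1 hlim 1 one_pos] with n hn
    refine Eventually.of_forall fun q => (A q).le_opNorm_of_le ?_
    have hclose := hn q
    rw [dist_comm, dist_eq_norm] at hclose
    exact (norm_le_norm_add_norm_sub' _ _).trans (add_le_add_right hclose.le _)
  · exact Eventually.of_forall fun q => ((A q).continuous.tendsto _).comp (hlim.tendsto_at q)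

section WeakSolution

variable {m : ℕ} {φ f h g : ℝ → ℝ} {τ C D : ℝ} {u ζ ψ : Point m → ℝ} {K : Set (Point m)}

theorem tendsto_integral_mul_of_tendstoUniformly {F : Point m → ℝ} {ψ : ℕ → Point m → ℝ}
    (hK : IsCompact K) (hF : ContinuousOn F K) (hψ : ∀ n, Continuous (ψ n)) (hζ : Continuous ζ)
    (hψK : ∀ n, tsupport (ψ n) ⊆ K) (hlim : TendstoUniformly ψ ζ atTop) :
    Tendsto (fun n => ∫ q, F q * ψ n q) atTop (𝓝 (∫ q, F q * ζ q)) :=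
  tendsto_integral_clm_apply (A := fun q => ContinuousLinearMap.lsmul ℝ ℝ (F q)) hK
    ((ContinuousLinearMap.lsmul ℝ ℝ).continuous.comp_continuousOn hF) hψ hζ
    (fun n _ hq => image_eq_zero_of_notMem_tsupport fun hmem => hq (hψK n hmem)) hlim

theorem tendsto_integral_inner_hgrad_of_tendstoUniformly
    {W : Point m → EuclideanSpace ℝ (Fin m ⊕ Fin m)} {ψ : ℕ → Point m → ℝ} (hK : IsCompact K)
    (hW : ContinuousOn W K) (hψ : ∀ n, ContDiff ℝ 1 (ψ n)) (hζ : ContDiff ℝ 1 ζ)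
    (hψK : ∀ n, tsupport (ψ n) ⊆ K)
    (hlim : TendstoUniformly (fun n => fderiv ℝ (ψ n)) (fderiv ℝ ζ) atTop) :
    Tendsto (fun n => ∫ q, inner ℝ (W q) (hgrad (ψ n) q)) atTop
      (𝓝 (∫ q, inner ℝ (W q) (hgrad ζ q))) := by
  let A : Point m → (Point m →L[ℝ] ℝ) →L[ℝ] ℝ := fun q =>
    ContinuousLinearMap.apply ℝ ℝ (∑ i, W q i • frame i q)
  have hA : ContinuousOn A K :=
    (ContinuousLinearMap.apply ℝ ℝ).continuous.comp_continuousOn <|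
      continuousOn_finsetSum _ fun i _ =>
        ((EuclideanSpace.proj (𝕜 := ℝ) i).continuous.comp_continuousOn hW).smul
          (contDiff_frame i).continuous.continuousOn
  have hAe : ∀ (k : Point m → ℝ) (q : Point m), inner ℝ (W q) (hgrad k q) = A q (fderiv ℝ k q) :=
    fun k q => by simp [A, inner_hgrad_eq_sum]
  simp only [hAe]
  exact tendsto_integral_clm_apply hK hA (fun n => (hψ n).continuous_fderiv one_ne_zero)
    (hζ.continuous_fderiv one_ne_zero)
    (fun n q hq => fderiv_of_notMem_tsupport ℝ fun hmem => hq (hψK n hmem)) hlim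

theorem CondG.exists_le (hg : CondG φ g τ) (hτ : 0 ≤ τ) :
    ∃ C, 0 < C ∧ ∀ s, 0 ≤ s → g s ≤ C * (s ^ 2 * deriv φ s) := by
  obtain ⟨C, hC, hbound⟩ := hg.bound
  refine ⟨C, hC, fun s hs => ?_⟩
  rcases hs.eq_or_lt with rfl | hs
  · have hzero := hbound 0 le_rfl zero_le_one 1 one_pos
    rw [Real.zero_rpow (by linarith)] at hzero
    simpa using hzero
  · simpa [mul_assoc] using hbound 1 zero_le_one le_rfl s hs

theorem CondG.measurable_comp (hg : CondG φ g τ) {X : Type*} [MeasurableSpace X] {s : X → ℝ}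
    (hs : Measurable s) (hs0 : ∀ x, 0 ≤ s x) : Measurable fun x => g (s x) :=
  hg.measurable.comp (hs.subtype_mk (h := hs0))

theorem CondH.map_mul_nonneg (hh : CondH h) (hsub : tsupport ψ ⊆ {q | 0 < u q})
    (hψ0 : ∀ q, 0 ≤ ψ q) (q : Point m) : 0 ≤ h (u q) * ψ q := by
  by_cases hq : q ∈ tsupport ψ
  · exact mul_nonneg (hh.nonneg _ (hsub hq)) (hψ0 q)
  · rw [image_eq_zero_of_notMem_tsupport hq, mul_zero]

theorem source_mul_le (hh : CondH h) (hgC : ∀ s, 0 ≤ s → g s ≤ C * (s ^ 2 * deriv φ s))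
    (hsub : tsupport ψ ⊆ {q | 0 < u q}) (hψ0 : ∀ q, 0 ≤ ψ q) (q : Point m) :
    source φ f h C u q * ψ q ≤ (f (u q) - h (u q) * g ‖hgrad u q‖) * ψ q := by
  rw [source]
  linarith [mul_le_mul_of_nonneg_left (hgC _ (norm_nonneg (hgrad u q)))
    (hh.map_mul_nonneg hsub hψ0 q)]

theorem integrable_sub_mul_of_tsupport_subset (hφ : CondPhi φ) (hf : CondF f) (hh : CondH h)
    (hg : CondG φ g τ) (hD : HasDilationBound φ D)
    (hgC : ∀ s, 0 ≤ s → g s ≤ C * (s ^ 2 * deriv φ s)) (hu : ContDiff ℝ 1 u)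
    (hψ : Continuous ψ) (hc : HasCompactSupport ψ) (hsub : tsupport ψ ⊆ {q | 0 < u q})
    (hψ0 : ∀ q, 0 ≤ ψ q) :
    Integrable fun q => (f (u q) - h (u q) * g ‖hgrad u q‖) * ψ q := by
  have hO : IsOpen {q | 0 < u q} := isOpen_lt continuous_const hu.continuous
  have hfu : ContinuousOn (fun q => f (u q)) {q | 0 < u q} :=
    hf.continuousOn.comp hu.continuous.continuousOn fun q (hq : 0 < u q) => hq.le
  have hhu : ContinuousOn (fun q => h (u q)) {q | 0 < u q} :=
    hh.continuousOn.comp hu.continuous.continuousOn fun _ hq => hq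
  have hgu : Measurable fun q => g ‖hgrad u q‖ :=
    hg.measurable_comp (continuous_hgrad hu).norm.measurable fun _ => norm_nonneg _
  have hmeas : Measurable fun q => f (u q) * ψ q - h (u q) * ψ q * g ‖hgrad u q‖ :=
    (continuous_mul_of_tsupport_subset hO hfu hψ hsub).measurable.sub
      ((continuous_mul_of_tsupport_subset hO hhu hψ hsub).measurable.mul hgu)
  refine integrable_of_le_of_le (g₁ := fun q => source φ f h C u q * ψ q)
    (g₂ := fun q => f (u q) * ψ q) (hmeas.aestronglyMeasurable.congr
      (Eventually.of_forall fun q => by ring))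
    (Eventually.of_forall (source_mul_le hh hgC hsub hψ0)) (Eventually.of_forall fun q => ?_)
    (integrable_mul_of_tsupport_subset hO (continuousOn_source hO hu.contDiffOn (fun _ hq => hq)
      hφ hD (hf.continuousOn.mono Ioi_subset_Ici_self) hh) hψ hc hsub)
    (integrable_mul_of_tsupport_subset hO hfu hψ hc hsub)
  linarith [mul_nonneg (hh.map_mul_nonneg hsub hψ0 q) (hg.nonneg _ (norm_nonneg (hgrad u q)))]

theorem IsWeakSolution.integral_source_mul_le_of_contDiff_top (hsol : IsWeakSolution φ f h g u)
    (hφ : CondPhi φ) (hf : CondF f) (hh : CondH h) (hg : CondG φ g τ)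
    (hD : HasDilationBound φ D) (hgC : ∀ s, 0 ≤ s → g s ≤ C * (s ^ 2 * deriv φ s))
    (hu : ContDiff ℝ 1 u) (hψ : ContDiff ℝ (⊤ : ℕ∞) ψ) (hc : HasCompactSupport ψ)
    (hsub : tsupport ψ ⊆ {q | 0 < u q}) (hψ0 : ∀ q, 0 ≤ ψ q) :
    ∫ q, source φ f h C u q * ψ q ≤ -∫ q, inner ℝ (flux φ (hgrad u q)) (hgrad ψ q) := by
  have hO : IsOpen {q | 0 < u q} := isOpen_lt continuous_const hu.continuous
  have hint := integrable_sub_mul_of_tsupport_subset hφ hf hh hg hD hgC hu hψ.continuous hc hsub hψ0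
  have hweak := hsol ψ hψ hc hψ0
  simp only [gradNorm_eq_norm, gradDot_eq_inner, ← real_inner_smul_left] at hweak
  exact (integral_mono (integrable_mul_of_tsupport_subset hO (continuousOn_source hO
    hu.contDiffOn (fun _ hq => hq) hφ hD (hf.continuousOn.mono Ioi_subset_Ici_self) hh)
    hψ.continuous hc hsub) hint (source_mul_le hh hgC hsub hψ0)).trans (hweak hint)

theorem IsWeakSolution.integral_source_mul_le (hsol : IsWeakSolution φ f h g u)
    (hφ : CondPhi φ) (hf : CondF f) (hh : CondH h) (hg : CondG φ g τ)
    (hD : HasDilationBound φ D) (hgC : ∀ s, 0 ≤ s → g s ≤ C * (s ^ 2 * deriv φ s))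
    (hu : ContDiff ℝ 1 u) (hζ : ContDiff ℝ 1 ζ) (hc : HasCompactSupport ζ)
    (hsub : tsupport ζ ⊆ {q | 0 < u q}) (hζ0 : ∀ q, 0 ≤ ζ q) :
    ∫ q, source φ f h C u q * ζ q ≤ -∫ q, inner ℝ (flux φ (hgrad u q)) (hgrad ζ q) := by
  have hO : IsOpen {q | 0 < u q} := isOpen_lt continuous_const hu.continuous
  obtain ⟨K, ψ, hK, hKO, hψ, hlim, hlim'⟩ :=
    exists_seq_contDiff_tendstoUniformly hO hζ hc hsub hζ0
  have hψ1 : ∀ n, ContDiff ℝ 1 (ψ n) := fun n => (hψ n).1.of_le (by exact_mod_cast le_top)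
  have hsource : ContinuousOn (source φ f h C u) K := (continuousOn_source hO hu.contDiffOn
    (fun _ hq => hq) hφ hD (hf.continuousOn.mono Ioi_subset_Ici_self) hh).mono hKO
  have hflux : Continuous fun q => flux φ (hgrad u q) :=
    (continuous_flux hφ.continuousOn hφ.map_zero).comp (continuous_hgrad hu)
  refine le_of_tendsto_of_tendsto'
    (tendsto_integral_mul_of_tendstoUniformly hK hsource (fun n => (hψ1 n).continuous)
      hζ.continuous (fun n => (hψ n).2.2) hlim)
    (tendsto_integral_inner_hgrad_of_tendstoUniformly hK hflux.continuousOn hψ1 hζ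
      (fun n => (hψ n).2.2) hlim').neg fun n => ?_
  exact hsol.integral_source_mul_le_of_contDiff_top hφ hf hh hg hD hgC hu (hψ n).1
    (hK.of_isClosed_subset (isClosed_tsupport _) (hψ n).2.2) ((hψ n).2.2.trans hKO) (hψ n).2.1

end WeakSolution

/-! ### Weak comparison -/

section Cutoff

variable {E : Type*} {B U : Set E} {w : E → ℝ} {c : ℝ} {q : E}

/-- The truncation `((w - c)⁺)²` on `B`, extended by `0`: the test function of the comparison
principle. It is `C¹` as soon as `w` is `C¹` and `w < c` on the boundary of `B`. -/
noncomputable def cutoff (B : Set E) (w : E → ℝ) (c : ℝ) : E → ℝ :=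
  B.indicator fun q => (max (w q - c) 0) ^ 2

theorem cutoff_nonneg (B : Set E) (w : E → ℝ) (c : ℝ) (q : E) : 0 ≤ cutoff B w c q :=
  indicator_nonneg (fun _ _ => sq_nonneg _) q

theorem cutoff_eq_zero_of_le (hq : w q ≤ c) : cutoff B w c q = 0 :=
  indicator_apply_eq_zero.2 fun _ => by rw [max_eq_right (sub_nonpos.2 hq), zero_pow two_ne_zero]

theorem cutoff_pos (hq : q ∈ B) (hcq : c < w q) : 0 < cutoff B w c q := by
  rw [cutoff, indicator_of_mem hq]
  exact pow_pos (lt_max_of_lt_left (sub_pos.2 hcq)) 2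

section Topological

variable [TopologicalSpace E]

theorem cutoff_eventuallyEq (hB : IsOpen B) (hq : q ∈ B) :
    cutoff B w c =ᶠ[𝓝 q] fun q => (max (w q - c) 0) ^ 2 := by
  filter_upwards [hB.mem_nhds hq] with y hy using indicator_of_mem hy _

theorem cutoff_eventuallyEq_zero (hU : IsOpen U) (hw : ContinuousOn w U) (hB : IsOpen B)
    (hBU : closure B ⊆ U) (hc : ∀ q ∈ frontier B, w q < c) (hq : q ∉ B) :
    cutoff B w c =ᶠ[𝓝 q] fun _ => 0 := by
  by_cases hqB : q ∈ closure B
  · filter_upwards [(hw.continuousAt (hU.mem_nhds (hBU hqB))).eventually_lt_const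
      (hc q (hB.frontier_eq ▸ ⟨hqB, hq⟩))] with y hy using cutoff_eq_zero_of_le hy.le
  · filter_upwards [isClosed_closure.isOpen_compl.mem_nhds hqB] with y hy
    exact indicator_of_notMem (fun h => hy (subset_closure h)) _

theorem isCompact_closure_inter_superlevel (hB : IsCompact (closure B))
    (hw : ContinuousOn w (closure B)) (c : ℝ) : IsCompact (closure B ∩ w ⁻¹' Ici c) :=
  hB.of_isClosed_subset (hw.preimage_isClosed_of_isClosed isClosed_closure isClosed_Ici)
    inter_subset_left

theorem tsupport_cutoff_subset (hw : ContinuousOn w (closure B)) :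
    tsupport (cutoff B w c) ⊆ closure B ∩ w ⁻¹' Ici c := by
  refine closure_minimal (fun q hq => ?_)
    (hw.preimage_isClosed_of_isClosed isClosed_closure isClosed_Ici)
  have hqB : q ∈ B := by
    by_contra hqB
    exact hq (indicator_of_notMem hqB _)
  exact ⟨subset_closure hqB, not_lt.1 fun hqc => hq (cutoff_eq_zero_of_le hqc.le)⟩

end Topological

theorem contDiff_cutoff [NormedAddCommGroup E] [NormedSpace ℝ E] (hU : IsOpen U)
    (hw : ContDiffOn ℝ 1 w U) (hB : IsOpen B) (hBU : closure B ⊆ U)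
    (hc : ∀ q ∈ frontier B, w q < c) : ContDiff ℝ 1 (cutoff B w c) := by
  refine contDiff_iff_contDiffAt.2 fun q => ?_
  by_cases hq : q ∈ B
  · exact (contDiff_max_zero_sq.contDiffAt.comp q ((hw.contDiffAt (hU.mem_nhds
      (hBU (subset_closure hq)))).sub contDiffAt_const)).congr_of_eventuallyEq
      (cutoff_eventuallyEq hB hq)
  · exact contDiffAt_const.congr_of_eventuallyEq
      (cutoff_eventuallyEq_zero hU hw.continuousOn hB hBU hc hq)

theorem integral_mul_cutoff_pos [TopologicalSpace E] [MeasurableSpace E]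
    [OpensMeasurableSpace E] {μ : Measure E} [IsFiniteMeasureOnCompacts μ] [μ.IsOpenPosMeasure]
    {O : Set E} {e : E → ℝ} (hO : IsOpen O) (he : ContinuousOn e O)
    (hcont : Continuous (cutoff B w c)) (hcomp : HasCompactSupport (cutoff B w c))
    (hsub : tsupport (cutoff B w c) ⊆ O) (hpos : ∀ q ∈ B, c < w q → 0 < e q) (hq : q ∈ B)
    (hcq : c < w q) : 0 < ∫ q, e q * cutoff B w c q ∂μ := by
  refine Continuous.integral_pos_of_hasCompactSupport_nonneg_nonzero (x := q)
    (continuous_mul_of_tsupport_subset hO he hcont hsub) hcomp.mul_left (fun y => ?_)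
    (mul_pos (hpos q hq hcq) (cutoff_pos hq hcq)).ne'
  rcases le_or_gt (w y) c with hy | hy
  · simp only [cutoff_eq_zero_of_le hy, mul_zero, Pi.zero_apply, le_refl]
  · by_cases hyB : y ∈ B
    · exact mul_nonneg (hpos y hyB hy).le (cutoff_nonneg B w c y)
    · simp only [cutoff, indicator_of_notMem hyB, mul_zero, Pi.zero_apply, le_refl]

end Cutoff

theorem exists_superlevel_pos {X : Type*} [TopologicalSpace X] [T2Space X] {K : Set X}
    {w e : X → ℝ} {a b : ℝ} (hK : IsCompact (K ∩ w ⁻¹' Ici a))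
    (hw : ContinuousOn w (K ∩ w ⁻¹' Ici a)) (he : ContinuousOn e (K ∩ w ⁻¹' Ici a)) (hab : a < b)
    (hle : ∀ q ∈ K, w q ≤ b) (hpos : ∀ q ∈ K, w q = b → 0 < e q) :
    ∃ c, a ≤ c ∧ c < b ∧ ∀ q ∈ K, c < w q → 0 < e q := by
  set Z := K ∩ w ⁻¹' Ici a ∩ e ⁻¹' Iic 0
  have hZ : IsCompact Z := hK.of_isClosed_subset
    (he.preimage_isClosed_of_isClosed hK.isClosed isClosed_Iic) inter_subset_left
  rcases Z.eq_empty_or_nonempty with hempty | hne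
  · refine ⟨a, le_rfl, hab, fun q hq hwq => ?_⟩
    by_contra! heq
    exact (hempty ▸ (⟨⟨hq, hwq.le⟩, heq⟩ : q ∈ Z) : q ∈ (∅ : Set X))
  · obtain ⟨z, hz, hzmax⟩ := hZ.exists_isMaxOn hne (hw.mono inter_subset_left)
    refine ⟨w z, hz.1.2, (hle z hz.1.1).lt_of_ne fun hzb => ?_, fun q hq hwq => ?_⟩
    · exact (hpos z hz.1.1 hzb).not_ge hz.2
    · by_contra! heq
      exact (hzmax (⟨⟨hq, (mem_Ici.1 hz.1.2).trans hwq.le⟩, heq⟩ : q ∈ Z)).not_gt hwq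

section Comparison

variable {m : ℕ} {B O U : Set (Point m)} {Γ : ℝ → ℝ} {u v w eu ev : Point m → ℝ} {c : ℝ}
  {q : Point m}

theorem hgrad_cutoff (hB : IsOpen B) (hw : DifferentiableAt ℝ w q) (hq : q ∈ B) :
    hgrad (cutoff B w c) q = (2 * max (w q - c) 0) • hgrad w q := by
  rw [hgrad_congr (cutoff_eventuallyEq hB hq)]
  exact hgrad_comp (f := fun y => (max (y - c) 0) ^ 2)
    ((hasDerivAt_max_zero_sq (w q - c)).comp_sub_const (w q) c) hw

theorem hgrad_cutoff_eq_zero (hU : IsOpen U) (hw : ContinuousOn w U) (hB : IsOpen B)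
    (hBU : closure B ⊆ U) (hc : ∀ q ∈ frontier B, w q < c) (hq : q ∉ B) :
    hgrad (cutoff B w c) q = 0 := by
  rw [hgrad_congr (cutoff_eventuallyEq_zero hU hw hB hBU hc hq)]
  ext i
  simp [hgrad_apply]

theorem hgrad_eq_of_isLocalMax_sub (hu : DifferentiableAt ℝ u q) (hv : DifferentiableAt ℝ v q)
    (hmax : IsLocalMax (fun q => u q - v q) q) : hgrad u q = hgrad v q := by
  rw [← sub_eq_zero, ← hgrad_sub hu hv]
  ext i
  simp [hgrad_apply, hmax.fderiv_eq_zero]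

theorem inner_flux_sub_hgrad_cutoff_nonneg (hΓ : MonotoneOn Γ (Ici 0)) (hΓ0 : Γ 0 = 0)
    (hU : IsOpen U) (hu : ContDiffOn ℝ 1 u U) (hv : ContDiffOn ℝ 1 v U) (hB : IsOpen B)
    (hBU : closure B ⊆ U) (hc : ∀ q ∈ frontier B, u q - v q < c) (q : Point m) :
    0 ≤ inner ℝ (flux Γ (hgrad u q) - flux Γ (hgrad v q))
      (hgrad (cutoff B (fun q => u q - v q) c) q) := by
  by_cases hq : q ∈ B
  · have hqU := hU.mem_nhds (hBU (subset_closure hq))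
    have hud := (hu.contDiffAt hqU).differentiableAt one_ne_zero
    have hvd := (hv.contDiffAt hqU).differentiableAt one_ne_zero
    rw [hgrad_cutoff hB (hud.fun_sub hvd) hq, hgrad_sub hud hvd, real_inner_smul_right]
    exact mul_nonneg (mul_nonneg two_pos.le (le_max_right _ _)) (inner_flux_sub_nonneg hΓ hΓ0 _ _)
  · rw [hgrad_cutoff_eq_zero (w := fun q => u q - v q) hU
      (hu.continuousOn.sub hv.continuousOn) hB hBU hc hq, inner_zero_right]

theorem integral_inner_flux_hgrad_cutoff_le (hΓ : MonotoneOn Γ (Ici 0))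
    (hΓc : ContinuousOn Γ (Ici 0)) (hΓ0 : Γ 0 = 0) (hU : IsOpen U) (hu : ContDiffOn ℝ 1 u U)
    (hv : ContDiffOn ℝ 1 v U) (hB : IsOpen B) (hBc : IsCompact (closure B)) (hBU : closure B ⊆ U)
    (hc : ∀ q ∈ frontier B, u q - v q < c) :
    ∫ q, inner ℝ (flux Γ (hgrad v q)) (hgrad (cutoff B (fun q => u q - v q) c) q) ≤
      ∫ q, inner ℝ (flux Γ (hgrad u q)) (hgrad (cutoff B (fun q => u q - v q) c) q) := by
  have hw := hu.sub hv
  have hζ := contDiff_cutoff hU hw hB hBU hc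
  have hsub := tsupport_cutoff_subset (c := c) (hw.continuousOn.mono hBU)
  have hζc : HasCompactSupport (cutoff B (fun q => u q - v q) c) :=
    hBc.of_isClosed_subset (isClosed_tsupport _) (hsub.trans inter_subset_left)
  have hint : ∀ {k : Point m → ℝ}, ContDiffOn ℝ 1 k U → Integrable fun q =>
      inner ℝ (flux Γ (hgrad k q)) (hgrad (cutoff B (fun q => u q - v q) c) q) := fun hk =>
    integrable_inner_hgrad hU ((continuous_flux hΓc hΓ0).comp_continuousOn
      (continuousOn_hgrad hU hk)) hζ hζc ((hsub.trans inter_subset_left).trans hBU)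
  refine integral_mono (hint hv) (hint hu) fun q => ?_
  have h := inner_flux_sub_hgrad_cutoff_nonneg hΓ hΓ0 hU hu hv hB hBU hc q
  rwa [inner_sub_left, sub_nonneg] at h

theorem exists_superlevel_lt (hU : IsOpen U) (hu : ContDiffOn ℝ 1 u U) (hv : ContDiffOn ℝ 1 v U)
    (hB : IsOpen B) (hBc : IsCompact (closure B)) (hBU : closure B ⊆ U)
    (hlt : ∀ q ∈ frontier B, u q < v q)
    (heu : ContinuousOn eu (closure B ∩ {q | v q ≤ u q}))
    (hev : ContinuousOn ev (closure B ∩ {q | v q ≤ u q}))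
    (he : ∀ q ∈ B, v q < u q → hgrad u q = hgrad v q → ev q < eu q)
    (hq : q ∈ closure B) (hvu : v q < u q) :
    ∃ c, 0 ≤ c ∧ (∃ x ∈ B, c < u x - v x) ∧ ∀ q ∈ B, c < u q - v q → ev q < eu q := by
  have hw := hu.continuousOn.sub hv.continuousOn
  have hset : closure B ∩ (fun q => u q - v q) ⁻¹' Ici 0 = closure B ∩ {q | v q ≤ u q} := by
    ext; simp
  obtain ⟨x, hx, hxmax⟩ := hBc.exists_isMaxOn ⟨q, hq⟩ (hw.mono hBU)
  have hxpos : 0 < u x - v x := (sub_pos.2 hvu).trans_le (hxmax hq)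
  have hmemB : ∀ y ∈ closure B, u y - v y = u x - v x → y ∈ B := fun y hy hyx => by
    by_contra hyB
    linarith [hlt y (hB.frontier_eq ▸ ⟨hy, hyB⟩)]
  have hmax : ∀ y ∈ closure B, u y - v y = u x - v x → 0 < eu y - ev y := fun y hy hyx => by
    have hyB := hmemB y hy hyx
    have hyU := hU.mem_nhds (hBU hy)
    refine sub_pos.2 (he y hyB (sub_pos.1 (hyx ▸ hxpos)) (hgrad_eq_of_isLocalMax_sub
      ((hu.contDiffAt hyU).differentiableAt one_ne_zero)
      ((hv.contDiffAt hyU).differentiableAt one_ne_zero) ?_))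
    filter_upwards [hB.mem_nhds hyB] with z hz
    exact (hxmax (subset_closure hz)).trans hyx.ge
  obtain ⟨c, hc0, hcx, hc⟩ := exists_superlevel_pos
    (isCompact_closure_inter_superlevel hBc (hw.mono hBU) 0)
    (hw.mono (inter_subset_left.trans hBU)) (hset ▸ heu.sub hev) hxpos hxmax hmax
  exact ⟨c, hc0, ⟨x, hmemB x hx rfl, hcx⟩,
    fun q hq hcq => sub_pos.1 (hc q (subset_closure hq) hcq)⟩

/-- The right-hand sides are comparable only where the gradients agree, in particular at a maximum
of `u - v`; hence the truncation level is chosen so close to that maximum that `ev < eu` on the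
support of the test function. -/
theorem le_of_integral_le (hΓ : MonotoneOn Γ (Ici 0)) (hΓc : ContinuousOn Γ (Ici 0))
    (hΓ0 : Γ 0 = 0) (hU : IsOpen U) (hu : ContDiffOn ℝ 1 u U) (hv : ContDiffOn ℝ 1 v U)
    (hB : IsOpen B) (hBc : IsCompact (closure B)) (hBU : closure B ⊆ U)
    (hlt : ∀ q ∈ frontier B, u q < v q) (hO : IsOpen O)
    (hsubO : closure B ∩ {q | v q ≤ u q} ⊆ O) (heu : ContinuousOn eu O) (hev : ContinuousOn ev O)
    (he : ∀ q ∈ B, v q < u q → hgrad u q = hgrad v q → ev q < eu q)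
    (hsubsol : ∀ ζ, ContDiff ℝ 1 ζ → HasCompactSupport ζ → tsupport ζ ⊆ O → (∀ q, 0 ≤ ζ q) →
      ∫ q, eu q * ζ q ≤ -∫ q, inner ℝ (flux Γ (hgrad u q)) (hgrad ζ q))
    (hsupersol : ∀ ζ, ContDiff ℝ 1 ζ → HasCompactSupport ζ → tsupport ζ ⊆ O → (∀ q, 0 ≤ ζ q) →
      -∫ q, inner ℝ (flux Γ (hgrad v q)) (hgrad ζ q) ≤ ∫ q, ev q * ζ q)
    (hq : q ∈ closure B) : u q ≤ v q := by
  by_contra! hvu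
  obtain ⟨c, hc0, ⟨x, hx, hcx⟩, hc⟩ := exists_superlevel_lt hU hu hv hB hBc hBU hlt
    (heu.mono hsubO) (hev.mono hsubO) he hq hvu
  set ζ := cutoff B (fun q => u q - v q) c
  have hneg : ∀ q ∈ frontier B, u q - v q < c := fun q hq => (sub_neg.2 (hlt q hq)).trans_le hc0
  have hw := hu.sub hv
  have hζ : ContDiff ℝ 1 ζ := contDiff_cutoff hU hw hB hBU hneg
  have hsupp : tsupport ζ ⊆ closure B ∩ (fun q => u q - v q) ⁻¹' Ici c :=
    tsupport_cutoff_subset (hw.continuousOn.mono hBU)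
  have hζc : HasCompactSupport ζ :=
    hBc.of_isClosed_subset (isClosed_tsupport _) (hsupp.trans inter_subset_left)
  have hζO : tsupport ζ ⊆ O := fun q hq =>
    hsubO ⟨(hsupp hq).1, sub_nonneg.1 (hc0.trans (hsupp hq).2)⟩
  have hζ0 : ∀ q, 0 ≤ ζ q := cutoff_nonneg B _ c
  have hpos : 0 < ∫ q, (eu q - ev q) * ζ q := integral_mul_cutoff_pos hO (heu.sub hev)
    hζ.continuous hζc hζO (fun q hq hcq => sub_pos.2 (hc q hq hcq)) hx hcx
  simp only [sub_mul] at hpos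
  rw [integral_sub (integrable_mul_of_tsupport_subset hO heu hζ.continuous hζc hζO)
    (integrable_mul_of_tsupport_subset hO hev hζ.continuous hζc hζO)] at hpos
  linarith [hsubsol ζ hζ hζc hζO hζ0, hsupersol ζ hζ hζc hζO hζ0,
    integral_inner_flux_hgrad_cutoff_le hΓ hΓc hΓ0 hU hu hv hB hBc hBU hneg]

end Comparison

section Barrier

variable {m : ℕ} {φ f h g : ℝ → ℝ} {τ ε κ r R C D : ℝ} {α p p' : ℝ → ℝ} {u v : Point m → ℝ}
  {q : Point m}

theorem source_half_lt_source (hφ : CondPhi φ) (hf : CondF f) (hh : CondH h) (hC : 0 ≤ C)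
    (hv : 0 < v q) (hvu : v q < u q) (hgrad_eq : hgrad u q = hgrad v q) :
    source φ (fun s => 1 / 2 * f s) h C v q < source φ f h C u q := by
  have hfm : f (v q) ≤ f (u q) := hf.monotoneOn hv.le (hv.trans hvu).le hvu.le
  have hhm : h (u q) ≤ h (v q) := hh.antitoneOn hv (hv.trans hvu) hvu.le
  have hgrad_term : 0 ≤ C * (‖hgrad v q‖ ^ 2 * deriv φ ‖hgrad v q‖) := by
    rcases (norm_nonneg (hgrad v q)).eq_or_lt with h0 | hpos
    · simp [← h0]
    · exact mul_nonneg hC (mul_nonneg (sq_nonneg _) (hφ.deriv_pos _ hpos).le)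
  rw [source, source, hgrad_eq]
  linarith [mul_le_mul_of_nonneg_right hhm hgrad_term, hf.pos _ hv]

theorem IsProfile.le_of_isWeakSolution (hP : IsProfile φ f h ε κ R α p p') (hφ : CondPhi φ)
    (hf : CondF f) (hh : CondH h) (hg : CondG φ g τ) (hD : HasDilationBound φ D) (hC : 0 ≤ C)
    (hgC : ∀ s, 0 ≤ s → g s ≤ C * (s ^ 2 * deriv φ s)) (hκ : 0 ≤ κ)
    (hκ' : (D + (2 * m + 1) + C * D) * κ ≤ 1 / 2) (hu : ContDiff ℝ 1 u)
    (hsol : IsWeakSolution φ f h g u) (hrR : r < R) (hlt : ∀ q, gauge q = r → u q < α r)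
    (hq : gauge q < r) : u q ≤ α (gauge q) := by
  have hle : closure {q : Point m | gauge q < r} ⊆ {q | gauge q ≤ r} :=
    closure_lt_subset_le continuous_gauge continuous_const
  have hU := isOpen_gauge_lt (m := m) R
  have hpos : IsOpen {q | 0 < u q} := isOpen_lt continuous_const hu.continuous
  refine le_of_integral_le (v := radial α) (eu := source φ f h C u)
    (ev := source φ (fun s => 1 / 2 * f s) h C (radial α)) hφ.strictMonoOn.monotoneOn
    hφ.continuousOn hφ.map_zero hU hu.contDiffOn hP.contDiffOn_radial (isOpen_gauge_lt r)
    ((isCompact_gauge_le r).of_isClosed_subset isClosed_closure hle)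
    (fun q hq => (hle hq).trans_lt hrR) (fun q hq => ?_) (hU.inter hpos)
    (fun q hq => ⟨(hle hq.1).trans_lt hrR, (hP.pos ((hle hq.1).trans_lt hrR)).trans_le hq.2⟩)
    ?_ ?_ (fun q hq => source_half_lt_source hφ hf hh hC (hP.pos (hq.trans hrR))) ?_ ?_
    (subset_closure hq)
  · have hqr : gauge q = r := frontier_lt_subset_eq continuous_gauge continuous_const hq
    rw [radial, hqr]
    exact hlt q hqr
  · exact (Heisenberg.continuousOn_source hpos hu.contDiffOn (fun _ hq => hq) hφ hD
      (hf.continuousOn.mono Ioi_subset_Ici_self) hh).mono inter_subset_right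
  · exact (hP.continuousOn_source hφ hf hh hD C).mono inter_subset_left
  · exact fun ζ hζ hc hsub => hsol.integral_source_mul_le hφ hf hh hg hD hgC hu hζ hc
      (hsub.trans inter_subset_right)
  · exact fun ζ hζ hc hsub => hP.neg_integral_inner_flux_le hφ hf hh hD hC hκ hκ' hζ hc
      (hsub.trans inter_subset_left)

end Barrier

end Heisenberg

theorem mainTheorem4_general (m : ℕ) (φ f h g : ℝ → ℝ) (τ θ : ℝ)
    (hφ : Heisenberg.CondPhi φ) (hf : Heisenberg.CondF f) (hh : Heisenberg.CondH h)
    (hg : Heisenberg.CondG φ g τ)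
    (hφ0 : Heisenberg.CondPhi0 φ) (hφ2 : Heisenberg.CondPhi2 φ τ)
    (hφ3 : Heisenberg.CondPhi3 φ θ)
    (hKO : Heisenberg.KellerOsserman φ f h θ)
    (u : Heisenberg.Point m → ℝ) (hu : ContDiff ℝ 1 u)
    (hsol : Heisenberg.IsWeakSolution φ f h g u) :
    ∀ q, u q ≤ 0 := by
  intro q₀
  by_contra! hpos
  obtain ⟨C, hC, hgC⟩ := hg.exists_le hφ2.1
  obtain ⟨D, hD0, hD⟩ := hφ2.exists_hasDilationBound hφ
  have hden : 0 < D + (2 * (m : ℝ) + 1) + C * D := by positivity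
  have hκ : 0 < 1 / 2 / (D + (2 * (m : ℝ) + 1) + C * D) := by positivity
  obtain ⟨R, α, p, p', hP, hρR, hα⟩ := Heisenberg.exists_isProfile hφ hφ0 hφ2 hφ3 hf hh hKO
    (half_pos hpos) hκ (Heisenberg.gauge q₀) (half_lt_self hpos)
  obtain ⟨M, hM⟩ := (Heisenberg.isCompact_gauge_le (m := m) R).bddAbove_image
    hu.continuous.continuousOn
  obtain ⟨r, hMr, hρr, hrR⟩ := ((hP.tendsto_atTop.eventually_gt_atTop M).and
    (Ioo_mem_nhdsLT hρR)).exists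
  refine (hP.le_of_isWeakSolution hφ hf hh hg hD hC.le hgC hκ.le (mul_div_cancel₀ _ hden.ne').le
    hu hsol hrR (fun q hq => ?_) hρr).not_gt hα
  exact (hM ⟨q, (hq.trans_lt hrR).le, rfl⟩).trans_lt hMr

theorem mainTheorem4 (m : ℕ) (φ f h g : ℝ → ℝ) (τ θ : ℝ)
    (hφ : Heisenberg.CondPhi φ) (hf : Heisenberg.CondF f) (hh : Heisenberg.CondH h)
    (hg : Heisenberg.CondG φ g τ)
    (hφ0 : Heisenberg.CondPhi0 φ) (hφ2 : Heisenberg.CondPhi2 φ τ)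
    (hφ3 : Heisenberg.CondPhi3 φ θ)
    (hKO : Heisenberg.KellerOsserman φ f h θ)
    (u : Heisenberg.Point m → ℝ) (hu : ContDiff ℝ 1 u) (hu0 : ∀ q, 0 ≤ u q)
    (hsol : Heisenberg.IsWeakSolution φ f h g u) :
    ∀ q, u q = 0 := fun q =>
  (mainTheorem4_general m φ f h g τ θ hφ hf hh hg hφ0 hφ2 hφ3 hKO u hu hsol q).antisymm (hu0 q)
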